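/- Let $N\ge 2$, $\eta=2\pi/N$, $\omega=e^{i\eta}$, and $$S(\theta)=\frac{\sinh\frac12(\theta+i\eta)}{\sinh\frac12(\theta-i\eta)},\quad \phi(z)=\frac1{\sinh\frac12 z\,\sinh\frac12(z+i\eta)},\quad \varkappa(z)=\frac1{\phi(z)},\quad \tau(z)=\frac1{\phi(z)\phi(-z)} .$$ Write $\theta_{ij}=\theta_i-\theta_j$. For $1\le\alpha\le N-2$ let $S_{1\alpha}(\theta)=\prod_{j=1}^{\alpha}S\big(\theta+i\eta(j-\tfrac{\alpha+1}2)\big)$ and $\Gamma_\alpha=i\,\big|\operatorname{Res}_{\theta=i\eta(\alpha+1)/2}S_{1\alpha}(\theta)\big|^{1/2}$. For integers $0\le Q,\tilde Q\le N-1$ put $$s=\min(Q,\tilde Q)-\frac{Q\tilde Q}{N},\qquad \sigma=\omega^{\tilde Q}.$$ For $n=Nl+Q$, $l=0,1,2,\dots$, let $m_k=l+1$ for $1\le k\le Q$ and $m_k=l$ for $Q<k\le N-1$, and for $\underline\theta=(\theta_1,\dots,\theta_n)$, $\underline z=(z_{kj})_{1\le k\le N-1,\,1\le j\le m_k}$ put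 $$p_{n\underline m}(\underline\theta,\underline z)=\rho_n\exp\Big(\sum_{k=1}^{\tilde Q}\sum_{j=1}^{m_k}z_{kj}-\frac{\tilde Q}{N}\sum_{i=1}^n\theta_i\Big),\qquad \rho_n=\exp\Big(\frac{i\pi}{N}\,\tilde Q(\tilde Q-N+2)\frac nN\Big).$$ **(A)** For every such $n$ the function $p_{n\underline m}$ is analytic in all variables and satisfies: (i') it is symmetric in $\theta_1,\dots,\theta_n$; (ii') $\sigma\,p_{n\underline m}(\theta_1+2\pi i,\theta_2,\dots,\underline z)=p_{n\underline m}(\theta_1,\theta_2,\dots,\underline z)$ if $n\ge1$; (iii') if $n\ge N$ and $\theta_{k,k+1}=i\eta$ for $k=1,\dots,N-1$, then $$p_{n\underline m}\big|_{z_{k1}=\theta_k\,(1\le k\le N-1)}=\sigma\,p_{n\underline m}\big|_{z_{k1}=\theta_{k+1}\,(1\le k\le N-1)}=\sigma\,p_{n-N,\underline m-1}(\underline\theta',\underline z'),$$ where $\underline\theta'=(\theta_{N+1},\dots,\theta_n)$ and $\underline z'=(z_{kj})_{j\ge2}$; (v') $p_{n\underline m}(\underline\theta+\mu,\underline z+\mu)=e^{s\mu}p_{n\underline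 m}(\underline\theta,\underline z)$ for all $\mu\in\mathbb C$. **(B)** There is a (unique) meromorphic function $F$ on $\mathbb C$ with $$F(\theta)=c_N\exp\int_0^\infty\frac{dt}{t}\,\frac{2\cosh\frac tN\,\sinh\frac{N-1}Nt}{\sinh^2t}\Big(1-\cosh t\big(1-\tfrac{\theta}{i\pi}\big)\Big)\qquad(0<\operatorname{Im}\theta<2\pi),$$ $$c_N=e^{i\pi\frac{N-1}N}\exp\int_0^\infty\frac{dt}{t\sinh t}\Big(1-\frac2N-\frac{\sinh t(1-\frac2N)}{\sinh t}\Big).$$ For each $Q$ and each prescribed value of $N_Q$ there are constants $N_n$ ($n\equiv Q$ mod $N$) with $$N_{n}\Big(\operatorname*{Res}_{\theta=i\eta}\phi(-\theta)\Big)^{N-1}\prod_{k=1}^{N-2}\phi(ki\eta)^k\prod_{k=1}^{N-1}F(ki\eta)^{N-k}=N_{n-N}\,2i\prod_{\alpha=1}^{N-2}\sqrt2\,\Gamma_\alpha\qquad(n\ge N).\tag{1}$$ For such constants put $F_n=0$ if $n\not\equiv Q$ mod $N$, and for $n\equiv Q$ mod $N$, $n\ge0$, $$F_n(\underline\theta)=N_n\,I_n(\underline\theta)\prod_{1\le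 i<j\le n}F(\theta_{ij}),\qquad I_n(\underline\theta)=\Big(\prod_{k=1}^{N-1}\frac1{m_k!}\prod_{j=1}^{m_k}\int_{\mathcal C_{\underline\theta}}\frac{dz_{kj}}{R}\Big)h(\underline\theta,\underline z)\,p_{n\underline m}(\underline\theta,\underline z),$$ $$h=\prod_{k=1}^{N-1}\Big(\prod_{j=1}^{m_k}\prod_{i=1}^n\phi(z_{kj}-\theta_i)\prod_{1\le i<j\le m_k}\tau(z_{ki}-z_{kj})\Big)\prod_{1\le k<l\le N-1}\prod_{i=1}^{m_k}\prod_{j=1}^{m_l}\varkappa(z_{ki}-z_{lj}),$$ where $\mathcal C_{\underline\theta}$ consists of small equally oriented circles around the points $\theta_1,\dots,\theta_n$ and $R=\int_{\mathcal C_\theta}\phi(z-\theta)\,dz$, with $\mathcal C_\theta$ one such circle around the single point $\theta$. Then the $F_n$ are, in the sector of particles of type 1, form factors of a field with charge $Q$, spin $s$ and statistics factor $\sigma$. That is, for all $n$, $F_n$ is meromorphic on $\mathbb C^n$ and analytic where no difference $\theta_{ij}$ is $\equiv i\eta$ mod $2\pi i$; there (i) $F_n(\dots,\theta_i,\theta_{i+1},\dots)=F_n(\dots,\theta_{i+1},\theta_i,\dots)\,S(\theta_{i,i+1})$;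 (ii) $\sigma F_n(\theta_1+i\pi,\theta_2,\dots,\theta_n)=F_n(\theta_2,\dots,\theta_n,\theta_1-i\pi)$ (for arguments in that domain); (v) $F_n(\underline\theta+\mu)=e^{s\mu}F_n(\underline\theta)$; and, for $\theta_{N+1},\dots,\theta_n$ in that domain and all $\theta_i-\theta_N\notin i\eta\mathbb Z$ ($i>N$), the annihilation and bound state equations (iii), (iv) hold in the form $$\operatorname*{Res}_{\theta_{N-1,N}=i\eta}\cdots\operatorname*{Res}_{\theta_{12}=i\eta}F_n(\theta_1,\dots,\theta_n)=2i\,F_{n-N}(\theta_{N+1},\dots,\theta_n)\Big(1-\sigma\prod_{i=N+1}^nS(\theta_{Ni})\Big)\prod_{\alpha=1}^{N-2}\sqrt2\,\Gamma_\alpha ,$$ all residues being those of at most simple poles; likewise the iterated residues $\operatorname{Res}_{\theta_{r-1,r}=i\eta}\cdots\operatorname{Res}_{\theta_{12}=i\eta}F_n$, $1\le r<N$, which define the form factors with one bound state of $r$ particles of type 1, exist for $\theta_{r+1},\dots,\theta_n$ in that domain with all $\theta_i-\theta_r\notin i\eta\mathbb Z$ ($i>r$). This includes the order parameters $\sigma_Q$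 ($\tilde Q=0$: $\sigma=1$, $s=0$), the disorder parameters $\mu_{\tilde Q}$ ($Q=0$: $\sigma=\omega^{\tilde Q}$, $s=0$) and the para-fermi fields $\psi_Q$ ($\tilde Q=Q$: $\sigma=\omega^Q$, $s=Q(N-Q)/N$). **(C)** Up to non-zero constant factors (if the normalization constant involved is non-zero): for $\sigma_1$: $F_1(\theta)=1$; for $\sigma_2$ ($N\ge3$): $$F_2(\theta_1,\theta_2)=\frac{F(\theta_{12})}{\sinh\frac12(\theta_{12}-\frac{2\pi i}N)\sinh\frac12(\theta_{12}+\frac{2\pi i}N)};$$ for $\psi_Q$ ($1\le Q\le N-1$) the form factor of one particle of type $Q$ and rapidity $\theta$, that is $\operatorname{Res}_{\theta_{Q-1,Q}=i\eta}\cdots\operatorname{Res}_{\theta_{12}=i\eta}F_Q(\theta_1,\dots,\theta_Q)$ with $\theta=\theta_Q+\frac{Q-1}2i\eta$ (the mean of the $\theta_i$), is $e^{\frac{Q(N-Q)}N\theta}$; and for $\psi_2$ ($N\ge3$): $$F_2(\theta_1,\theta_2)=\frac{e^{(1-\frac2N)(\theta_1+\theta_2)}F(\theta_{12})}{\sinh\frac12(\theta_{12}-\frac{2\pi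 i}N)\sinh\frac12(\theta_{12}+\frac{2\pi i}N)}.$$ -/

import Mathlib

open Filter Topology

namespace ZNIsing

noncomputable section

/-! ### The S-matrix and the elementary functions of the scaling `Z(N)`-Ising model -/

/-- The bound state fusion angle `η = 2π / N`. -/
def eta (N : ℕ) : ℂ := 2 * Real.pi / N

/-- The primitive root of unity `ω = exp (i η) = exp (2πi / N)`. -/
def omega (N : ℕ) : ℂ := Complex.exp (Complex.I * eta N)

/-- The scattering matrix of two particles of type 1. -/
def smatrix (N : ℕ) (θ : ℂ) : ℂ :=
  Complex.sinh ((θ + Complex.I * eta N) / 2) / Complex.sinh ((θ - Complex.I * eta N) / 2)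

/-- The scattering matrix `S_{1α}` of a particle of type 1 and a particle of type `α`, the latter
being the bound state of `α` particles of type 1 whose rapidities are equally spaced by `i η`
around the rapidity of the bound state. -/
def smatrixOne (N α : ℕ) (θ : ℂ) : ℂ :=
  ∏ j ∈ Finset.Icc 1 α, smatrix N (θ + Complex.I * eta N * ((j : ℂ) - ((α : ℂ) + 1) / 2))

/-- The residue of `f` at a (at most) simple pole `a`. -/
def simpleResidue (f : ℂ → ℂ) (a : ℂ) : ℂ :=
  limUnder (𝓝[≠] a) (fun z => (z - a) * f z)

/-- The bound state intertwiner `Γ_{1α}^{1+α} = i |Res S_{1α}|^{1/2}`; the residue is taken at the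
bound state pole `θ = i η (α + 1) / 2`. -/
def intertwiner (N α : ℕ) : ℂ :=
  Complex.I *
    (Real.sqrt ‖simpleResidue (smatrixOne N α) (Complex.I * eta N * ((α : ℂ) + 1) / 2)‖ : ℝ)

/-- `φ(z) = 1 / (sinh (z/2) sinh ((z + iη)/2))`. -/
def phi (N : ℕ) (z : ℂ) : ℂ :=
  1 / (Complex.sinh (z / 2) * Complex.sinh ((z + Complex.I * eta N) / 2))

/-- `ϰ(z) = 1 / φ(z)`, an entire function. -/
def kappa (N : ℕ) (z : ℂ) : ℂ :=
  Complex.sinh (z / 2) * Complex.sinh ((z + Complex.I * eta N) / 2)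

/-- `τ(z) = 1 / (φ(z) φ(-z))`, an entire function. -/
def tau (N : ℕ) (z : ℂ) : ℂ := kappa N z * kappa N (-z)

/-! ### The minimal form factor -/

/-- The constant `c_N`. -/
def minimalConstant (N : ℕ) : ℂ :=
  Complex.exp (Complex.I * Real.pi * ((N : ℂ) - 1) / N) *
    Complex.exp ((∫ t in Set.Ioi (0 : ℝ), 1 / (t * Real.sinh t) *
      ((1 - 2 / (N : ℝ)) - Real.sinh (t * (1 - 2 / (N : ℝ))) / Real.sinh t) : ℝ) : ℂ)

/-- The integral representation of the minimal form factor; the integral converges absolutely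
in the strip `0 < Im θ < 2π`. -/
def minimalIntegral (N : ℕ) (θ : ℂ) : ℂ :=
  minimalConstant N * Complex.exp (∫ t in Set.Ioi (0 : ℝ),
    (1 / (t : ℂ)) * (2 * Complex.cosh ((t : ℂ) / N) * Complex.sinh (((N : ℂ) - 1) / N * t) /
      Complex.sinh (t : ℂ) ^ 2) * (1 - Complex.cosh (t * (1 - θ / (Complex.I * Real.pi)))))

/-- `F` is the minimal form factor: the meromorphic function on `ℂ` that is given by the integral
representation in the strip `0 < Im θ < 2π`. By the identity theorem there is at most one such
function; the normal form only fixes its values at removable singularities (by continuity) and at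
poles (by `0`). -/
structure IsMinimalFormFactor (N : ℕ) (F : ℂ → ℂ) : Prop where
  meromorphic : MeromorphicNFOn F Set.univ
  eq_integral : ∀ θ : ℂ, 0 < θ.im → θ.im < 2 * Real.pi → F θ = minimalIntegral N θ

/-! ### Multiple contour integrals -/

/-- `∫_{C_θ} dz/R f(z)` where `C_θ` consists of the circles of radius `r` around the points `θ_i`,
and `R = ∫_{C_0} φ(z) dz`. The orientation of the circles drops out of the quotient. -/
def contourIntegral (N : ℕ) {n : ℕ} (θ : Fin n → ℂ) (r : ℝ) (f : ℂ → ℂ) : ℂ :=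
  (∑ w ∈ Finset.univ.image θ, ∮ z in C(w, r), f z) / ∮ z in C(0, r), phi N z

/-- The iterated integral `∫ dz_1 ⋯ ∫ dz_m f(z_1, …, z_m)` for a given one-dimensional
integral `J`. -/
def iterIntegral (J : (ℂ → ℂ) → ℂ) : (m : ℕ) → ((Fin m → ℂ) → ℂ) → ℂ
  | 0, f => f Fin.elim0
  | m + 1, f => J (fun z => iterIntegral J m (fun z' => f (Fin.cons z z')))

/-- The iterated integral over the variables `z_{kj}` with `k < K`, `j < m_k`. -/
def iterIntegralFamily (J : (ℂ → ℂ) → ℂ) :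
    (K : ℕ) → (m : Fin K → ℕ) → (((k : Fin K) → Fin (m k) → ℂ) → ℂ) → ℂ
  | 0, _, f => f (fun k => k.elim0)
  | K + 1, m, f => iterIntegral J (m 0) (fun z₀ =>
      iterIntegralFamily J K (fun k => m k.succ)
        (fun z => f (Fin.cons (α := fun k : Fin (K + 1) => Fin (m k) → ℂ) z₀ z)))

/-! ### The fundamental building blocks of the form factors

The index `k = 1, …, N - 1` is represented by `k - 1 : Fin (N - 1)`. -/

/-- The function `h(θ, z)`. -/
def hFunction (N n : ℕ) (m : Fin (N - 1) → ℕ) (θ : Fin n → ℂ)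
    (z : (k : Fin (N - 1)) → Fin (m k) → ℂ) : ℂ :=
  (∏ k, ((∏ j, ∏ i, phi N (z k j - θ i)) *
      ∏ i, ∏ j ∈ Finset.Ioi i, tau N (z k i - z k j))) *
    ∏ k, ∏ l ∈ Finset.Ioi k, ∏ i, ∏ j, kappa N (z k i - z l j)

/-- `I_{nm}(θ, p)`; the integrals do not depend on the radius `r` of the circles
as soon as it is small enough. -/
def buildingBlock (N n : ℕ) (m : Fin (N - 1) → ℕ) (θ : Fin n → ℂ)
    (p : (Fin n → ℂ) → ((k : Fin (N - 1)) → Fin (m k) → ℂ) → ℂ) : ℂ :=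
  (∏ k, 1 / ((m k).factorial : ℂ)) *
    limUnder (𝓝[>] (0 : ℝ)) (fun r => iterIntegralFamily (contourIntegral N θ r) (N - 1) m
      (fun z => hFunction N n m θ z * p θ z))

/-! ### p-functions -/

/-- The number `m_k` of integration variables for charge `Q` and `n = N l + Q` particles:
`l + 1` for `k ≤ Q` and `l` for `k > Q`. -/
def multiplicity (N Q n : ℕ) (k : Fin (N - 1)) : ℕ := n / N + if (k : ℕ) < Q then 1 else 0

/-- The pairs `(n, m)` for which the p-function of a field of charge `Q` is defined. -/
def Admissible (N Q n : ℕ) (m : Fin (N - 1) → ℕ) : Prop := n % N = Q ∧ m = multiplicity N Q n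

/-- The conditions (i'), (ii'), (iii') (without an additional term `p̃`) and (v') on the p-function
of a field of charge `Q`, statistics factor `σ` with respect to the particle of type 1,
and spin `s`. -/
structure IsPFunction (N Q : ℕ) (σ s : ℂ)
    (p : (n : ℕ) → (m : Fin (N - 1) → ℕ) → (Fin n → ℂ) →
      ((k : Fin (N - 1)) → Fin (m k) → ℂ) → ℂ) : Prop where
  analytic : ∀ n m, Admissible N Q n m →
    AnalyticOnNhd ℂ (fun x : (Fin n → ℂ) × ((k : Fin (N - 1)) → Fin (m k) → ℂ) => p n m x.1 x.2)
      Set.univ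
  symmetric : ∀ n m, Admissible N Q n m → ∀ (i j : Fin n) θ z,
    p n m (θ ∘ Equiv.swap i j) z = p n m θ z
  periodic : ∀ n m, Admissible N Q (n + 1) m → ∀ (x : ℂ) (θ : Fin n → ℂ) z,
    σ * p (n + 1) m (Fin.cons (x + 2 * Real.pi * Complex.I) θ) z = p (n + 1) m (Fin.cons x θ) z
  recursion : ∀ n m, Admissible N Q n m → ∀ (a : Fin N → ℂ) (θ : Fin n → ℂ)
    (z : (k : Fin (N - 1)) → Fin (m k) → ℂ),
    (∀ k : Fin (N - 1), a ⟨k, by omega⟩ - a ⟨k + 1, by omega⟩ = Complex.I * eta N) →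
    p (N + n) (fun k => m k + 1) (Fin.append a θ) (fun k => Fin.cons (a ⟨k, by omega⟩) (z k)) =
        σ * p (N + n) (fun k => m k + 1) (Fin.append a θ)
          (fun k => Fin.cons (a ⟨k + 1, by omega⟩) (z k)) ∧
      p (N + n) (fun k => m k + 1) (Fin.append a θ) (fun k => Fin.cons (a ⟨k, by omega⟩) (z k)) =
        σ * p n m θ z
  lorentz : ∀ n m, Admissible N Q n m → ∀ (μ : ℂ) θ z,
    p n m (fun i => θ i + μ) (fun k j => z k j + μ) = Complex.exp (s * μ) * p n m θ z

/-! ### Form factor equations -/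

/-- The rapidities for which no difference `θ_i - θ_j` equals `i η` modulo `2πi`. -/
def generic (N n : ℕ) : Set (Fin n → ℂ) :=
  {θ | ∀ i j, ∀ k : ℤ, θ i - θ j ≠ Complex.I * eta N + 2 * Real.pi * Complex.I * k}

/-- A function of several complex variables is meromorphic at `x` if it is near `x` a quotient of
analytic functions with a denominator that does not vanish identically near `x`. -/
def IsMeromorphicAt {n : ℕ} (f : (Fin n → ℂ) → ℂ) (x : Fin n → ℂ) : Prop :=
  ∃ g h : (Fin n → ℂ) → ℂ, AnalyticAt ℂ g x ∧ AnalyticAt ℂ h x ∧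
    (¬ ∀ᶠ y in 𝓝 x, h y = 0) ∧ ∀ᶠ y in 𝓝 x, h y ≠ 0 → f y = g y / h y

/-- `HasIteratedResidue N r G x c` says that the iterated residue
`Res_{θ_{r-1}-θ_r = iη} ⋯ Res_{θ_1-θ_2 = iη} G(θ_1, …, θ_r)` exists at `θ_r = x`, where all
residues (the one in `θ_1 - θ_2` is taken first, the one in `θ_{r-1} - θ_r` last) belong to at most
simple poles, and that it is equal to `c`. -/
def HasIteratedResidue (N : ℕ) : (r : ℕ) → ((Fin r → ℂ) → ℂ) → ℂ → ℂ → Prop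
  | 0, _, _, _ => False
  | 1, G, x, c => G (fun _ => x) = c
  | r + 2, G, x, c => ∃ g : ℂ → ℂ,
      (∀ᶠ y in 𝓝[≠] (x + Complex.I * eta N),
        HasIteratedResidue N (r + 1) (fun θ => G (Fin.snoc θ x)) y (g y)) ∧
      Tendsto (fun y => (y - (x + Complex.I * eta N)) * g y) (𝓝[≠] (x + Complex.I * eta N)) (𝓝 c)

/-- The functions `𝓕 n = F_{1…1}` of the rapidities of `n` particles of type 1 satisfy the form
factor equations of a field with charge `Q`, statistics factor `σ` with respect to the particle of
type 1, and spin `s`. -/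
structure IsFormFactorFamily (N Q : ℕ) (σ s : ℂ) (𝓕 : (n : ℕ) → (Fin n → ℂ) → ℂ) : Prop where
  charge : ∀ n, n % N ≠ Q → 𝓕 n = 0
  analytic : ∀ n, AnalyticOnNhd ℂ (𝓕 n) (generic N n)
  meromorphic : ∀ n θ, IsMeromorphicAt (𝓕 n) θ
  watson : ∀ n (i : Fin n) (hi : (i : ℕ) + 1 < n), ∀ θ ∈ generic N n,
    𝓕 n θ = 𝓕 n (θ ∘ Equiv.swap i ⟨i + 1, hi⟩) * smatrix N (θ i - θ ⟨i + 1, hi⟩)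
  crossing : ∀ n (x : ℂ) (θ : Fin n → ℂ),
    (Fin.cons (x + Complex.I * Real.pi) θ : Fin (n + 1) → ℂ) ∈ generic N (n + 1) →
    σ * 𝓕 (n + 1) (Fin.cons (x + Complex.I * Real.pi) θ) =
      𝓕 (n + 1) (Fin.snoc θ (x - Complex.I * Real.pi))
  /-- The residues that define the form factors with one bound state of `r` particles exist. -/
  boundState : ∀ r n, 1 ≤ r → r < N → ∀ (x : ℂ), ∀ θ ∈ generic N n,
    (∀ i, ∀ k : ℤ, θ i - x ≠ Complex.I * eta N * k) →
    ∃ b, HasIteratedResidue N r (fun a => 𝓕 (r + n) (Fin.append a θ)) x b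
  /-- The annihilation recursion relation, where the antiparticle of the particle of type 1 is
  the bound state of `N - 1` particles of type 1. -/
  recursion : ∀ n (x : ℂ), ∀ θ ∈ generic N n,
    (∀ i, ∀ k : ℤ, θ i - x ≠ Complex.I * eta N * k) →
    HasIteratedResidue N N (fun a => 𝓕 (N + n) (Fin.append a θ)) x
      (2 * Complex.I * 𝓕 n θ * (1 - σ * ∏ i, smatrix N (x - θ i)) *
        ∏ α ∈ Finset.Icc 1 (N - 2), (Real.sqrt 2 : ℂ) * intertwiner N α)
  lorentz : ∀ n (μ : ℂ), ∀ θ ∈ generic N n,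
    𝓕 n (fun i => θ i + μ) = Complex.exp (s * μ) * 𝓕 n θ

/-! ### The fields `ψ_{Q,Q̃}` -/

/-- The statistics factor `ω ^ Q̃`. -/
def statistics (N Qt : ℕ) : ℂ := omega N ^ Qt

/-- The spin `min (Q, Q̃) - Q Q̃ / N`. -/
def spin (N Q Qt : ℕ) : ℂ := ((min Q Qt : ℕ) : ℂ) - (Q : ℂ) * (Qt : ℂ) / (N : ℂ)

/-- The factor `ρ = (√ω) ^ (Q̃ (Q̃ - N + 2) n / N)` with `√ω = exp (πi / N)`. -/
def rho (N Qt n : ℕ) : ℂ :=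
  Complex.exp (Complex.I * Real.pi / N * ((Qt : ℂ) * ((Qt : ℂ) - N + 2) * n / N))

/-- The p-function of the field `ψ_{Q,Q̃}`; it depends on `Q` only through the admissible `(n, m)`. -/
def pFunction (N Qt n : ℕ) (m : Fin (N - 1) → ℕ) (θ : Fin n → ℂ)
    (z : (k : Fin (N - 1)) → Fin (m k) → ℂ) : ℂ :=
  rho N Qt n * Complex.exp ((∑ k : Fin (N - 1), if (k : ℕ) < Qt then ∑ j, z k j else 0) -
    (Qt : ℂ) / N * ∑ i, θ i)

/-- The relation between the normalization constants `N_n`, `n ≡ Q mod N`. -/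
def NormalizationRelation (N Q : ℕ) (F : ℂ → ℂ) (c : ℕ → ℂ) : Prop :=
  ∀ n, n % N = Q →
    c (N + n) * (simpleResidue (fun θ => phi N (-θ)) (Complex.I * eta N) ^ (N - 1) *
        (∏ k ∈ Finset.Icc 1 (N - 2), phi N (k * (Complex.I * eta N)) ^ k) *
        ∏ k ∈ Finset.Icc 1 (N - 1), F (k * (Complex.I * eta N)) ^ (N - k)) =
      c n * (2 * Complex.I *
        ∏ α ∈ Finset.Icc 1 (N - 2), (Real.sqrt 2 : ℂ) * intertwiner N α)

/-- The form factors of `ψ_{Q,Q̃}` for `n` particles of type 1, with minimal form factor `F` and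
normalization constants `c n`. -/
def formFactor (N : ℕ) (F : ℂ → ℂ) (Q Qt : ℕ) (c : ℕ → ℂ) (n : ℕ) (θ : Fin n → ℂ) : ℂ :=
  if n % N = Q then
    c n * buildingBlock N n (multiplicity N Q n) θ (pFunction N Qt n (multiplicity N Q n)) *
      ∏ i, ∏ j ∈ Finset.Ioi i, F (θ i - θ j)
  else 0

/-- The form factors of the order parameter `σ_Q = ψ_{Q,0}`. -/
def orderFormFactor (N : ℕ) (F : ℂ → ℂ) (Q : ℕ) := formFactor N F Q 0

/-- The form factors of the disorder parameter `μ_{Q̃} = ψ_{0,Q̃}`. -/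
def disorderFormFactor (N : ℕ) (F : ℂ → ℂ) (Qt : ℕ) := formFactor N F 0 Qt

/-- The form factors of the para-fermi field `ψ_Q = ψ_{Q,Q}`. -/
def paraFermiFormFactor (N : ℕ) (F : ℂ → ℂ) (Q : ℕ) := formFactor N F Q Q

end

end ZNIsing

open Filter Topology

namespace ZNIsing

noncomputable section

/-! ### The function `sinh (z / 2)` -/

/-- The function `sinh (z / 2)`. -/
def hs (z : ℂ) : ℂ := Complex.sinh (z / 2)

lemma hs_neg (z : ℂ) : hs (-z) = -hs z := by
  simp [hs, neg_div]

lemma hs_sub_comm (z w : ℂ) : hs (z - w) = -hs (w - z) := by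
  rw [← hs_neg, neg_sub]

lemma hs_add_two_pi (z : ℂ) : hs (z + 2 * Real.pi * Complex.I) = -hs z := by
  rw [hs, hs, show (z + 2 * Real.pi * Complex.I) / 2 = z / 2 + Real.pi * Complex.I by ring,
    Complex.sinh_add, Complex.cosh_mul_I, Complex.sinh_mul_I]
  simp

lemma hs_sub_two_pi (z : ℂ) : hs (z - 2 * Real.pi * Complex.I) = -hs z := by
  have := hs_add_two_pi (z - 2 * Real.pi * Complex.I)
  rw [sub_add_cancel] at this
  rw [this, neg_neg]

lemma hs_zero : hs 0 = 0 := by simp [hs]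

lemma hs_eq_zero_iff {z : ℂ} : hs z = 0 ↔ ∃ k : ℤ, z = 2 * Real.pi * Complex.I * k := by
  have h : hs z = -Complex.I * Complex.sin (z / 2 * Complex.I) := by
    rw [Complex.sin_mul_I, hs]
    linear_combination Complex.sinh (z / 2) * Complex.I_mul_I
  rw [h, mul_eq_zero, or_iff_right (by simp), Complex.sin_eq_zero_iff]
  constructor
  · rintro ⟨k, hk⟩
    refine ⟨-k, ?_⟩
    push_cast
    linear_combination -2 * Complex.I * hk + z * Complex.I_mul_I
  · rintro ⟨k, hk⟩
    refine ⟨-k, ?_⟩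
    rw [hk]
    push_cast
    linear_combination (Real.pi * k : ℂ) * Complex.I_mul_I

lemma differentiable_hs : Differentiable ℂ hs := by
  unfold hs; fun_prop

lemma analyticAt_hs (z : ℂ) : AnalyticAt ℂ hs z :=
  differentiable_hs.analyticAt z

lemma continuous_hs : Continuous hs := differentiable_hs.continuous

lemma hs_ne_zero_of_im {z : ℂ} (h₀ : 0 < z.im) (h₁ : z.im < 2 * Real.pi) : hs z ≠ 0 := by
  rw [Ne, hs_eq_zero_iff]
  rintro ⟨k, rfl⟩
  have him : (2 * Real.pi * Complex.I * (k : ℂ)).im = 2 * Real.pi * k := by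
    simp
  rw [him] at h₀ h₁
  have hp := Real.two_pi_pos
  have h2 : (0 : ℝ) < k := by
    by_contra h
    nlinarith
  have h3 : (k : ℝ) < 1 := by
    by_contra h
    nlinarith
  norm_cast at h2 h3
  omega

lemma I_mul_eta_im (N : ℕ) : (Complex.I * eta N).im = 2 * Real.pi / N := by
  rw [eta, show Complex.I * (2 * Real.pi / (N : ℂ)) = ((2 * Real.pi / N : ℝ) : ℂ) * Complex.I by
    push_cast; ring]
  simp

lemma mul_I_mul_eta_im (N : ℕ) (k : ℝ) :
    ((k : ℂ) * (Complex.I * eta N)).im = k * (2 * Real.pi / N) := by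
  rw [Complex.im_ofReal_mul, I_mul_eta_im]

lemma N_mul_I_mul_eta {N : ℕ} (hN : 2 ≤ N) :
    (N : ℂ) * (Complex.I * eta N) = 2 * Real.pi * Complex.I := by
  have : (N : ℂ) ≠ 0 := by
    norm_cast
    omega
  rw [eta]
  field_simp

/-- `sinh (k i η / 2)` does not vanish for `0 < k < N`. -/
lemma hs_mul_ne_zero {N k : ℕ} (h₀ : 0 < k) (h₁ : k < N) :
    hs ((k : ℂ) * (Complex.I * eta N)) ≠ 0 := by
  have hN : (0 : ℝ) < N := by
    norm_cast
    omega
  have hk : (0 : ℝ) < k := by exact_mod_cast h₀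
  have hkN : (k : ℝ) < N := by exact_mod_cast h₁
  have := mul_I_mul_eta_im N k
  apply hs_ne_zero_of_im
  · rw [show ((k : ℕ) : ℂ) = ((k : ℝ) : ℂ) by simp, this]
    positivity
  · rw [show ((k : ℕ) : ℂ) = ((k : ℝ) : ℂ) by simp, this, ← mul_div_assoc, div_lt_iff₀ hN]
    nlinarith [Real.pi_pos]

lemma hs_reflect {N : ℕ} (hN : 2 ≤ N) (z : ℂ) :
    hs ((N : ℂ) * (Complex.I * eta N) - z) = hs z := by
  rw [N_mul_I_mul_eta hN, hs_sub_comm, hs_sub_two_pi, neg_neg]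

lemma hs_add_N {N : ℕ} (hN : 2 ≤ N) (z : ℂ) :
    hs (z + (N : ℂ) * (Complex.I * eta N)) = -hs z := by
  rw [N_mul_I_mul_eta hN, hs_add_two_pi]

lemma smatrix_eq (N : ℕ) (z : ℂ) :
    smatrix N z = hs (z + Complex.I * eta N) / hs (z - Complex.I * eta N) := rfl

lemma phi_eq (N : ℕ) (z : ℂ) : phi N z = (hs z * hs (z + Complex.I * eta N))⁻¹ := by
  rw [phi, one_div]; rfl

lemma kappa_eq (N : ℕ) (z : ℂ) : kappa N z = hs z * hs (z + Complex.I * eta N) := rfl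

lemma phi_eq_inv_kappa (N : ℕ) (z : ℂ) : phi N z = (kappa N z)⁻¹ := by
  rw [phi_eq, kappa_eq]

lemma smatrix_neg (N : ℕ) (z : ℂ) : smatrix N (-z) = (smatrix N z)⁻¹ := by
  rw [smatrix_eq, smatrix_eq, inv_div,
    show -z + Complex.I * eta N = -(z - Complex.I * eta N) by ring,
    show -z - Complex.I * eta N = -(z + Complex.I * eta N) by ring, hs_neg, hs_neg, neg_div_neg_eq]

lemma smatrix_add_two_pi (N : ℕ) (z : ℂ) :
    smatrix N (z + 2 * Real.pi * Complex.I) = smatrix N z := by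
  rw [smatrix_eq, smatrix_eq, add_right_comm, hs_add_two_pi, add_sub_right_comm, hs_add_two_pi,
    neg_div_neg_eq]

lemma phi_neg (N : ℕ) (z : ℂ) : phi N (-z) = (hs z * hs (z - Complex.I * eta N))⁻¹ := by
  rw [phi_eq, hs_neg, show -z + Complex.I * eta N = -(z - Complex.I * eta N) by ring, hs_neg,
    neg_mul_neg]

/-- `z` is not congruent to `± i η` modulo `2πi`. -/
def Regular (N : ℕ) (z : ℂ) : Prop :=
  hs (z - Complex.I * eta N) ≠ 0 ∧ hs (z + Complex.I * eta N) ≠ 0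

lemma Regular.neg {N : ℕ} {z : ℂ} (h : Regular N z) : Regular N (-z) := by
  refine ⟨?_, ?_⟩
  · rw [show -z - Complex.I * eta N = -(z + Complex.I * eta N) by ring, hs_neg]
    exact neg_ne_zero.mpr h.2
  · rw [show -z + Complex.I * eta N = -(z - Complex.I * eta N) by ring, hs_neg]
    exact neg_ne_zero.mpr h.1

lemma Regular.add_two_pi {N : ℕ} {z : ℂ} (h : Regular N z) :
    Regular N (z + 2 * Real.pi * Complex.I) := by
  refine ⟨?_, ?_⟩
  · rw [add_sub_right_comm, hs_add_two_pi]
    exact neg_ne_zero.mpr h.1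
  · rw [add_right_comm, hs_add_two_pi]
    exact neg_ne_zero.mpr h.2

lemma Regular.sub_two_pi {N : ℕ} {z : ℂ} (h : Regular N z) :
    Regular N (z - 2 * Real.pi * Complex.I) := by
  have := h.neg.add_two_pi.neg
  rwa [neg_add, neg_neg, ← sub_eq_add_neg] at this

lemma Regular.smatrix_ne_zero {N : ℕ} {z : ℂ} (h : Regular N z) : smatrix N z ≠ 0 := by
  rw [smatrix_eq]
  exact div_ne_zero h.2 h.1

lemma isOpen_regular (N : ℕ) : IsOpen {z | Regular N z} := by
  apply IsOpen.inter
  · exact isOpen_ne_fun (continuous_hs.comp (by fun_prop)) continuous_const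
  · exact isOpen_ne_fun (continuous_hs.comp (by fun_prop)) continuous_const

lemma mem_generic_iff {N n : ℕ} {θ : Fin n → ℂ} :
    θ ∈ generic N n ↔ ∀ i j, hs (θ i - θ j - Complex.I * eta N) ≠ 0 := by
  refine forall₂_congr fun i j => ?_
  rw [Ne, hs_eq_zero_iff, not_exists]
  refine forall_congr' fun k => not_congr ?_
  constructor <;> intro h <;> linear_combination h

lemma regular_of_mem_generic {N n : ℕ} {θ : Fin n → ℂ} (h : θ ∈ generic N n) (i j : Fin n) :
    Regular N (θ i - θ j) := by
  rw [mem_generic_iff] at h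
  refine ⟨h i j, ?_⟩
  rw [show θ i - θ j + Complex.I * eta N = -(θ j - θ i - Complex.I * eta N) by ring, hs_neg]
  exact neg_ne_zero.mpr (h j i)

/-! ### The reciprocal of `sinh (w / 2)` near its pole -/

/-- The analytic continuation of `w / sinh (w / 2)` to `w = 0`. -/
def hsRec (w : ℂ) : ℂ := (dslope hs 0 w)⁻¹

lemma hsRec_of_ne {w : ℂ} (h : w ≠ 0) : hsRec w = w / hs w := by
  rw [hsRec, dslope_of_ne _ h, slope_def_field, hs_zero, sub_zero, sub_zero, inv_div]

lemma deriv_hs_zero : deriv hs 0 = 1 / 2 := by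
  have h : HasDerivAt hs (Complex.cosh (0 / 2) * (1 / 2)) 0 :=
    HasDerivAt.csinh ((hasDerivAt_id (0 : ℂ)).div_const 2)
  rw [h.deriv]
  simp

lemma hsRec_zero : hsRec 0 = 2 := by
  rw [hsRec, dslope_same, deriv_hs_zero]
  norm_num

lemma analyticAt_hsRec {w : ℂ} (h : w = 0 ∨ hs w ≠ 0) : AnalyticAt ℂ hsRec w := by
  have hd : Differentiable ℂ (dslope hs 0) := by
    rw [← differentiableOn_univ, Complex.differentiableOn_dslope univ_mem]
    exact differentiable_hs.differentiableOn
  apply (hd.analyticAt w).inv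
  rcases eq_or_ne w 0 with rfl | h0
  · rw [dslope_same, deriv_hs_zero]
    norm_num
  · rw [dslope_of_ne _ h0, slope_def_field, hs_zero, sub_zero, sub_zero]
    exact div_ne_zero (h.resolve_left h0) h0

/-! ### Integrals of exponentially decaying kernels -/

lemma norm_cosh_le (z : ℂ) : ‖Complex.cosh z‖ ≤ Real.exp |z.re| := by
  rw [Complex.cosh, norm_div, Complex.norm_ofNat, div_le_iff₀ two_pos]
  refine (norm_add_le _ _).trans ?_
  rw [Complex.norm_exp, Complex.norm_exp, Complex.neg_re]
  have h1 := Real.exp_le_exp.mpr (le_abs_self z.re)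
  have h2 := Real.exp_le_exp.mpr (neg_le_abs z.re)
  linarith

lemma norm_sinh_le (z : ℂ) : ‖Complex.sinh z‖ ≤ ‖z‖ * Real.exp |z.re| := by
  have hconv : Convex ℝ {w : ℂ | |w.re| ≤ |z.re|} := by
    have : {w : ℂ | |w.re| ≤ |z.re|} = Complex.reLm ⁻¹' (Set.Icc (-|z.re|) |z.re|) := by
      ext w
      simp [abs_le]
    rw [this]
    exact (convex_Icc _ _).is_linear_preimage Complex.reLm.isLinear
  have := hconv.norm_image_sub_le_of_norm_hasDerivWithin_le (f := Complex.sinh)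
    (f' := Complex.cosh) (x := 0) (y := z) (C := Real.exp |z.re|)
    (fun w _ => (Complex.hasDerivAt_sinh w).hasDerivWithinAt)
    (fun w hw => (norm_cosh_le w).trans (Real.exp_le_exp.mpr hw))
    (show |(0 : ℂ).re| ≤ |z.re| by simp) (le_refl |z.re|)
  simpa [mul_comm] using this

lemma norm_one_sub_cosh_le (z : ℂ) : ‖1 - Complex.cosh z‖ ≤ ‖z‖ ^ 2 * Real.exp |z.re| := by
  have h : 1 - Complex.cosh z = -(2 * Complex.sinh (z / 2) ^ 2) := by
    have := Complex.cosh_two_mul (z / 2)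
    rw [show 2 * (z / 2) = z by ring, Complex.cosh_sq] at this
    rw [this]
    ring
  have h2 := norm_sinh_le (z / 2)
  have h3 : (z / 2).re = z.re / 2 := by simp
  rw [h, norm_neg, norm_mul, norm_pow, Complex.norm_ofNat]
  rw [norm_div, Complex.norm_ofNat, h3, abs_div, abs_two] at h2
  have h4 : ‖Complex.sinh (z / 2)‖ ^ 2 ≤ (‖z‖ / 2 * Real.exp (|z.re| / 2)) ^ 2 :=
    pow_le_pow_left₀ (norm_nonneg _) h2 2
  have h5 : Real.exp (|z.re| / 2) ^ 2 = Real.exp |z.re| := by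
    rw [← Real.exp_nat_mul]
    congr 1
    push_cast
    ring
  rw [mul_pow, h5] at h4
  nlinarith [mul_nonneg (sq_nonneg ‖z‖) (Real.exp_pos |z.re|).le]

lemma inv_sinh_le {t : ℝ} (ht : 0 < t) :
    (Real.sinh t)⁻¹ ≤ (1 + 2 * t) * Real.exp (-t) / t := by
  have h1 : 2 * t + 1 ≤ Real.exp (2 * t) := Real.add_one_le_exp _
  have h2 : Real.exp t * Real.exp (-t) = 1 := by rw [← Real.exp_add]; simp
  have h3 : Real.exp (2 * t) = Real.exp t * Real.exp t := by rw [← Real.exp_add]; congr 1; ring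
  have hs : 0 < Real.sinh t := Real.sinh_pos_iff.mpr ht
  rw [inv_le_comm₀ hs (by positivity), inv_div, div_le_iff₀ (by positivity), Real.sinh_eq]
  have h4 : Real.exp (-t) = (Real.exp t)⁻¹ := Real.exp_neg t
  have hp := Real.exp_pos t
  rw [h4] at *
  field_simp
  rw [h3] at h1
  nlinarith

lemma integrableOn_poly_exp {δ : ℝ} (hδ : 0 < δ) :
    MeasureTheory.IntegrableOn (fun t : ℝ => (1 + 2 * t) ^ 2 * Real.exp (-δ * t))
      (Set.Ioi 0) := by
  have h := (exp_neg_integrableOn_Ioi 0 (half_pos hδ)).const_mul ((1 + 8 / δ) ^ 2)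
  refine MeasureTheory.Integrable.mono' h (Continuous.aestronglyMeasurable (by fun_prop)) ?_
  refine (MeasureTheory.ae_restrict_iff' measurableSet_Ioi).mpr (Eventually.of_forall ?_)
  intro t ht
  have ht : 0 < t := ht
  rw [Real.norm_of_nonneg (by positivity)]
  have h1 : 1 + 2 * t ≤ (1 + 8 / δ) * Real.exp (δ / 4 * t) := by
    have h2 : δ / 4 * t + 1 ≤ Real.exp (δ / 4 * t) := Real.add_one_le_exp _
    have h3 : 1 + 2 * t ≤ (1 + 8 / δ) * (δ / 4 * t + 1) := by
      have : (1 + 8 / δ) * (δ / 4 * t + 1) = 1 + 2 * t + (δ / 4 * t + 8 / δ) := by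
        field_simp
        ring
      rw [this]
      have : 0 < δ / 4 * t + 8 / δ := by positivity
      linarith
    exact h3.trans (mul_le_mul_of_nonneg_left h2 (by positivity))
  have h4 : (1 + 2 * t) ^ 2 ≤ ((1 + 8 / δ) * Real.exp (δ / 4 * t)) ^ 2 :=
    pow_le_pow_left₀ (by positivity) h1 2
  calc (1 + 2 * t) ^ 2 * Real.exp (-δ * t)
      ≤ ((1 + 8 / δ) * Real.exp (δ / 4 * t)) ^ 2 * Real.exp (-δ * t) :=
        mul_le_mul_of_nonneg_right h4 (Real.exp_pos _).le
    _ = (1 + 8 / δ) ^ 2 * Real.exp (-(δ / 2) * t) := by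
        rw [mul_pow, mul_assoc, ← Real.exp_nat_mul, ← Real.exp_add]
        congr 2
        push_cast
        ring

/-- A real kernel on `(0, ∞)` that is `O(1/t)` at `0` and decays like `exp (-lam t)`. -/
structure IsKernel (k : ℝ → ℝ) (lam : ℝ) : Prop where
  continuousOn : ContinuousOn k (Set.Ioi 0)
  bound : ∀ t, 0 < t → |k t| ≤ (1 + 2 * t) ^ 2 * Real.exp (-lam * t) / t

/-- `∫ dt/t k(t) (1 - cosh (t x))`. -/
def kernelIntegral (k : ℝ → ℝ) (x : ℂ) : ℂ :=
  ∫ t in Set.Ioi (0 : ℝ), 1 / (t : ℂ) * k t * (1 - Complex.cosh (t * x))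

lemma IsKernel.integrable {k : ℝ → ℝ} {lam : ℝ} (hk : IsKernel k lam) {x : ℂ}
    (hx : |x.re| < lam) :
    MeasureTheory.IntegrableOn
      (fun t : ℝ => 1 / (t : ℂ) * k t * (1 - Complex.cosh (t * x))) (Set.Ioi 0) := by
  have h := (integrableOn_poly_exp (sub_pos.mpr hx)).const_mul (‖x‖ ^ 2)
  refine MeasureTheory.Integrable.mono' h ?_ ?_
  · refine ContinuousOn.aestronglyMeasurable ?_ measurableSet_Ioi
    have h1 : ContinuousOn (fun t : ℝ => 1 / (t : ℂ)) (Set.Ioi 0) :=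
      ContinuousOn.div continuousOn_const (by fun_prop) fun t ht => by
        simpa using (ne_of_gt ht : t ≠ 0)
    have h2 : ContinuousOn (fun t : ℝ => (k t : ℂ)) (Set.Ioi 0) :=
      Complex.continuous_ofReal.comp_continuousOn hk.continuousOn
    exact (h1.mul h2).mul (Continuous.continuousOn (by fun_prop))
  · refine (MeasureTheory.ae_restrict_iff' measurableSet_Ioi).mpr (Eventually.of_forall ?_)
    intro t ht
    have ht : 0 < t := ht
    have h1 := norm_one_sub_cosh_le (t * x)
    have h2 := hk.bound t ht
    rw [Complex.re_ofReal_mul, norm_mul, abs_mul, abs_of_pos ht, Complex.norm_real,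
      Real.norm_of_nonneg ht.le] at h1
    rw [norm_mul, norm_mul, norm_div, norm_one, Complex.norm_real, Complex.norm_real,
      Real.norm_of_nonneg ht.le, Real.norm_eq_abs]
    calc 1 / t * |k t| * ‖1 - Complex.cosh (t * x)‖
        ≤ 1 / t * ((1 + 2 * t) ^ 2 * Real.exp (-lam * t) / t) *
          ((t * ‖x‖) ^ 2 * Real.exp (t * |x.re|)) := by gcongr
      _ = ‖x‖ ^ 2 * ((1 + 2 * t) ^ 2 * (Real.exp (-lam * t) * Real.exp (t * |x.re|))) := by
          field_simp
      _ = _ := by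
          rw [← Real.exp_add]
          congr 3
          ring

lemma IsKernel.norm_mul_sinh_le {k : ℝ → ℝ} {lam : ℝ} (hk : IsKernel k lam) {t : ℝ} (ht : 0 < t)
    {x : ℂ} {β M : ℝ} (hβ : |x.re| ≤ β) (hM : ‖x‖ ≤ M) :
    ‖-((k t : ℂ) * Complex.sinh (t * x))‖ ≤
      M * ((1 + 2 * t) ^ 2 * Real.exp (-(lam - β) * t)) := by
  have h1 := norm_sinh_le (t * x)
  have h2 := hk.bound t ht
  rw [Complex.re_ofReal_mul, norm_mul, abs_mul, abs_of_pos ht, Complex.norm_real,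
    Real.norm_of_nonneg ht.le] at h1
  rw [norm_neg, norm_mul, Complex.norm_real, Real.norm_eq_abs]
  have hM0 : 0 ≤ M := (norm_nonneg x).trans hM
  calc |k t| * ‖Complex.sinh (t * x)‖
      ≤ ((1 + 2 * t) ^ 2 * Real.exp (-lam * t) / t) * (t * M * Real.exp (t * β)) := by
        have h3 : t * ‖x‖ * Real.exp (t * |x.re|) ≤ t * M * Real.exp (t * β) := by gcongr
        exact mul_le_mul h2 (h1.trans h3) (norm_nonneg _) (by positivity)
    _ = M * ((1 + 2 * t) ^ 2 * (Real.exp (-lam * t) * Real.exp (t * β))) := by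
        field_simp
    _ = _ := by
        rw [← Real.exp_add]
        congr 3
        ring

lemma IsKernel.hasDerivAt {k : ℝ → ℝ} {lam : ℝ} (hk : IsKernel k lam) {x : ℂ}
    (hx : |x.re| < lam) :
    HasDerivAt (kernelIntegral k)
      (∫ t in Set.Ioi (0 : ℝ), -((k t : ℂ) * Complex.sinh (t * x))) x := by
  obtain ⟨β, hβ, hβl⟩ := exists_between hx
  have hU : {y : ℂ | |y.re| < β ∧ ‖y‖ < ‖x‖ + 1} ∈ 𝓝 x := by
    apply IsOpen.mem_nhds
    · exact (isOpen_lt (f := fun y : ℂ => |y.re|) (by fun_prop) continuous_const).inter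
        (isOpen_lt (f := fun y : ℂ => ‖y‖) (by fun_prop) continuous_const)
    · exact ⟨hβ, by simp⟩
  have hcont : ∀ y : ℂ, ContinuousOn (fun t : ℝ => (k t : ℂ)) (Set.Ioi 0) := fun _ =>
    Complex.continuous_ofReal.comp_continuousOn hk.continuousOn
  refine (hasDerivAt_integral_of_dominated_loc_of_deriv_le
    (μ := MeasureTheory.volume.restrict (Set.Ioi (0 : ℝ))) hU
    (F := fun y t => 1 / (t : ℂ) * k t * (1 - Complex.cosh (t * y)))
    (F' := fun y t => -((k t : ℂ) * Complex.sinh (t * y)))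
    (bound := fun t => (‖x‖ + 1) * ((1 + 2 * t) ^ 2 * Real.exp (-(lam - β) * t)))
    ?_ (hk.integrable hx) ?_ ?_ ?_ ?_).2
  · filter_upwards [hU] with y hy
    exact (hk.integrable (hy.1.trans hβl)).aestronglyMeasurable
  · refine ContinuousOn.aestronglyMeasurable ?_ measurableSet_Ioi
    exact ((hcont x).mul (Continuous.continuousOn (by fun_prop))).neg
  · refine (MeasureTheory.ae_restrict_iff' measurableSet_Ioi).mpr (Eventually.of_forall ?_)
    intro t ht y hy
    exact hk.norm_mul_sinh_le ht hy.1.le hy.2.le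
  · exact (integrableOn_poly_exp (sub_pos.mpr hβl)).const_mul _
  · refine (MeasureTheory.ae_restrict_iff' measurableSet_Ioi).mpr (Eventually.of_forall ?_)
    intro t ht y _
    have ht : (t : ℂ) ≠ 0 := by simpa using (ne_of_gt ht : t ≠ 0)
    have h1 : HasDerivAt (fun y : ℂ => (t : ℂ) * y) (t : ℂ) y := by
      simpa using (hasDerivAt_id y).const_mul (t : ℂ)
    have h2 := (h1.ccosh.const_sub 1).const_mul (1 / (t : ℂ) * k t)
    refine h2.congr_deriv ?_
    field_simp

lemma kernelIntegral_neg (k : ℝ → ℝ) (x : ℂ) : kernelIntegral k (-x) = kernelIntegral k x := by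
  simp [kernelIntegral]

lemma kernelIntegral_zero (k : ℝ → ℝ) : kernelIntegral k 0 = 0 := by
  simp [kernelIntegral]

lemma isOpen_strip (lam : ℝ) : IsOpen {x : ℂ | |x.re| < lam} :=
  isOpen_lt (by fun_prop) continuous_const

lemma IsKernel.analyticAt {k : ℝ → ℝ} {lam : ℝ} (hk : IsKernel k lam) {x : ℂ}
    (hx : |x.re| < lam) : AnalyticAt ℂ (kernelIntegral k) x := by
  have : DifferentiableOn ℂ (kernelIntegral k) {x : ℂ | |x.re| < lam} := fun y hy =>
    (hk.hasDerivAt hy).differentiableAt.differentiableWithinAt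
  exact this.analyticAt ((isOpen_strip lam).mem_nhds hx)

/-- The kernel `1 / sinh t`. -/
def sinhKernel (t : ℝ) : ℝ := (Real.sinh t)⁻¹

lemma isKernel_sinhKernel : IsKernel sinhKernel 1 where
  continuousOn := by
    unfold sinhKernel
    exact ContinuousOn.inv₀ (by fun_prop) fun t ht => (Real.sinh_pos_iff.mpr ht).ne'
  bound t ht := by
    have hs := Real.sinh_pos_iff.mpr ht
    rw [sinhKernel, abs_of_pos (inv_pos.mpr hs)]
    refine (inv_sinh_le ht).trans ?_
    rw [neg_one_mul]
    gcongr
    nlinarith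

/-- The kernel `sinh (a t) / sinh (t)²`. -/
def sinhSqKernel (a : ℝ) (t : ℝ) : ℝ := Real.sinh (a * t) / Real.sinh t ^ 2

lemma sinh_le_mul_exp {y : ℝ} (hy : 0 ≤ y) : Real.sinh y ≤ y * Real.exp y := by
  have := norm_sinh_le (y : ℂ)
  rw [← Complex.ofReal_sinh, Complex.norm_real, Complex.norm_real, Complex.ofReal_re,
    Real.norm_of_nonneg hy, abs_of_nonneg hy] at this
  exact (le_abs_self _).trans this

lemma isKernel_sinhSqKernel {a : ℝ} (h₀ : 0 ≤ a) (h₁ : a ≤ 1) :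
    IsKernel (sinhSqKernel a) (2 - a) where
  continuousOn := by
    unfold sinhSqKernel
    exact ContinuousOn.div (by fun_prop) (by fun_prop)
      fun t ht => pow_ne_zero 2 (Real.sinh_pos_iff.mpr ht).ne'
  bound t ht := by
    have hs := Real.sinh_pos_iff.mpr ht
    have ha : 0 ≤ Real.sinh (a * t) := Real.sinh_nonneg_iff.mpr (by positivity)
    rw [sinhSqKernel, abs_of_nonneg (by positivity), div_eq_mul_inv, ← inv_pow]
    calc Real.sinh (a * t) * (Real.sinh t)⁻¹ ^ 2
        ≤ (a * t * Real.exp (a * t)) * ((1 + 2 * t) * Real.exp (-t) / t) ^ 2 := by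
          gcongr
          · exact sinh_le_mul_exp (by positivity)
          · exact inv_sinh_le ht
      _ = a * ((1 + 2 * t) ^ 2 * (Real.exp (a * t) * (Real.exp (-t) * Real.exp (-t))) / t) := by
          field_simp
      _ ≤ 1 * ((1 + 2 * t) ^ 2 * (Real.exp (a * t) * (Real.exp (-t) * Real.exp (-t))) / t) := by
          gcongr
      _ = _ := by
          rw [← Real.exp_add, ← Real.exp_add, one_mul]
          congr 3
          ring

/-! ### The logarithm of the cosine as an integral -/

lemma hasSum_exp_odd {t : ℝ} (ht : 0 < t) :
    HasSum (fun n : ℕ => 2 * Real.exp (-((2 * n + 1 : ℝ) * t))) (Real.sinh t)⁻¹ := by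
  have h1 : Real.exp (-2 * t) < 1 := Real.exp_lt_one_iff.mpr (by linarith)
  have h := (hasSum_geometric_of_lt_one (Real.exp_pos _).le h1).mul_left (2 * Real.exp (-t))
  have hp := Real.exp_pos t
  have hs := Real.sinh_pos_iff.mpr ht
  have h2 : Real.exp (-2 * t) = Real.exp (-t) * Real.exp (-t) := by
    rw [← Real.exp_add]
    congr 1
    ring
  have h3 : Real.exp t * Real.exp (-t) = 1 := by rw [← Real.exp_add]; simp
  have h4 : 1 - Real.exp (-2 * t) = 2 * Real.exp (-t) * Real.sinh t := by
    rw [h2, Real.sinh_eq]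
    linear_combination -h3
  have h5 : 2 * Real.exp (-t) * (1 - Real.exp (-2 * t))⁻¹ = (Real.sinh t)⁻¹ := by
    rw [h4, mul_inv, ← mul_assoc, mul_inv_cancel₀ (by positivity), one_mul]
  rw [h5] at h
  refine h.congr_fun fun n => ?_
  rw [mul_assoc, ← Real.exp_nat_mul, ← Real.exp_add]
  congr 2
  ring

lemma integral_sinh_exp {b : ℂ} {c : ℝ} (h : |b.re| < c) :
    ∫ t in Set.Ioi (0 : ℝ), Complex.sinh (t * b) * (2 * Real.exp (-(c * t)) : ℝ) =
      1 / (c - b) - 1 / (c + b) := by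
  obtain ⟨h1, h2⟩ := abs_lt.mp h
  have e : ∀ t : ℝ, Complex.sinh (t * b) * (2 * Real.exp (-(c * t)) : ℝ) =
      Complex.exp ((b - c) * t) - Complex.exp ((-b - c) * t) := by
    intro t
    rw [Complex.sinh]
    push_cast
    rw [show (b - c) * t = (t : ℂ) * b + -(c * t) by ring,
      show (-b - c) * t = -((t : ℂ) * b) + -(c * t) by ring, Complex.exp_add, Complex.exp_add]
    ring
  have r1 : (b - c).re < 0 := by simp; linarith
  have r2 : (-b - c).re < 0 := by simp; linarith
  simp_rw [e]
  rw [MeasureTheory.integral_sub (integrableOn_exp_mul_complex_Ioi r1 0)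
    (integrableOn_exp_mul_complex_Ioi r2 0), integral_exp_mul_complex_Ioi r1,
    integral_exp_mul_complex_Ioi r2]
  simp only [Complex.ofReal_zero, mul_zero, Complex.exp_zero]
  rw [show b - c = -(c - b) by ring, show -b - c = -(c + b) by ring, neg_div_neg_eq,
    neg_div_neg_eq]

lemma hasSum_integral_sinh {b : ℂ} (hb : |b.re| < 1) :
    HasSum (fun n : ℕ => 1 / ((2 * n + 1 : ℝ) - b) - 1 / ((2 * n + 1 : ℝ) + b))
      (∫ t in Set.Ioi (0 : ℝ), (sinhKernel t : ℂ) * Complex.sinh (t * b)) := by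
  have hn : ∀ n : ℕ, |b.re| < (2 * n + 1 : ℝ) := fun n => hb.trans_le (by
    have : (0 : ℝ) ≤ n := n.cast_nonneg
    linarith)
  simp_rw [← fun n => integral_sinh_exp (hn n)]
  have hsum : ∀ t : ℝ, 0 < t →
      HasSum (fun n : ℕ => ‖Complex.sinh (t * b)‖ * (2 * Real.exp (-((2 * n + 1 : ℝ) * t))))
        (‖Complex.sinh (t * b)‖ * (Real.sinh t)⁻¹) := fun t ht =>
    (hasSum_exp_odd ht).mul_left _
  refine MeasureTheory.hasSum_integral_of_dominated_convergence
    (fun n t => ‖Complex.sinh (t * b)‖ * (2 * Real.exp (-((2 * n + 1 : ℝ) * t)))) ?_ ?_ ?_ ?_ ?_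
  · intro n
    exact Continuous.aestronglyMeasurable (by fun_prop)
  · intro n
    refine Eventually.of_forall fun t => ?_
    rw [norm_mul, Complex.norm_real, Real.norm_of_nonneg (by positivity)]
  · refine (MeasureTheory.ae_restrict_iff' measurableSet_Ioi).mpr (Eventually.of_forall ?_)
    intro t ht
    exact (hsum t ht).summable
  · have h := (integrableOn_poly_exp (sub_pos.mpr hb)).const_mul ‖b‖
    have hI : MeasureTheory.IntegrableOn
        (fun t : ℝ => ‖Complex.sinh (t * b)‖ * (Real.sinh t)⁻¹) (Set.Ioi 0) := by
      refine MeasureTheory.Integrable.mono' h ?_ ?_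
      · refine ContinuousOn.aestronglyMeasurable ?_ measurableSet_Ioi
        exact (Continuous.continuousOn (by fun_prop)).mul isKernel_sinhKernel.continuousOn
      · refine (MeasureTheory.ae_restrict_iff' measurableSet_Ioi).mpr (Eventually.of_forall ?_)
        intro t ht
        have := isKernel_sinhKernel.norm_mul_sinh_le ht (le_refl |b.re|) (le_refl ‖b‖)
        rw [norm_neg, norm_mul, mul_comm, Complex.norm_real] at this
        rwa [norm_mul, norm_norm]
    refine hI.congr ?_
    refine (MeasureTheory.ae_restrict_iff' measurableSet_Ioi).mpr (Eventually.of_forall ?_)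
    intro t ht
    exact (hsum t ht).tsum_eq.symm
  · refine (MeasureTheory.ae_restrict_iff' measurableSet_Ioi).mpr (Eventually.of_forall ?_)
    intro t ht
    rw [mul_comm (sinhKernel t : ℂ), sinhKernel]
    exact (Complex.hasSum_ofReal.mpr (hasSum_exp_odd ht)).mul_left _

lemma integral_sinh_div_sinh {b : ℂ} (hb : |b.re| < 1) :
    ∫ t in Set.Ioi (0 : ℝ), (sinhKernel t : ℂ) * Complex.sinh (t * b) =
      Real.pi / 2 * Complex.cot (Real.pi * ((1 - b) / 2)) := by
  obtain ⟨hb1, hb2⟩ := abs_lt.mp hb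
  set x : ℂ := (1 - b) / 2 with hx
  have hxre : x.re = (1 - b.re) / 2 := by
    simp [hx]
  have hxZ : x ∈ Complex.integerComplement := by
    rintro ⟨k, hk⟩
    have : (k : ℝ) = (1 - b.re) / 2 := by
      rw [← hxre, ← hk]
      simp
    have h1 : (0 : ℝ) < k := by linarith
    have h2 : (k : ℝ) < 1 := by linarith
    norm_cast at h1 h2
    omega
  have hpos : ∀ n : ℕ, ((2 * n + 1 : ℝ) : ℂ) - b ≠ 0 := by
    intro n h
    have := congrArg Complex.re h
    simp only [Complex.sub_re, Complex.ofReal_re, Complex.zero_re] at this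
    have : (0 : ℝ) ≤ n := n.cast_nonneg
    linarith
  have hpos' : ∀ n : ℕ, ((2 * n + 1 : ℝ) : ℂ) + b ≠ 0 := by
    intro n h
    have := congrArg Complex.re h
    simp only [Complex.add_re, Complex.ofReal_re, Complex.zero_re] at this
    have : (0 : ℝ) ≤ n := n.cast_nonneg
    linarith
  have hx0 : x ≠ 0 := by
    rw [hx]
    have := hpos 0
    simp only [Nat.cast_zero, mul_zero, zero_add, Complex.ofReal_one] at this
    exact div_ne_zero this two_ne_zero
  have key : ∀ M : ℕ, ∑ n ∈ Finset.range M,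
      (1 / (((2 * n + 1 : ℝ) : ℂ) - b) - 1 / (((2 * n + 1 : ℝ) : ℂ) + b)) =
      1 / 2 * ∑ j ∈ Finset.range M, cotTerm x j + 1 / (2 * x) -
        1 / (((2 * M + 1 : ℝ) : ℂ) - b) := by
    intro M
    induction M with
    | zero =>
      have : (2 : ℂ) * x = 1 - b := by
        rw [hx]
        ring
      simp [this]
    | succ M ih =>
      rw [Finset.sum_range_succ, ih, Finset.sum_range_succ, cotTerm]
      have h1 : x - (M + 1) = -(((2 * M + 1 : ℝ) : ℂ) + b) / 2 := by
        rw [hx]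
        push_cast
        ring
      have h2 : x + (M + 1) = (((2 * (M + 1 : ℕ) + 1 : ℝ) : ℂ) - b) / 2 := by
        rw [hx]
        push_cast
        ring
      rw [h1, h2]
      have := hpos M
      have := hpos' M
      have := hpos (M + 1)
      generalize ((2 * (M + 1 : ℕ) + 1 : ℝ) : ℂ) - b = A at *
      generalize ((2 * M + 1 : ℝ) : ℂ) - b = B at *
      generalize ((2 * M + 1 : ℝ) : ℂ) + b = C at *
      field_simp
      ring
  have hlim : Tendsto (fun M : ℕ => 1 / (((2 * M + 1 : ℝ) : ℂ) - b)) atTop (𝓝 0) := by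
    simp_rw [one_div]
    apply tendsto_inv₀_cobounded.comp
    rw [← tendsto_norm_atTop_iff_cobounded]
    apply tendsto_atTop_mono (f := fun M : ℕ => (M : ℝ) - ‖b‖) _
      (tendsto_atTop_add_const_right _ _ tendsto_natCast_atTop_atTop)
    intro M
    have := norm_sub_norm_le (((2 * M + 1 : ℝ) : ℂ)) b
    have hM : (0 : ℝ) ≤ M := M.cast_nonneg
    rw [Complex.norm_real, Real.norm_of_nonneg (by positivity)] at this
    linarith
  have h1 := (hasSum_integral_sinh hb).tendsto_sum_nat
  have h2 := (((tendsto_logDeriv_euler_cot_sub hxZ).const_mul (1 / 2)).add_const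
    (1 / (2 * x))).sub hlim
  simp_rw [key] at h1
  rw [tendsto_nhds_unique h1 h2]
  field_simp
  ring

/-- `exp ∫ dt/t (1 - cosh (t b)) / sinh t = cos (π b / 2)`. -/
lemma exp_kernelIntegral_sinhKernel {b : ℂ} (hb : |b.re| < 1) :
    Complex.exp (kernelIntegral sinhKernel b) = Complex.cos (Real.pi * b / 2) := by
  have hder : ∀ y ∈ {y : ℂ | |y.re| < 1}, HasDerivAt
      (fun y => Complex.exp (-kernelIntegral sinhKernel y) * Complex.cos (Real.pi * y / 2)) 0 y := by
    intro y hy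
    have h1 := (isKernel_sinhKernel.hasDerivAt hy).fun_neg.cexp
    have h0 : HasDerivAt (fun y : ℂ => (Real.pi : ℂ) * y / 2) ((Real.pi : ℂ) / 2) y := by
      simpa using ((hasDerivAt_id y).const_mul (Real.pi : ℂ)).div_const 2
    refine (h1.mul h0.ccos).congr_deriv ?_
    rw [MeasureTheory.integral_neg, integral_sinh_div_sinh hy, Complex.cot_eq_cos_div_sin,
      show (Real.pi : ℂ) * ((1 - y) / 2) = Real.pi / 2 - Real.pi * y / 2 by ring,
      Complex.cos_pi_div_two_sub, Complex.sin_pi_div_two_sub]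
    have hc : Complex.cos (Real.pi * y / 2) ≠ 0 := by
      rw [Ne, Complex.cos_eq_zero_iff]
      rintro ⟨k, hk⟩
      have hpi : (Real.pi : ℂ) ≠ 0 := by exact_mod_cast Real.pi_ne_zero
      have hy2 : y = 2 * k + 1 := by
        field_simp at hk
        exact hk
      have hyre : y.re = 2 * k + 1 := by
        rw [hy2]
        simp
      obtain ⟨h3, h4⟩ := abs_lt.mp (show |y.re| < 1 from hy)
      rw [hyre] at h3 h4
      have h5 : (-1 : ℝ) < k := by linarith
      have h6 : (k : ℝ) < 0 := by linarith
      norm_cast at h5 h6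
      omega
    field_simp
    ring
  have hconv : Convex ℝ {y : ℂ | |y.re| < 1} := by
    have : {w : ℂ | |w.re| < 1} = Complex.reLm ⁻¹' (Set.Ioo (-1) 1) := by
      ext w
      simp [abs_lt]
    rw [this]
    exact (convex_Ioo _ _).is_linear_preimage Complex.reLm.isLinear
  have hconst := hconv.is_const_of_fderivWithin_eq_zero (𝕜 := ℂ)
    (f := fun y => Complex.exp (-kernelIntegral sinhKernel y) * Complex.cos (Real.pi * y / 2))
    (fun y hy => (hder y hy).differentiableAt.differentiableWithinAt)
    (fun y hy => by
      rw [fderivWithin_of_isOpen (isOpen_strip 1) hy]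
      ext
      simp [(hder y hy).deriv])
    hb (show (0 : ℂ) ∈ {y : ℂ | |y.re| < 1} by simp)
  simp only [kernelIntegral_zero, neg_zero, Complex.exp_zero, mul_zero, zero_div, Complex.cos_zero,
    mul_one, Complex.exp_neg] at hconst
  have := Complex.exp_ne_zero (kernelIntegral sinhKernel b)
  field_simp at hconst
  exact hconst.symm

/-! ### The minimal form factor in a strip -/

/-- The parameter `1 - 2 / N`. -/
def kernelParam (N : ℕ) : ℝ := 1 - 2 / N

lemma kernelParam_nonneg {N : ℕ} (hN : 2 ≤ N) : 0 ≤ kernelParam N := by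
  have : (2 : ℝ) ≤ N := by exact_mod_cast hN
  rw [kernelParam, sub_nonneg, div_le_one (by linarith)]
  exact this

lemma kernelParam_le (N : ℕ) : kernelParam N ≤ 1 := by
  rw [kernelParam, sub_le_self_iff]
  positivity

lemma isKernel_kernelParam {N : ℕ} (hN : 2 ≤ N) :
    IsKernel (sinhSqKernel (kernelParam N)) (1 + 2 / N) := by
  have := isKernel_sinhSqKernel (kernelParam_nonneg hN) (kernelParam_le N)
  rwa [kernelParam, show (2 : ℝ) - (1 - 2 / N) = 1 + 2 / N by ring] at this

/-- The variable `1 - θ / (iπ)`. -/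
def crossingVar (θ : ℂ) : ℂ := 1 - θ / (Complex.I * Real.pi)

lemma crossingVar_eq (θ : ℂ) : crossingVar θ = 1 + Complex.I * θ / Real.pi := by
  rw [crossingVar, div_mul_eq_div_div, Complex.div_I]
  ring

lemma crossingVar_re (θ : ℂ) : (crossingVar θ).re = 1 - θ.im / Real.pi := by
  rw [crossingVar_eq, Complex.add_re, Complex.div_ofReal_re]
  simp
  ring

lemma abs_crossingVar_re_lt {θ : ℂ} {δ : ℝ} (h₀ : -(Real.pi * δ) < θ.im)
    (h₁ : θ.im < 2 * Real.pi + Real.pi * δ) : |(crossingVar θ).re| < 1 + δ := by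
  have hp := Real.pi_pos
  rw [crossingVar_re, abs_lt]
  constructor
  · have : θ.im / Real.pi < 2 + δ := by
      rw [div_lt_iff₀ hp]
      linarith
    linarith
  · have : -δ < θ.im / Real.pi := by
      rw [lt_div_iff₀ hp]
      linarith
    linarith

lemma abs_crossingVar_re_lt_one {θ : ℂ} (h₀ : 0 < θ.im) (h₁ : θ.im < 2 * Real.pi) :
    |(crossingVar θ).re| < 1 := by
  have := abs_crossingVar_re_lt (θ := θ) (δ := 0) (by simpa using h₀) (by simpa using h₁)
  simpa using this

lemma crossingVar_reflect (θ : ℂ) :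
    crossingVar (2 * Real.pi * Complex.I - θ) = -crossingVar θ := by
  have : (Real.pi : ℂ) ≠ 0 := by exact_mod_cast Real.pi_ne_zero
  rw [crossingVar_eq, crossingVar_eq]
  field_simp
  linear_combination 2 * (Real.pi : ℂ) * Complex.I_mul_I

lemma cos_crossingVar (θ : ℂ) :
    Complex.I * Complex.cos (Real.pi * crossingVar θ / 2) = hs θ := by
  have : (Real.pi : ℂ) ≠ 0 := by exact_mod_cast Real.pi_ne_zero
  rw [crossingVar_eq, show (Real.pi : ℂ) * (1 + Complex.I * θ / Real.pi) / 2 =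
    Real.pi / 2 - (-(θ / 2)) * Complex.I by field_simp; ring, Complex.cos_pi_div_two_sub,
    Complex.sin_mul_I, Complex.sinh_neg, hs]
  linear_combination -Complex.sinh (θ / 2) * Complex.I_mul_I

/-- The quotient of the minimal form factor by `sinh (θ / 2)`, in the strip
`-η < Im θ < 2π + η`. -/
def stripFactor (N : ℕ) (θ : ℂ) : ℂ :=
  -Complex.I * minimalConstant N *
    Complex.exp (kernelIntegral (sinhSqKernel (kernelParam N)) (crossingVar θ))

lemma stripFactor_ne_zero (N : ℕ) (θ : ℂ) : stripFactor N θ ≠ 0 := by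
  simp [stripFactor, minimalConstant]

lemma stripFactor_analyticAt {N : ℕ} (hN : 2 ≤ N) {θ : ℂ} (h₀ : -(2 * Real.pi / N) < θ.im)
    (h₁ : θ.im < 2 * Real.pi + 2 * Real.pi / N) : AnalyticAt ℂ (stripFactor N) θ := by
  have hx : |(crossingVar θ).re| < 1 + 2 / N :=
    abs_crossingVar_re_lt (by convert h₀ using 2; ring) (by convert h₁ using 2; ring)
  have hK := (isKernel_kernelParam hN).analyticAt hx
  have hc : AnalyticAt ℂ crossingVar θ := by
    unfold crossingVar
    fun_prop
  have : AnalyticAt ℂ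
      (fun θ => kernelIntegral (sinhSqKernel (kernelParam N)) (crossingVar θ)) θ :=
    hK.comp hc
  exact analyticAt_const.mul this.cexp

lemma stripFactor_reflect (N : ℕ) (θ : ℂ) :
    stripFactor N (2 * Real.pi * Complex.I - θ) = stripFactor N θ := by
  rw [stripFactor, crossingVar_reflect, kernelIntegral_neg, stripFactor]

lemma kernelIntegral_sub_kernelIntegral {N : ℕ} (hN : 2 ≤ N) {u : ℂ} (hu : |u.re| < 2 / N) :
    kernelIntegral (sinhSqKernel (kernelParam N)) (1 - u) +
        kernelIntegral sinhKernel (kernelParam N + u) =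
      kernelIntegral (sinhSqKernel (kernelParam N)) (1 + u) +
        kernelIntegral sinhKernel (kernelParam N - u) := by
  have hk := isKernel_kernelParam hN
  have ha := kernelParam_nonneg hN
  obtain ⟨hu1, hu2⟩ := abs_lt.mp hu
  have h2N : (2 : ℝ) / N ≤ 1 := by
    rw [kernelParam] at ha
    linarith
  have i1 := hk.integrable (x := 1 - u) (by
    rw [Complex.sub_re, Complex.one_re, abs_lt]
    constructor <;> linarith)
  have i2 := isKernel_sinhKernel.integrable (x := kernelParam N + u) (by
    rw [Complex.add_re, Complex.ofReal_re, abs_lt, kernelParam] at *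
    constructor <;> linarith)
  have i3 := hk.integrable (x := 1 + u) (by
    rw [Complex.add_re, Complex.one_re, abs_lt]
    constructor <;> linarith)
  have i4 := isKernel_sinhKernel.integrable (x := kernelParam N - u) (by
    rw [Complex.sub_re, Complex.ofReal_re, abs_lt, kernelParam] at *
    constructor <;> linarith)
  rw [kernelIntegral, kernelIntegral, kernelIntegral, kernelIntegral,
    ← MeasureTheory.integral_add i1 i2, ← MeasureTheory.integral_add i3 i4]
  refine MeasureTheory.setIntegral_congr_fun measurableSet_Ioi fun t ht => ?_
  have ht0 : (t : ℂ) ≠ 0 := by simpa using (ne_of_gt ht : t ≠ 0)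
  have hs0 : Complex.sinh (t : ℂ) ≠ 0 := by
    rw [← Complex.ofReal_sinh]
    exact_mod_cast (Real.sinh_pos_iff.mpr ht).ne'
  simp only [sinhSqKernel, sinhKernel, Complex.ofReal_div, Complex.ofReal_pow, Complex.ofReal_inv,
    Complex.ofReal_sinh, Complex.ofReal_mul]
  rw [mul_comm (kernelParam N : ℂ) (t : ℂ), mul_sub (t : ℂ) 1 u, mul_add (t : ℂ) 1 u,
    mul_sub (t : ℂ) _ u, mul_add (t : ℂ) _ u, mul_one,
    Complex.cosh_add, Complex.cosh_add, Complex.cosh_sub, Complex.cosh_sub]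
  field_simp
  ring

lemma stripFactor_watson {N : ℕ} (hN : 2 ≤ N) {θ : ℂ} (h : |θ.im| < 2 * Real.pi / N) :
    stripFactor N θ * hs (θ - Complex.I * eta N) =
      -(stripFactor N (-θ) * hs (θ + Complex.I * eta N)) := by
  have hpi : (Real.pi : ℂ) ≠ 0 := by exact_mod_cast Real.pi_ne_zero
  have hpR := Real.pi_pos
  have hN0 : (N : ℂ) ≠ 0 := by
    norm_cast
    omega
  set u : ℂ := θ / (Complex.I * Real.pi) with hu
  have hue : u = -(Complex.I * θ / Real.pi) := by
    rw [hu, div_mul_eq_div_div, Complex.div_I]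
    ring
  have hure : u.re = θ.im / Real.pi := by
    rw [hue, Complex.neg_re, Complex.div_ofReal_re]
    simp
    ring
  have hu2 : |u.re| < 2 / N := by
    rw [hure, abs_div, abs_of_pos hpR, div_lt_iff₀ hpR, div_mul_eq_mul_div]
    exact h
  have ha := kernelParam_nonneg hN
  obtain ⟨hu3, hu4⟩ := abs_lt.mp hu2
  have key := congrArg Complex.exp (kernelIntegral_sub_kernelIntegral hN hu2)
  rw [Complex.exp_add, Complex.exp_add, exp_kernelIntegral_sinhKernel (by
    rw [Complex.add_re, Complex.ofReal_re, abs_lt, kernelParam] at *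
    constructor <;> linarith), exp_kernelIntegral_sinhKernel (by
    rw [Complex.sub_re, Complex.ofReal_re, abs_lt, kernelParam] at *
    constructor <;> linarith)] at key
  have e1 : Complex.I * Complex.cos (Real.pi * (kernelParam N + u) / 2) =
      -hs (θ - Complex.I * eta N) := by
    have h1 : (kernelParam N : ℂ) + u = crossingVar (-(θ - Complex.I * eta N)) := by
      rw [crossingVar_eq, hue, kernelParam, eta]
      push_cast
      field_simp
      linear_combination -2 * (Real.pi : ℂ) * Complex.I_mul_I
    rw [h1, cos_crossingVar, hs_neg]
  have e2 : Complex.I * Complex.cos (Real.pi * (kernelParam N - u) / 2) =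
      hs (θ + Complex.I * eta N) := by
    have h1 : (kernelParam N : ℂ) - u = crossingVar (θ + Complex.I * eta N) := by
      rw [crossingVar_eq, hue, kernelParam, eta]
      push_cast
      field_simp
      linear_combination -2 * (Real.pi : ℂ) * Complex.I_mul_I
    rw [h1, cos_crossingVar]
  have c1 : crossingVar θ = 1 - u := rfl
  have c2 : crossingVar (-θ) = 1 + u := by
    rw [crossingVar, neg_div, sub_neg_eq_add]
  rw [stripFactor, stripFactor, c1, c2, ← e2]
  rw [eq_comm, neg_eq_iff_eq_neg, eq_comm, ← mul_neg, ← e1]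
  linear_combination (-Complex.I * minimalConstant N * Complex.I) * key

lemma minimalIntegral_eq {N : ℕ} (hN : 2 ≤ N) {θ : ℂ} (h₀ : 0 < θ.im)
    (h₁ : θ.im < 2 * Real.pi) : minimalIntegral N θ = hs θ * stripFactor N θ := by
  have hN0 : (N : ℂ) ≠ 0 := by
    norm_cast
    omega
  have hx := abs_crossingVar_re_lt_one h₀ h₁
  have hx2 : |(crossingVar θ).re| < 1 + 2 / N := hx.trans_le
    (le_add_of_nonneg_right (by positivity))
  have hsplit : (∫ t in Set.Ioi (0 : ℝ),
      (1 / (t : ℂ)) * (2 * Complex.cosh ((t : ℂ) / N) * Complex.sinh (((N : ℂ) - 1) / N * t) /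
        Complex.sinh (t : ℂ) ^ 2) * (1 - Complex.cosh (t * (1 - θ / (Complex.I * Real.pi))))) =
      kernelIntegral sinhKernel (crossingVar θ) +
        kernelIntegral (sinhSqKernel (kernelParam N)) (crossingVar θ) := by
    rw [kernelIntegral, kernelIntegral, ← MeasureTheory.integral_add
      (isKernel_sinhKernel.integrable hx) ((isKernel_kernelParam hN).integrable hx2)]
    refine MeasureTheory.setIntegral_congr_fun measurableSet_Ioi fun t ht => ?_
    have ht0 : (t : ℂ) ≠ 0 := by simpa using (ne_of_gt ht : t ≠ 0)
    have hs0 : Complex.sinh (t : ℂ) ≠ 0 := by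
      rw [← Complex.ofReal_sinh]
      exact_mod_cast (Real.sinh_pos_iff.mpr ht).ne'
    have e : 2 * Complex.cosh ((t : ℂ) / N) * Complex.sinh (((N : ℂ) - 1) / N * t) =
        Complex.sinh t + Complex.sinh (kernelParam N * t) := by
      have h1 : (t : ℂ) = ((N : ℂ) - 1) / N * t + (t : ℂ) / N := by
        field_simp
        ring
      have h2 : (kernelParam N : ℂ) * t = ((N : ℂ) - 1) / N * t - (t : ℂ) / N := by
        rw [kernelParam]
        push_cast
        field_simp
        ring
      have h3 : Complex.sinh (t : ℂ) = Complex.sinh (((N : ℂ) - 1) / N * t + (t : ℂ) / N) := by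
        rw [← h1]
      rw [h2, h3, Complex.sinh_add, Complex.sinh_sub]
      ring
    simp only [sinhSqKernel, sinhKernel, Complex.ofReal_div, Complex.ofReal_pow,
      Complex.ofReal_inv, Complex.ofReal_sinh, Complex.ofReal_mul]
    rw [e, ← crossingVar]
    field_simp
  rw [minimalIntegral, hsplit, Complex.exp_add, exp_kernelIntegral_sinhKernel hx, stripFactor,
    ← cos_crossingVar]
  linear_combination (minimalConstant N * Complex.cos (Real.pi * crossingVar θ / 2) *
    Complex.exp (kernelIntegral (sinhSqKernel (kernelParam N)) (crossingVar θ))) *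
    Complex.I_mul_I

/-! ### The product of the minimal form factors of a multiplet -/

lemma sinh_mul_sum_cosh (u y : ℂ) (M : ℕ) :
    Complex.sinh u * ∑ j ∈ Finset.range M, Complex.cosh (y - 2 * j * u) =
      Complex.sinh (M * u) * Complex.cosh (y - (M - 1) * u) := by
  induction M with
  | zero => simp
  | succ M ih =>
    rw [Finset.sum_range_succ, mul_add, ih]
    rw [show y - ((M : ℂ) - 1) * u = (y - M * u) + u by ring,
      show y - 2 * (M : ℂ) * u = (y - M * u) - M * u by ring,
      show ((M + 1 : ℕ) : ℂ) * u = M * u + u by push_cast; ring,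
      show y - (((M + 1 : ℕ) : ℂ) - 1) * u = y - M * u by push_cast; ring,
      Complex.cosh_add (y - M * u), Complex.cosh_sub (y - M * u), Complex.sinh_add]
    ring

lemma sum_cosh_identity {M : ℕ} {t : ℝ} (ht : 0 < t) (x : ℂ) :
    Complex.sinh (kernelParam (M + 2) * t) *
        ∑ j ∈ Finset.range (M + 2), Complex.cosh (t * (x - 2 * j / (M + 2 : ℕ))) =
      Complex.sinh t *
        ∑ j ∈ Finset.range M, Complex.cosh (t * (x - 2 * (j + 1 : ℕ) / (M + 2 : ℕ))) := by
  have hN0 : ((M + 2 : ℕ) : ℂ) ≠ 0 := by norm_cast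
  set u : ℂ := t / (M + 2 : ℕ) with hu
  have hu0 : Complex.sinh u ≠ 0 := by
    have : u = ((t / (M + 2 : ℕ) : ℝ) : ℂ) := by
      rw [hu]
      push_cast
      rfl
    rw [this, ← Complex.ofReal_sinh]
    exact_mod_cast (Real.sinh_pos_iff.mpr (by positivity)).ne'
  have htu : (t : ℂ) = (M + 2 : ℕ) * u := by
    rw [hu]
    field_simp
  have h1 := sinh_mul_sum_cosh u (t * x) (M + 2)
  have h2 := sinh_mul_sum_cosh u (t * x - 2 * u) M
  have e1 : ∀ j : ℕ, (t : ℂ) * (x - 2 * j / (M + 2 : ℕ)) = t * x - 2 * j * u := by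
    intro j
    rw [hu]
    ring
  have e2 : ∀ j : ℕ, (t : ℂ) * (x - 2 * (j + 1 : ℕ) / (M + 2 : ℕ)) =
      t * x - 2 * u - 2 * j * u := by
    intro j
    rw [hu]
    push_cast
    ring
  have e3 : (kernelParam (M + 2) : ℂ) * t = M * u := by
    rw [kernelParam, htu]
    have hM : (M : ℂ) + 2 ≠ 0 := by exact_mod_cast hN0
    push_cast
    field_simp
    ring
  rw [Finset.sum_congr rfl fun j _ => congrArg Complex.cosh (e1 j),
    Finset.sum_congr rfl fun j _ => congrArg Complex.cosh (e2 j)]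
  apply mul_left_cancel₀ hu0
  rw [mul_left_comm (Complex.sinh u), h1, mul_left_comm (Complex.sinh u), h2, e3, ← htu,
    show (t : ℂ) * x - 2 * u - (M - 1) * u = t * x - (((M + 2 : ℕ) : ℂ) - 1) * u by
      push_cast; ring]
  ring

lemma crossingVar_add (N : ℕ) (θ : ℂ) (j : ℕ) :
    crossingVar (θ + j * (Complex.I * eta N)) = crossingVar θ - 2 * j / N := by
  have hpi : (Real.pi : ℂ) ≠ 0 := by exact_mod_cast Real.pi_ne_zero
  have h : Complex.I * (j * (Complex.I * (2 * Real.pi / (N : ℂ)))) / Real.pi = -(2 * j / N) := by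
    rw [div_eq_iff hpi]
    linear_combination (2 * (j : ℂ) * Real.pi / N) * Complex.I_mul_I
  rw [crossingVar_eq, crossingVar_eq, eta]
  linear_combination h

lemma add_mul_I_eta_im (N : ℕ) (θ : ℂ) (j : ℕ) :
    (θ + j * (Complex.I * eta N)).im = θ.im + j * (2 * Real.pi / N) := by
  have := mul_I_mul_eta_im N j
  rw [Complex.add_im, ← this]
  simp

lemma sum_kernelIntegral {M : ℕ} {θ : ℂ} (h₀ : 0 ≤ θ.im)
    (h₁ : θ.im < 2 * Real.pi / (M + 2 : ℕ)) :
    ((M + 2 : ℕ) : ℂ) * ((∫ t in Set.Ioi (0 : ℝ), 1 / (t * Real.sinh t) *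
      ((1 - 2 / ((M + 2 : ℕ) : ℝ)) - Real.sinh (t * (1 - 2 / ((M + 2 : ℕ) : ℝ))) / Real.sinh t) : ℝ) : ℂ) +
      ∑ j ∈ Finset.range (M + 2), kernelIntegral (sinhSqKernel (kernelParam (M + 2)))
        (crossingVar (θ + j * (Complex.I * eta (M + 2)))) =
      ∑ j ∈ Finset.range M, kernelIntegral sinhKernel
        (crossingVar (θ + (j + 1 : ℕ) * (Complex.I * eta (M + 2)))) := by
  have hNpos : (0 : ℝ) < (M + 2 : ℕ) := by positivity
  have hN0 : ((M + 2 : ℕ) : ℂ) ≠ 0 := by norm_cast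
  set η : ℝ := 2 * Real.pi / (M + 2 : ℕ) with hη
  have hη0 : 0 < η := by positivity
  have hNη : ((M : ℝ) + 2) * η = 2 * Real.pi := by
    rw [hη]
    push_cast at *
    field_simp
  have hi1 : ∀ j ∈ Finset.range (M + 2), MeasureTheory.IntegrableOn (fun t : ℝ =>
      1 / (t : ℂ) * sinhSqKernel (kernelParam (M + 2)) t *
        (1 - Complex.cosh (t * crossingVar (θ + j * (Complex.I * eta (M + 2)))))) (Set.Ioi 0) := by
    intro j hj
    refine (isKernel_kernelParam (by omega)).integrable (abs_crossingVar_re_lt ?_ ?_)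
    · rw [add_mul_I_eta_im]
      have : 0 < Real.pi * (2 / (M + 2 : ℕ)) := by positivity
      have : 0 ≤ (j : ℝ) * (2 * Real.pi / (M + 2 : ℕ)) := by positivity
      linarith
    · rw [add_mul_I_eta_im, ← hη, show Real.pi * (2 / (M + 2 : ℕ)) = η by rw [hη]; ring]
      have : (j : ℝ) ≤ M + 1 := by
        have := Finset.mem_range.mp hj
        exact_mod_cast (by omega : j ≤ M + 1)
      nlinarith
  have hi2 : ∀ j ∈ Finset.range M, MeasureTheory.IntegrableOn (fun t : ℝ =>
      1 / (t : ℂ) * sinhKernel t *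
        (1 - Complex.cosh (t * crossingVar (θ + (j + 1 : ℕ) * (Complex.I * eta (M + 2))))))
        (Set.Ioi 0) := by
    intro j hj
    refine isKernel_sinhKernel.integrable (abs_crossingVar_re_lt_one ?_ ?_)
    · rw [add_mul_I_eta_im]
      positivity
    · rw [add_mul_I_eta_im, ← hη]
      have : ((j + 1 : ℕ) : ℝ) ≤ M := by
        have := Finset.mem_range.mp hj
        exact_mod_cast (by omega : j + 1 ≤ M)
      nlinarith
  have e1 : ∑ j ∈ Finset.range (M + 2), kernelIntegral (sinhSqKernel (kernelParam (M + 2)))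
      (crossingVar (θ + j * (Complex.I * eta (M + 2)))) = _ :=
    (MeasureTheory.integral_finsetSum _ hi1).symm
  have e2 : ∑ j ∈ Finset.range M, kernelIntegral sinhKernel
      (crossingVar (θ + (j + 1 : ℕ) * (Complex.I * eta (M + 2)))) = _ :=
    (MeasureTheory.integral_finsetSum _ hi2).symm
  rw [← eq_sub_iff_add_eq, e1, e2, ← MeasureTheory.integral_sub
    (MeasureTheory.integrable_finsetSum _ hi2) (MeasureTheory.integrable_finsetSum _ hi1),
    ← integral_complex_ofReal, ← MeasureTheory.integral_const_mul]
  refine MeasureTheory.setIntegral_congr_fun measurableSet_Ioi fun t ht => ?_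
  have ht0 : (t : ℂ) ≠ 0 := by simpa using (ne_of_gt ht : t ≠ 0)
  have hs0 : Complex.sinh (t : ℂ) ≠ 0 := by
    rw [← Complex.ofReal_sinh]
    exact_mod_cast (Real.sinh_pos_iff.mpr ht).ne'
  have key := sum_cosh_identity (M := M) ht (crossingVar θ)
  have ha : t * (1 - 2 / ((M + 2 : ℕ) : ℝ)) = kernelParam (M + 2) * t := by
    rw [kernelParam, mul_comm]
  simp only [crossingVar_add, ha, sinhSqKernel, sinhKernel]
  simp_rw [← Finset.mul_sum]
  have hM : (M : ℂ) + 2 ≠ 0 := by exact_mod_cast hN0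
  simp only [Finset.sum_sub_distrib, Finset.sum_const, Finset.card_range, nsmul_eq_mul, mul_one]
  push_cast at key ⊢
  generalize ∑ j ∈ Finset.range (M + 2),
    Complex.cosh (t * (crossingVar θ - 2 * j / ((M : ℂ) + 2))) = X at *
  generalize ∑ j ∈ Finset.range M,
    Complex.cosh (t * (crossingVar θ - 2 * ((j : ℂ) + 1) / ((M : ℂ) + 2))) = Y at *
  generalize Complex.sinh (kernelParam (M + 2) * t) = A at *
  field_simp
  linear_combination -key

lemma prod_stripFactor {M : ℕ} {θ : ℂ} (h₀ : 0 ≤ θ.im)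
    (h₁ : θ.im < 2 * Real.pi / (M + 2 : ℕ)) :
    ∏ j ∈ Finset.range (M + 2), stripFactor (M + 2) (θ + j * (Complex.I * eta (M + 2))) =
      ∏ j ∈ Finset.range M, hs (θ + (j + 1 : ℕ) * (Complex.I * eta (M + 2))) := by
  have hNpos : (0 : ℝ) < (M + 2 : ℕ) := by positivity
  have hN0 : ((M + 2 : ℕ) : ℂ) ≠ 0 := by norm_cast
  set η : ℝ := 2 * Real.pi / (M + 2 : ℕ) with hη
  have hη0 : 0 < η := by positivity
  have hNη : ((M : ℝ) + 2) * η = 2 * Real.pi := by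
    rw [hη]
    push_cast at *
    field_simp
  have hR : ∀ j ∈ Finset.range M, hs (θ + (j + 1 : ℕ) * (Complex.I * eta (M + 2))) =
      Complex.I * Complex.exp (kernelIntegral sinhKernel
        (crossingVar (θ + (j + 1 : ℕ) * (Complex.I * eta (M + 2))))) := by
    intro j hj
    rw [exp_kernelIntegral_sinhKernel, cos_crossingVar]
    apply abs_crossingVar_re_lt_one
    · rw [add_mul_I_eta_im]
      positivity
    · rw [add_mul_I_eta_im, ← hη]
      have : ((j + 1 : ℕ) : ℝ) ≤ M := by
        have := Finset.mem_range.mp hj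
        exact_mod_cast (by omega : j + 1 ≤ M)
      nlinarith
  rw [Finset.prod_congr rfl hR, Finset.prod_mul_distrib, ← Complex.exp_sum,
    ← sum_kernelIntegral h₀ h₁]
  simp only [stripFactor, Finset.prod_mul_distrib, ← Complex.exp_sum, Finset.prod_const,
    Finset.card_range]
  rw [Complex.exp_add, Complex.exp_nat_mul, minimalConstant, mul_pow, ← Complex.exp_nat_mul,
    show ((M + 2 : ℕ) : ℂ) * (Complex.I * Real.pi * (((M + 2 : ℕ) : ℂ) - 1) / (M + 2 : ℕ)) =
      ((M + 1 : ℕ) : ℂ) * (Real.pi * Complex.I) by push_cast at *; field_simp; ring,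
    Complex.exp_nat_mul, Complex.exp_pi_mul_I]
  have : (-Complex.I) ^ (M + 2) * (-1) ^ (M + 1) = Complex.I ^ M := by
    rw [neg_pow, pow_add Complex.I, Complex.I_sq, pow_add, pow_add (-1 : ℂ) M 1]
    have : ((-1 : ℂ) ^ M) * (-1) ^ M = 1 := by
      rw [← mul_pow]
      simp
    linear_combination (Complex.I ^ M) * this
  rw [← this]
  ring

/-! ### The meromorphic continuation of the minimal form factor -/

/-- The multiplier of the quotient of the minimal form factor by `sinh (θ / 2)` under the
translation by `2πi`. -/
def multiplier (N : ℕ) (θ : ℂ) : ℂ := -smatrix N (-θ)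

lemma multiplier_eq (N : ℕ) (θ : ℂ) :
    multiplier N θ = -(hs (θ - Complex.I * eta N) / hs (θ + Complex.I * eta N)) := by
  rw [multiplier, smatrix_neg, smatrix_eq, inv_div]

lemma multiplier_neg (N : ℕ) (θ : ℂ) : multiplier N (-θ) = (multiplier N θ)⁻¹ := by
  rw [multiplier, multiplier, neg_neg, smatrix_neg, inv_neg, inv_inv]

lemma multiplier_add_two_pi (N : ℕ) (θ : ℂ) :
    multiplier N (θ + 2 * Real.pi * Complex.I) = multiplier N θ := by
  rw [multiplier, multiplier, smatrix_neg, smatrix_neg, smatrix_add_two_pi]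

lemma multiplier_sub_two_pi_mul (N : ℕ) (θ : ℂ) (k : ℤ) :
    multiplier N (θ - 2 * Real.pi * Complex.I * k) = multiplier N θ := by
  have h : Function.Periodic (multiplier N) (2 * Real.pi * Complex.I) := multiplier_add_two_pi N
  rw [mul_comm]
  exact h.sub_int_mul_eq k

lemma Regular.multiplier_ne_zero {N : ℕ} {z : ℂ} (h : Regular N z) : multiplier N z ≠ 0 :=
  neg_ne_zero.mpr h.neg.smatrix_ne_zero

lemma meromorphicAt_multiplier (N : ℕ) (z : ℂ) : MeromorphicAt (multiplier N) z := by
  have h : multiplier N =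
      -((fun θ => hs (θ - Complex.I * eta N)) / fun θ => hs (θ + Complex.I * eta N)) := by
    ext θ
    exact multiplier_eq N θ
  rw [h]
  refine (MeromorphicAt.div (AnalyticAt.meromorphicAt ?_) (AnalyticAt.meromorphicAt ?_)).neg
  · exact (analyticAt_hs _).fun_comp (f := fun θ => θ - Complex.I * eta N) (by fun_prop)
  · exact (analyticAt_hs _).fun_comp (f := fun θ => θ + Complex.I * eta N) (by fun_prop)

lemma Regular.analyticAt_multiplier {N : ℕ} {z : ℂ} (h : Regular N z) :
    AnalyticAt ℂ (multiplier N) z := by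
  have e : multiplier N =
      -((fun θ => hs (θ - Complex.I * eta N)) / fun θ => hs (θ + Complex.I * eta N)) := by
    ext θ
    exact multiplier_eq N θ
  rw [e]
  refine AnalyticAt.neg (AnalyticAt.div (𝕜 := ℂ) ?_ ?_ h.2)
  · exact (analyticAt_hs _).fun_comp (f := fun θ => θ - Complex.I * eta N) (by fun_prop)
  · exact (analyticAt_hs _).fun_comp (f := fun θ => θ + Complex.I * eta N) (by fun_prop)

lemma two_pi_I_mul_im (k : ℤ) : (2 * Real.pi * Complex.I * (k : ℂ)).im = 2 * Real.pi * k := by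
  simp

lemma regular_of_abs_im_lt {N : ℕ} (hN : 2 ≤ N) {z : ℂ} (h : |z.im| < 2 * Real.pi / N) :
    Regular N z := by
  have hN2 : (2 : ℝ) ≤ N := by exact_mod_cast hN
  have hle : 2 * Real.pi / N ≤ Real.pi := by
    rw [div_le_iff₀ (by linarith)]
    nlinarith [Real.pi_pos]
  have h1 := abs_lt.mp h
  have h2 := I_mul_eta_im N
  constructor
  · rw [← neg_ne_zero, ← hs_neg]
    apply hs_ne_zero_of_im <;> rw [Complex.neg_im, Complex.sub_im, h2] <;> linarith [Real.pi_pos]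
  · apply hs_ne_zero_of_im <;> rw [Complex.add_im, h2] <;> linarith [Real.pi_pos]

lemma stripFactor_add_two_pi {N : ℕ} (hN : 2 ≤ N) {w : ℂ} (h : |w.im| < 2 * Real.pi / N) :
    stripFactor N (w + 2 * Real.pi * Complex.I) = stripFactor N w * multiplier N w := by
  have hr := regular_of_abs_im_lt hN h
  rw [← stripFactor_reflect, sub_add_cancel_right, multiplier_eq]
  have := stripFactor_watson hN h
  have h2 := hr.2
  field_simp
  linear_combination this

/-- The meromorphic continuation of `stripFactor`. -/
def regularPart (N : ℕ) (θ : ℂ) : ℂ :=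
  stripFactor N (θ - 2 * Real.pi * Complex.I * ⌊θ.im / (2 * Real.pi)⌋) *
    multiplier N θ ^ ⌊θ.im / (2 * Real.pi)⌋

lemma floor_im_bounds (θ : ℂ) :
    2 * Real.pi * ⌊θ.im / (2 * Real.pi)⌋ ≤ θ.im ∧
      θ.im < 2 * Real.pi * ⌊θ.im / (2 * Real.pi)⌋ + 2 * Real.pi := by
  have hp := Real.two_pi_pos
  have h1 := Int.floor_le (θ.im / (2 * Real.pi))
  have h2 := Int.lt_floor_add_one (θ.im / (2 * Real.pi))
  rw [le_div_iff₀ hp] at h1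
  rw [div_lt_iff₀ hp] at h2
  constructor <;> nlinarith

lemma regularPart_eq {N : ℕ} (hN : 2 ≤ N) {θ : ℂ} (m : ℤ)
    (h₀ : 2 * Real.pi * m - 2 * Real.pi / N < θ.im)
    (h₁ : θ.im < 2 * Real.pi * m + 2 * Real.pi + 2 * Real.pi / N) :
    regularPart N θ = stripFactor N (θ - 2 * Real.pi * Complex.I * m) * multiplier N θ ^ m := by
  have hp := Real.two_pi_pos
  have hN2 : (2 : ℝ) ≤ N := by exact_mod_cast hN
  have hle : 2 * Real.pi / N ≤ Real.pi := by
    rw [div_le_iff₀ (by linarith)]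
    nlinarith [Real.pi_pos]
  obtain ⟨hb1, hb2⟩ := floor_im_bounds θ
  rw [regularPart]
  generalize ⌊θ.im / (2 * Real.pi)⌋ = k at *
  have step : ∀ l : ℤ, |θ.im - 2 * Real.pi * l| < 2 * Real.pi / N →
      stripFactor N (θ - 2 * Real.pi * Complex.I * l) * multiplier N θ ^ l =
        stripFactor N (θ - 2 * Real.pi * Complex.I * (l - 1 : ℤ)) * multiplier N θ ^ (l - 1) := by
    intro l hl
    have hl' : |(θ - 2 * Real.pi * Complex.I * l).im| < 2 * Real.pi / N := by
      rwa [Complex.sub_im, two_pi_I_mul_im]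
    have h := stripFactor_add_two_pi hN hl'
    have hq := (regular_of_abs_im_lt hN hl').multiplier_ne_zero
    rw [multiplier_sub_two_pi_mul] at h hq
    rw [show θ - 2 * Real.pi * Complex.I * (l - 1 : ℤ) =
      θ - 2 * Real.pi * Complex.I * l + 2 * Real.pi * Complex.I by push_cast; ring, h,
      zpow_sub_one₀ hq]
    field_simp
  have hk1 : k ≤ m + 1 := by
    by_contra hcon
    have : (m : ℝ) + 2 ≤ k := by exact_mod_cast (by omega : m + 2 ≤ k)
    nlinarith
  have hk2 : m - 1 ≤ k := by
    by_contra hcon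
    have : (k : ℝ) + 2 ≤ m := by exact_mod_cast (by omega : k + 2 ≤ m)
    nlinarith
  obtain rfl | rfl | rfl : k = m ∨ k = m + 1 ∨ k = m - 1 := by omega
  · rfl
  · rw [step (m + 1), add_sub_cancel_right]
    push_cast at *
    rw [abs_lt]
    constructor <;> nlinarith
  · rw [step m]
    push_cast at *
    rw [abs_lt]
    constructor <;> nlinarith

lemma regularPart_eq_stripFactor {N : ℕ} (hN : 2 ≤ N) {θ : ℂ} (h₀ : -(2 * Real.pi / N) < θ.im)
    (h₁ : θ.im < 2 * Real.pi + 2 * Real.pi / N) : regularPart N θ = stripFactor N θ := by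
  have := regularPart_eq hN (θ := θ) 0 (by simpa using h₀) (by simpa using h₁)
  simpa using this

lemma regularPart_eventuallyEq {N : ℕ} (hN : 2 ≤ N) (θ : ℂ) :
    regularPart N =ᶠ[𝓝 θ] fun z =>
      stripFactor N (z - 2 * Real.pi * Complex.I * ⌊θ.im / (2 * Real.pi)⌋) *
        multiplier N z ^ ⌊θ.im / (2 * Real.pi)⌋ := by
  obtain ⟨hb1, hb2⟩ := floor_im_bounds θ
  have hη : 0 < 2 * Real.pi / N := by
    have : 0 < N := by omega
    positivity
  have h1 : ∀ᶠ z : ℂ in 𝓝 θ,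
      2 * Real.pi * ⌊θ.im / (2 * Real.pi)⌋ - 2 * Real.pi / N < z.im :=
    Complex.continuous_im.continuousAt.eventually (lt_mem_nhds (by linarith))
  have h2 : ∀ᶠ z : ℂ in 𝓝 θ,
      z.im < 2 * Real.pi * ⌊θ.im / (2 * Real.pi)⌋ + 2 * Real.pi + 2 * Real.pi / N :=
    Complex.continuous_im.continuousAt.eventually (gt_mem_nhds (by linarith))
  filter_upwards [h1, h2] with z hz1 hz2
  exact regularPart_eq hN _ hz1 hz2

lemma stripFactor_translate_analyticAt {N : ℕ} (hN : 2 ≤ N) (θ : ℂ) :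
    AnalyticAt ℂ
      (fun z => stripFactor N (z - 2 * Real.pi * Complex.I * ⌊θ.im / (2 * Real.pi)⌋)) θ := by
  obtain ⟨hb1, hb2⟩ := floor_im_bounds θ
  have hη : 0 < 2 * Real.pi / N := by
    have : 0 < N := by omega
    positivity
  refine (stripFactor_analyticAt hN ?_ ?_).fun_comp
    (f := fun z => z - 2 * Real.pi * Complex.I * ⌊θ.im / (2 * Real.pi)⌋) (by fun_prop)
  · rw [Complex.sub_im, two_pi_I_mul_im]
    linarith
  · rw [Complex.sub_im, two_pi_I_mul_im]
    linarith

lemma regularPart_analyticAt {N : ℕ} (hN : 2 ≤ N) {θ : ℂ} (h : Regular N θ) :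
    AnalyticAt ℂ (regularPart N) θ := by
  refine AnalyticAt.congr ?_ (regularPart_eventuallyEq hN θ).symm
  exact (stripFactor_translate_analyticAt hN θ).mul
    (h.analyticAt_multiplier.zpow h.multiplier_ne_zero)

lemma regularPart_meromorphicAt {N : ℕ} (hN : 2 ≤ N) (θ : ℂ) :
    MeromorphicAt (regularPart N) θ := by
  refine MeromorphicAt.congr ?_ ((regularPart_eventuallyEq hN θ).symm.filter_mono nhdsWithin_le_nhds)
  exact (stripFactor_translate_analyticAt hN θ).meromorphicAt.mul
    ((meromorphicAt_multiplier N θ).zpow _)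

lemma regularPart_ne_zero {N : ℕ} {θ : ℂ} (h : Regular N θ) : regularPart N θ ≠ 0 :=
  mul_ne_zero (stripFactor_ne_zero _ _) (zpow_ne_zero _ h.multiplier_ne_zero)

lemma regularPart_neg_eq_mul {N : ℕ} (hN : 2 ≤ N) {θ : ℂ} (h : Regular N θ) :
    regularPart N (-θ) = regularPart N θ * multiplier N θ := by
  obtain ⟨hb1, hb2⟩ := floor_im_bounds θ
  have hη : 0 < 2 * Real.pi / N := by
    have : 0 < N := by omega
    positivity
  rw [regularPart_eq hN (θ := -θ) (-⌊θ.im / (2 * Real.pi)⌋ - 1) (by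
    rw [Complex.neg_im]
    push_cast
    linarith) (by
    rw [Complex.neg_im]
    push_cast
    linarith), regularPart, ← stripFactor_reflect, multiplier_neg, inv_zpow',
    mul_assoc (stripFactor N _), ← zpow_add_one₀ h.multiplier_ne_zero]
  congr 2
  · push_cast
    ring
  · ring

lemma regularPart_add_two_pi {N : ℕ} {θ : ℂ} (h : Regular N θ) :
    regularPart N (θ + 2 * Real.pi * Complex.I) = regularPart N θ * multiplier N θ := by
  have h1 : (θ + 2 * Real.pi * Complex.I).im / (2 * Real.pi) = θ.im / (2 * Real.pi) + 1 := by
    have := Real.two_pi_pos.ne'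
    rw [Complex.add_im]
    simp
    field_simp
  rw [regularPart, h1, Int.floor_add_one, regularPart, multiplier_add_two_pi,
    mul_assoc (stripFactor N _), ← zpow_add_one₀ h.multiplier_ne_zero]
  congr 2
  push_cast
  ring

/-- `F` is the product of `sinh (z / 2)` and `E`, where `E` has the properties of the quotient of
the minimal form factor by `sinh (z / 2)`. -/
structure IsRegularPart (N : ℕ) (E F : ℂ → ℂ) : Prop where
  analyticAt : ∀ z, Regular N z → AnalyticAt ℂ E z
  meromorphicAt : ∀ z, MeromorphicAt E z
  ne_zero : ∀ z, Regular N z → E z ≠ 0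
  watson : ∀ z, Regular N z → E z = -(E (-z) * smatrix N z)
  crossing : ∀ z, Regular N z → E (z + 2 * Real.pi * Complex.I) = E (-z)
  analyticAt_strip : ∀ z : ℂ, 0 < z.im → z.im < 2 * Real.pi → AnalyticAt ℂ E z
  ne_zero_strip : ∀ z : ℂ, 0 < z.im → z.im < 2 * Real.pi → E z ≠ 0
  eq_regular : ∀ z, Regular N z → F z = hs z * E z
  eq_strip : ∀ z : ℂ, 0 < z.im → z.im < 2 * Real.pi → F z = hs z * E z
  prod_eq : ∀ z, (∀ k : ℤ, z ≠ Complex.I * eta N * k) →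
    ∏ j ∈ Finset.range N, (hs (z + j * (Complex.I * eta N)) * E (z + j * (Complex.I * eta N))) =
      ∏ j ∈ Finset.range (N - 1), kappa N (z + j * (Complex.I * eta N))

lemma hs_ne_zero_of_notMem_lattice {N : ℕ} (hN : 2 ≤ N) {z : ℂ}
    (h : ∀ k : ℤ, z ≠ Complex.I * eta N * k) (l : ℤ) : hs (z + Complex.I * eta N * l) ≠ 0 := by
  rw [Ne, hs_eq_zero_iff]
  rintro ⟨k, hk⟩
  apply h (N * k - l)
  rw [← N_mul_I_mul_eta hN] at hk
  push_cast
  linear_combination hk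

lemma regular_of_notMem_lattice {N : ℕ} (hN : 2 ≤ N) {z : ℂ}
    (h : ∀ k : ℤ, z ≠ Complex.I * eta N * k) : Regular N z := by
  have h1 := hs_ne_zero_of_notMem_lattice hN h (-1)
  have h2 := hs_ne_zero_of_notMem_lattice hN h 1
  refine ⟨?_, ?_⟩
  · convert h1 using 2
    push_cast
    ring
  · convert h2 using 2
    push_cast
    ring

lemma prod_shift_iff {N : ℕ} (hN : 2 ≤ N) {z : ℂ} (h : ∀ k : ℤ, z ≠ Complex.I * eta N * k) :
    (∏ j ∈ Finset.range N, (hs (z + Complex.I * eta N + j * (Complex.I * eta N)) *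
        regularPart N (z + Complex.I * eta N + j * (Complex.I * eta N))) =
      ∏ j ∈ Finset.range (N - 1), kappa N (z + Complex.I * eta N + j * (Complex.I * eta N))) ↔
    (∏ j ∈ Finset.range N, (hs (z + j * (Complex.I * eta N)) *
        regularPart N (z + j * (Complex.I * eta N))) =
      ∏ j ∈ Finset.range (N - 1), kappa N (z + j * (Complex.I * eta N))) := by
  have hr := regular_of_notMem_lattice hN h
  have h0 : hs z ≠ 0 := by simpa using hs_ne_zero_of_notMem_lattice hN h 0
  have hE := regularPart_ne_zero hr
  have hm := hr.multiplier_ne_zero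
  have shift : ∀ j : ℕ, z + Complex.I * eta N + j * (Complex.I * eta N) =
      z + (j + 1 : ℕ) * (Complex.I * eta N) := by
    intro j
    push_cast
    ring
  simp_rw [shift]
  obtain ⟨M, rfl⟩ : ∃ M, N = M + 2 := ⟨N - 2, by omega⟩
  set g : ℕ → ℂ := fun j => hs (z + j * (Complex.I * eta (M + 2))) *
    regularPart (M + 2) (z + j * (Complex.I * eta (M + 2))) with hg
  set q : ℕ → ℂ := fun j => kappa (M + 2) (z + j * (Complex.I * eta (M + 2))) with hq
  have e1 := (Finset.prod_range_succ' g (M + 2)).symm.trans (Finset.prod_range_succ g (M + 2))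
  have e2 := (Finset.prod_range_succ' q (M + 1)).symm.trans (Finset.prod_range_succ q (M + 1))
  have g0 : g 0 = hs z * regularPart (M + 2) z := by simp [hg]
  have gN : g (M + 2) = -(hs z * regularPart (M + 2) z * multiplier (M + 2) z) := by
    simp only [hg]
    rw [N_mul_I_mul_eta hN, hs_add_two_pi, regularPart_add_two_pi hr]
    ring
  have q0 : q 0 = hs z * hs (z + Complex.I * eta (M + 2)) := by simp [hq, kappa_eq]
  have qN : q (M + 1) = hs z * hs (z - Complex.I * eta (M + 2)) := by
    simp only [hq, kappa_eq]
    rw [show z + ((M + 1 : ℕ) : ℂ) * (Complex.I * eta (M + 2)) + Complex.I * eta (M + 2) =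
      z + ((M + 2 : ℕ) : ℂ) * (Complex.I * eta (M + 2)) by push_cast; ring,
      show z + ((M + 1 : ℕ) : ℂ) * (Complex.I * eta (M + 2)) =
      z - Complex.I * eta (M + 2) + ((M + 2 : ℕ) : ℂ) * (Complex.I * eta (M + 2)) by
        push_cast; ring, hs_add_N hN, hs_add_N hN]
    ring
  rw [show M + 2 - 1 = M + 1 by omega]
  change (∏ j ∈ Finset.range (M + 2), g (j + 1) = ∏ j ∈ Finset.range (M + 1), q (j + 1)) ↔
    (∏ j ∈ Finset.range (M + 2), g j = ∏ j ∈ Finset.range (M + 1), q j)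
  rw [g0, gN] at e1
  rw [q0, qN] at e2
  have e1' : ∏ j ∈ Finset.range (M + 2), g (j + 1) =
      -multiplier (M + 2) z * ∏ j ∈ Finset.range (M + 2), g j := by
    apply mul_right_cancel₀ (mul_ne_zero h0 hE)
    rw [e1]
    ring
  have e2' : ∏ j ∈ Finset.range (M + 1), q (j + 1) =
      -multiplier (M + 2) z * ∏ j ∈ Finset.range (M + 1), q j := by
    apply mul_right_cancel₀ (mul_ne_zero h0 hr.2)
    rw [e2, multiplier_eq]
    have := hr.2
    field_simp
  rw [e1', e2']
  exact mul_right_inj' (neg_ne_zero.mpr hm)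

lemma prod_regularPart_of_im {N : ℕ} (hN : 2 ≤ N) {z : ℂ} (h₀ : 0 ≤ z.im)
    (h₁ : z.im < 2 * Real.pi / N) :
    ∏ j ∈ Finset.range N, (hs (z + j * (Complex.I * eta N)) *
        regularPart N (z + j * (Complex.I * eta N))) =
      ∏ j ∈ Finset.range (N - 1), kappa N (z + j * (Complex.I * eta N)) := by
  obtain ⟨M, rfl⟩ : ∃ M, N = M + 2 := ⟨N - 2, by omega⟩
  have hη0 : 0 < 2 * Real.pi / (M + 2 : ℕ) := by positivity
  have hNη : ((M : ℝ) + 2) * (2 * Real.pi / (M + 2 : ℕ)) = 2 * Real.pi := by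
    push_cast
    field_simp
  have e : ∀ j ∈ Finset.range (M + 2),
      regularPart (M + 2) (z + j * (Complex.I * eta (M + 2))) =
        stripFactor (M + 2) (z + j * (Complex.I * eta (M + 2))) := by
    intro j hj
    have hj' : (j : ℝ) ≤ M + 1 := by
      have := Finset.mem_range.mp hj
      exact_mod_cast (by omega : j ≤ M + 1)
    apply regularPart_eq_stripFactor hN
    · rw [add_mul_I_eta_im]
      have : 0 ≤ (j : ℝ) * (2 * Real.pi / (M + 2 : ℕ)) := by positivity
      linarith
    · rw [add_mul_I_eta_im]
      nlinarith
  rw [Finset.prod_mul_distrib, Finset.prod_congr rfl e, prod_stripFactor h₀ h₁,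
    show M + 2 - 1 = M + 1 by omega]
  simp only [kappa_eq, Finset.prod_mul_distrib]
  have shift : ∀ j : ℕ, z + j * (Complex.I * eta (M + 2)) + Complex.I * eta (M + 2) =
      z + (j + 1 : ℕ) * (Complex.I * eta (M + 2)) := by
    intro j
    push_cast
    ring
  simp_rw [shift]
  set f : ℕ → ℂ := fun j => hs (z + j * (Complex.I * eta (M + 2)))
  change (∏ j ∈ Finset.range (M + 2), f j) * ∏ j ∈ Finset.range M, f (j + 1) =
    (∏ j ∈ Finset.range (M + 1), f j) * ∏ j ∈ Finset.range (M + 1), f (j + 1)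
  rw [Finset.prod_range_succ' f (M + 1), Finset.prod_range_succ' f M]
  ring

lemma prod_regularPart {N : ℕ} (hN : 2 ≤ N) {z : ℂ} (h : ∀ k : ℤ, z ≠ Complex.I * eta N * k) :
    ∏ j ∈ Finset.range N, (hs (z + j * (Complex.I * eta N)) *
        regularPart N (z + j * (Complex.I * eta N))) =
      ∏ j ∈ Finset.range (N - 1), kappa N (z + j * (Complex.I * eta N)) := by
  have hNpos : (0 : ℝ) < N := by
    norm_cast
    omega
  have hη : 0 < 2 * Real.pi / N := by positivity
  set m : ℤ := ⌊z.im / (2 * Real.pi / N)⌋ with hm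
  set w : ℂ := z - Complex.I * eta N * m with hw
  have hwim : w.im = z.im - (2 * Real.pi / N) * m := by
    rw [hw, Complex.sub_im, mul_comm (Complex.I * eta N)]
    have := mul_I_mul_eta_im N m
    rw [show ((m : ℤ) : ℂ) = ((m : ℝ) : ℂ) by simp, this]
    ring
  have hf1 := Int.floor_le (z.im / (2 * Real.pi / N))
  have hf2 := Int.lt_floor_add_one (z.im / (2 * Real.pi / N))
  rw [le_div_iff₀ hη] at hf1
  rw [div_lt_iff₀ hη] at hf2
  rw [← hm] at hf1 hf2
  have base := prod_regularPart_of_im hN (z := w) (by rw [hwim]; linarith)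
    (by rw [hwim]; linarith)
  have hwl : ∀ l k : ℤ, w + Complex.I * eta N * l ≠ Complex.I * eta N * k := by
    intro l k hk
    apply h (k + m - l)
    push_cast
    linear_combination hk + hw
  have all : ∀ l : ℤ, ∏ j ∈ Finset.range N,
      (hs (w + Complex.I * eta N * l + j * (Complex.I * eta N)) *
        regularPart N (w + Complex.I * eta N * l + j * (Complex.I * eta N))) =
      ∏ j ∈ Finset.range (N - 1),
        kappa N (w + Complex.I * eta N * l + j * (Complex.I * eta N)) := by
    intro l
    induction l using Int.induction_on with
    | zero => simpa using base
    | succ l ih =>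
      rw [← prod_shift_iff hN (hwl _)] at ih
      rwa [show w + Complex.I * eta N * ((l + 1 : ℤ) : ℂ) =
        w + Complex.I * eta N * ((l : ℤ) : ℂ) + Complex.I * eta N by push_cast; ring]
    | pred l ih =>
      rw [← prod_shift_iff hN (hwl _)]
      rwa [show w + Complex.I * eta N * ((-l - 1 : ℤ) : ℂ) + Complex.I * eta N =
        w + Complex.I * eta N * ((-l : ℤ) : ℂ) by push_cast; ring]
  have := all m
  rwa [hw, sub_add_cancel] at this

/-- The minimal form factor. -/
def minimalFormFactor (N : ℕ) : ℂ → ℂ :=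
  toMeromorphicNFOn (fun z => hs z * regularPart N z) Set.univ

lemma meromorphicOn_hs_mul_regularPart {N : ℕ} (hN : 2 ≤ N) :
    MeromorphicOn (fun z => hs z * regularPart N z) Set.univ := fun z _ =>
  (analyticAt_hs z).meromorphicAt.mul (regularPart_meromorphicAt hN z)

lemma minimalFormFactor_eq {N : ℕ} (hN : 2 ≤ N) {z : ℂ} (h : AnalyticAt ℂ (regularPart N) z) :
    minimalFormFactor N z = hs z * regularPart N z := by
  rw [minimalFormFactor,
    toMeromorphicNFOn_eq_toMeromorphicNFAt (meromorphicOn_hs_mul_regularPart hN) (Set.mem_univ z),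
    toMeromorphicNFAt_eq_self.mpr]
  exact ((analyticAt_hs z).mul h).meromorphicNFAt

lemma regularPart_analyticAt_of_im {N : ℕ} (hN : 2 ≤ N) {z : ℂ} (h₀ : 0 < z.im)
    (h₁ : z.im < 2 * Real.pi) : AnalyticAt ℂ (regularPart N) z := by
  have hη : 0 < 2 * Real.pi / N := by
    have : 0 < N := by omega
    positivity
  refine (stripFactor_analyticAt hN (by linarith) (by linarith)).congr ?_
  have h1 : ∀ᶠ w : ℂ in 𝓝 z, 0 < w.im :=
    Complex.continuous_im.continuousAt.eventually (lt_mem_nhds h₀)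
  have h2 : ∀ᶠ w : ℂ in 𝓝 z, w.im < 2 * Real.pi :=
    Complex.continuous_im.continuousAt.eventually (gt_mem_nhds h₁)
  filter_upwards [h1, h2] with w hw1 hw2
  exact (regularPart_eq_stripFactor hN (by linarith) (by linarith)).symm

lemma isRegularPart {N : ℕ} (hN : 2 ≤ N) :
    IsRegularPart N (regularPart N) (minimalFormFactor N) where
  analyticAt _ := regularPart_analyticAt hN
  meromorphicAt := regularPart_meromorphicAt hN
  ne_zero _ := regularPart_ne_zero
  watson z h := by
    rw [regularPart_neg_eq_mul hN h, multiplier, smatrix_neg]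
    have := h.smatrix_ne_zero
    field_simp
  crossing z h := by
    rw [regularPart_add_two_pi h, regularPart_neg_eq_mul hN h]
  analyticAt_strip _ := regularPart_analyticAt_of_im hN
  ne_zero_strip z h₀ h₁ := by
    have hη : 0 < 2 * Real.pi / N := by
      have : 0 < N := by omega
      positivity
    rw [regularPart_eq_stripFactor hN (by linarith) (by linarith)]
    exact stripFactor_ne_zero N z
  eq_regular z h := minimalFormFactor_eq hN (regularPart_analyticAt hN h)
  eq_strip z h₀ h₁ := minimalFormFactor_eq hN (regularPart_analyticAt_of_im hN h₀ h₁)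
  prod_eq _ := prod_regularPart hN

lemma isMinimalFormFactor {N : ℕ} (hN : 2 ≤ N) :
    IsMinimalFormFactor N (minimalFormFactor N) where
  meromorphic := meromorphicNFOn_toMeromorphicNFOn _ _
  eq_integral θ h₀ h₁ := by
    have hη : 0 < 2 * Real.pi / N := by
      have : 0 < N := by omega
      positivity
    rw [minimalIntegral_eq hN h₀ h₁,
      minimalFormFactor_eq hN (regularPart_analyticAt_of_im hN h₀ h₁),
      regularPart_eq_stripFactor hN (by linarith) (by linarith)]

/-! ### Evaluation of the contour integrals by residues -/

/-- The rapidities are pairwise different modulo `2πi`. -/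
def Separated {n : ℕ} (θ : Fin n → ℂ) : Prop := ∀ i j, i ≠ j → hs (θ i - θ j) ≠ 0

lemma Separated.injective {n : ℕ} {θ : Fin n → ℂ} (h : Separated θ) : Function.Injective θ := by
  intro i j hij
  by_contra hne
  apply h i j hne
  rw [hij, sub_self, hs_zero]

lemma hs_I_eta_ne_zero {N : ℕ} (hN : 2 ≤ N) : hs (Complex.I * eta N) ≠ 0 := by
  simpa using hs_mul_ne_zero (N := N) (k := 1) one_pos (by omega)

lemma analyticAt_phi {N : ℕ} {z : ℂ} (h₀ : hs z ≠ 0) (h₁ : hs (z + Complex.I * eta N) ≠ 0) :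
    AnalyticAt ℂ (phi N) z := by
  have e : phi N = fun z => (hs z * hs (z + Complex.I * eta N))⁻¹ := funext (phi_eq N)
  rw [e]
  refine AnalyticAt.inv ((analyticAt_hs z).mul ?_) (mul_ne_zero h₀ h₁)
  exact (analyticAt_hs _).fun_comp (f := fun z => z + Complex.I * eta N) (by fun_prop)

/-- The weight of the pole at `z = θ i`. -/
def poleWeight (N : ℕ) {n : ℕ} (θ : Fin n → ℂ) (i : Fin n) : ℂ :=
  ∏ j ∈ Finset.univ.erase i, phi N (θ i - θ j)

lemma exists_circleIntegral_eq {N n : ℕ} (hN : 2 ≤ N) {θ : Fin n → ℂ} (hgen : θ ∈ generic N n)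
    (hsep : Separated θ) (i : Fin n) :
    ∃ r₀ > 0, ∀ r, 0 < r → r < r₀ → ∀ g : ℂ → ℂ, Differentiable ℂ g →
      (∮ z in C(θ i, r), (∏ j, phi N (z - θ j)) * g z) =
        (2 * Real.pi * Complex.I) * (2 / hs (Complex.I * eta N)) *
          (poleWeight N θ i * g (θ i)) := by
  set q : ℂ → ℂ := fun z => hsRec (z - θ i) * (hs (z - θ i + Complex.I * eta N))⁻¹ *
    ∏ j ∈ Finset.univ.erase i, phi N (z - θ j) with hq
  have hqa : AnalyticAt ℂ q (θ i) := by
    refine (AnalyticAt.mul ?_ ?_).mul ?_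
    · exact (analyticAt_hsRec (Or.inl (sub_self (θ i)))).fun_comp (f := fun z => z - θ i)
        (by fun_prop)
    · refine AnalyticAt.inv ?_ ?_
      · exact (analyticAt_hs _).fun_comp (f := fun z => z - θ i + Complex.I * eta N) (by fun_prop)
      · rw [sub_self, zero_add]
        exact hs_I_eta_ne_zero hN
    · refine Finset.analyticAt_fun_prod _ fun j hj => ?_
      refine AnalyticAt.fun_comp (f := fun z => z - θ j) (analyticAt_phi ?_ ?_) (by fun_prop)
      · exact hsep i j (Finset.ne_of_mem_erase hj).symm
      · exact (regular_of_mem_generic hgen i j).2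
  obtain ⟨r₀, hr₀, hball⟩ := Metric.eventually_nhds_iff_ball.mp hqa.eventually_analyticAt
  refine ⟨r₀, hr₀, fun r hr hrr g hg => ?_⟩
  have hd : DifferentiableOn ℂ (fun z => q z * g z) (Metric.closedBall (θ i) r) := fun z hz =>
    ((hball z (lt_of_le_of_lt hz hrr)).differentiableAt.mul (hg z)).differentiableWithinAt
  have hc := hd.circleIntegral_sub_inv_smul (Metric.mem_ball_self hr)
  have e : (∮ z in C(θ i, r), (∏ j, phi N (z - θ j)) * g z) =
      ∮ z in C(θ i, r), (z - θ i)⁻¹ • (q z * g z) := by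
    refine circleIntegral.integral_congr hr.le fun z hz => ?_
    have hne : z - θ i ≠ 0 := by
      intro h
      have : dist z (θ i) = r := hz
      rw [dist_eq_norm, h, norm_zero] at this
      linarith
    simp only [hq, smul_eq_mul]
    rw [← Finset.mul_prod_erase _ _ (Finset.mem_univ i), phi_eq, hsRec_of_ne hne, mul_inv]
    field_simp
  rw [e, hc, smul_eq_mul]
  simp only [hq, sub_self, hsRec_zero, zero_add, poleWeight]
  ring

lemma exists_contourIntegral_eq {N n : ℕ} (hN : 2 ≤ N) {θ : Fin n → ℂ} (hgen : θ ∈ generic N n)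
    (hsep : Separated θ) :
    ∃ r₀ > 0, ∀ r, 0 < r → r < r₀ → ∀ g : ℂ → ℂ, Differentiable ℂ g →
      contourIntegral N θ r (fun z => (∏ j, phi N (z - θ j)) * g z) =
        ∑ i, poleWeight N θ i * g (θ i) := by
  choose ρ hρ hcirc using exists_circleIntegral_eq hN hgen hsep
  have hgen0 : (fun _ : Fin 1 => (0 : ℂ)) ∈ generic N 1 := by
    rw [mem_generic_iff]
    intro i j
    rw [sub_self, zero_sub, hs_neg]
    exact neg_ne_zero.mpr (hs_I_eta_ne_zero hN)
  have hsep0 : Separated (fun _ : Fin 1 => (0 : ℂ)) := fun i j hij =>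
    absurd (Subsingleton.elim i j) hij
  obtain ⟨ρ', hρ', hcirc'⟩ := exists_circleIntegral_eq hN hgen0 hsep0 0
  obtain ⟨r₀, hr₀, hlt⟩ : ∃ r₀ > 0, (∀ i, r₀ ≤ ρ i) ∧ r₀ ≤ ρ' := by
    obtain ⟨r₁, h1, h2⟩ : ∃ r₁ > 0, ∀ i, r₁ ≤ ρ i := by
      rcases isEmpty_or_nonempty (Fin n) with hE | hE
      · exact ⟨1, one_pos, fun i => (hE.false i).elim⟩
      · obtain ⟨i₀, hi₀⟩ := Finite.exists_min ρ
        exact ⟨ρ i₀, hρ i₀, hi₀⟩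
    exact ⟨min r₁ ρ', lt_min h1 hρ', fun i => (min_le_left _ _).trans (h2 i), min_le_right _ _⟩
  refine ⟨r₀, hr₀, fun r hr hrr g hg => ?_⟩
  have hR : (∮ z in C(0, r), phi N z) =
      (2 * Real.pi * Complex.I) * (2 / hs (Complex.I * eta N)) := by
    have := hcirc' r hr (hrr.trans_le hlt.2) (fun _ => 1) (differentiable_const 1)
    simpa [poleWeight] using this
  have hR0 : (2 * Real.pi * Complex.I) * (2 / hs (Complex.I * eta N)) ≠ 0 := by
    refine mul_ne_zero Complex.two_pi_I_ne_zero (div_ne_zero two_ne_zero (hs_I_eta_ne_zero hN))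
  rw [contourIntegral, hR, Finset.sum_image (fun i _ j _ h => hsep.injective h),
    Finset.sum_congr rfl fun i _ => hcirc i r hr (hrr.trans_le (hlt.1 i)) g hg, ← Finset.mul_sum,
    mul_div_cancel_left₀ _ hR0]

lemma iterIntegral_eq_sum {n : ℕ} {J : (ℂ → ℂ) → ℂ} {Φ : ℂ → ℂ} {A : Fin n → ℂ} {θ : Fin n → ℂ}
    (hJ : ∀ g : ℂ → ℂ, Differentiable ℂ g → J (fun z => Φ z * g z) = ∑ i, A i * g (θ i))
    (m : ℕ) (g : (Fin m → ℂ) → ℂ) (hg : Differentiable ℂ g) :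
    iterIntegral J m (fun z => (∏ j, Φ (z j)) * g z) =
      ∑ α : Fin m → Fin n, (∏ j, A (α j)) * g (fun j => θ (α j)) := by
  induction m with
  | zero =>
    rw [iterIntegral, Fintype.sum_unique]
    simp only [Finset.univ_eq_empty, Finset.prod_empty, one_mul]
    congr 1
    exact Subsingleton.elim _ _
  | succ m ih =>
    have hcons : ∀ z : ℂ, Differentiable ℂ (fun z' : Fin m → ℂ => (Fin.cons z z' : Fin (m + 1) → ℂ)) := by
      intro z
      rw [differentiable_pi]
      intro j
      refine Fin.cases ?_ (fun j => ?_) j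
      · simp
      · simpa using differentiable_apply j
    have hcons' : ∀ z' : Fin m → ℂ, Differentiable ℂ (fun z : ℂ => (Fin.cons z z' : Fin (m + 1) → ℂ)) := by
      intro z'
      rw [differentiable_pi]
      intro j
      refine Fin.cases ?_ (fun j => ?_) j
      · simp
      · simp
    have h1 : ∀ z : ℂ, iterIntegral J m
        (fun z' => (∏ j, Φ ((Fin.cons z z' : Fin (m + 1) → ℂ) j)) * g (Fin.cons z z')) =
        Φ z * ∑ α : Fin m → Fin n, (∏ j, A (α j)) * g (Fin.cons z fun j => θ (α j)) := by
      intro z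
      have := ih (fun z' => Φ z * g (Fin.cons z z')) ((hg.comp (hcons z)).const_mul _)
      simp only [Fin.prod_univ_succ, Fin.cons_zero, Fin.cons_succ]
      rw [Finset.mul_sum]
      convert this using 2
      · ext z'
        ring
      · ring
    rw [iterIntegral]
    simp_rw [h1]
    rw [hJ (fun z => ∑ α : Fin m → Fin n, (∏ j, A (α j)) * g (Fin.cons z fun j => θ (α j)))
      (Differentiable.fun_sum fun α _ => (hg.comp (hcons' _)).const_mul _),
      ← (Fin.consEquiv fun _ => Fin n).sum_comp, Fintype.sum_prod_type]
    refine Finset.sum_congr rfl fun i _ => ?_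
    rw [Finset.mul_sum]
    refine Finset.sum_congr rfl fun α _ => ?_
    simp only [Fin.consEquiv, Equiv.coe_fn_mk, Fin.prod_univ_succ, Fin.cons_zero, Fin.cons_succ]
    rw [mul_assoc]
    congr 3
    ext j
    refine Fin.cases ?_ (fun j => ?_) j <;> simp

lemma iterIntegralFamily_eq_sum {n : ℕ} {J : (ℂ → ℂ) → ℂ} {Φ : ℂ → ℂ} {A : Fin n → ℂ}
    {θ : Fin n → ℂ}
    (hJ : ∀ g : ℂ → ℂ, Differentiable ℂ g → J (fun z => Φ z * g z) = ∑ i, A i * g (θ i))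
    (K : ℕ) (m : Fin K → ℕ) (g : ((k : Fin K) → Fin (m k) → ℂ) → ℂ) (hg : Differentiable ℂ g) :
    iterIntegralFamily J K m (fun z => (∏ k, ∏ j, Φ (z k j)) * g z) =
      ∑ α : (k : Fin K) → Fin (m k) → Fin n,
        (∏ k, ∏ j, A (α k j)) * g (fun k j => θ (α k j)) := by
  induction K with
  | zero =>
    rw [iterIntegralFamily, Fintype.sum_unique]
    simp only [Finset.univ_eq_empty, Finset.prod_empty, one_mul]
    congr 1
    exact Subsingleton.elim _ _
  | succ K ih =>
    have hcons : ∀ z₀ : Fin (m 0) → ℂ, Differentiable ℂ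
        (fun z : (k : Fin K) → Fin (m k.succ) → ℂ =>
          (Fin.cons z₀ z : (k : Fin (K + 1)) → Fin (m k) → ℂ)) := by
      intro z₀
      rw [differentiable_pi]
      intro k
      refine Fin.cases ?_ (fun k => ?_) k
      · simp
      · simpa using differentiable_apply k
    have hcons' : ∀ z : (k : Fin K) → Fin (m k.succ) → ℂ, Differentiable ℂ
        (fun z₀ : Fin (m 0) → ℂ => (Fin.cons z₀ z : (k : Fin (K + 1)) → Fin (m k) → ℂ)) := by
      intro z
      rw [differentiable_pi]
      intro k
      refine Fin.cases ?_ (fun k => ?_) k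
      · simp
      · simp
    have h1 : ∀ z₀ : Fin (m 0) → ℂ, iterIntegralFamily J K (fun k => m k.succ)
        (fun z => (∏ k, ∏ j, Φ ((Fin.cons z₀ z : (k : Fin (K + 1)) → Fin (m k) → ℂ) k j)) *
          g (Fin.cons z₀ z)) =
        (∏ j, Φ (z₀ j)) * ∑ α : (k : Fin K) → Fin (m k.succ) → Fin n,
          (∏ k, ∏ j, A (α k j)) * g (Fin.cons z₀ fun k j => θ (α k j)) := by
      intro z₀
      have := ih (fun k => m k.succ) (fun z => (∏ j, Φ (z₀ j)) * g (Fin.cons z₀ z))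
        ((hg.comp (hcons z₀)).const_mul _)
      simp only [Fin.prod_univ_succ, Fin.cons_zero, Fin.cons_succ]
      rw [Finset.mul_sum]
      convert this using 2
      · ext z
        ring
      · ring
    rw [iterIntegralFamily]
    simp_rw [h1]
    rw [iterIntegral_eq_sum hJ (m 0)
      (fun z₀ => ∑ α : (k : Fin K) → Fin (m k.succ) → Fin n,
        (∏ k, ∏ j, A (α k j)) * g (Fin.cons z₀ fun k j => θ (α k j)))
      (Differentiable.fun_sum fun α _ => (hg.comp (hcons' _)).const_mul _),
      ← (Fin.consEquiv fun k => Fin (m k) → Fin n).sum_comp, Fintype.sum_prod_type]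
    refine Finset.sum_congr rfl fun α₀ _ => ?_
    rw [Finset.mul_sum]
    refine Finset.sum_congr rfl fun α _ => ?_
    simp only [Fin.consEquiv, Equiv.coe_fn_mk, Fin.prod_univ_succ, Fin.cons_zero, Fin.cons_succ]
    rw [mul_assoc]
    congr 3
    funext k
    refine Fin.cases ?_ (fun k => ?_) k <;> simp

/-! ### Labelings of the particles -/

/-- The particles that carry the label `k + 1`. -/
def labelFiber {N n : ℕ} (f : Fin n → Fin N) (k : Fin (N - 1)) : Finset (Fin n) :=
  {a | (f a : ℕ) = k + 1}

lemma mem_labelFiber {N n : ℕ} {f : Fin n → Fin N} {k : Fin (N - 1)} {a : Fin n} :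
    a ∈ labelFiber f k ↔ (f a : ℕ) = k + 1 := by
  simp [labelFiber]

/-- The labelings of `n` particles by `0, …, N - 1` where the label `k + 1` occurs `m k` times. -/
def labelings (N n : ℕ) (m : Fin (N - 1) → ℕ) : Finset (Fin n → Fin N) :=
  {f | ∀ k, (labelFiber f k).card = m k}

lemma mem_labelings {N n : ℕ} {m : Fin (N - 1) → ℕ} {f : Fin n → Fin N} :
    f ∈ labelings N n m ↔ ∀ k, (labelFiber f k).card = m k := by
  simp [labelings]

/-- The assignment `α` of the integration variables to the particles induces the labeling `f`. -/
def Compatible {N n : ℕ} {m : Fin (N - 1) → ℕ} (α : (k : Fin (N - 1)) → Fin (m k) → Fin n)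
    (f : Fin n → Fin N) : Prop :=
  ∀ k, Finset.univ.image (α k) = labelFiber f k

instance {N n : ℕ} {m : Fin (N - 1) → ℕ} (α : (k : Fin (N - 1)) → Fin (m k) → Fin n)
    (f : Fin n → Fin N) : Decidable (Compatible α f) :=
  inferInstanceAs (Decidable (∀ k, Finset.univ.image (α k) = labelFiber f k))

lemma card_image_eq {m n : ℕ} {S : Finset (Fin n)} (hS : S.card = m) :
    (Finset.univ.filter fun β : Fin m → Fin n => Finset.univ.image β = S).card = m.factorial := by
  have e : Fin m ≃ S := (finCongr hS.symm).trans S.equivFin.symm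
  have h1 : (Finset.univ : Finset (Fin m ≃ S)).card = m.factorial := by
    rw [Finset.card_univ, Fintype.card_equiv e, Fintype.card_fin]
  rw [← h1, eq_comm]
  refine Finset.card_bij (fun e _ => fun j => (e j : Fin n)) ?_ ?_ ?_
  · intro e _
    simp only [Finset.mem_filter, Finset.mem_univ, true_and]
    ext a
    simp only [Finset.mem_image, Finset.mem_univ, true_and]
    constructor
    · rintro ⟨j, rfl⟩
      exact (e j).2
    · intro ha
      exact ⟨e.symm ⟨a, ha⟩, by simp⟩
  · intro e _ e' _ h
    ext j
    exact congrArg Fin.val (congrFun h j)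
  · intro β hβ
    simp only [Finset.mem_filter, Finset.mem_univ, true_and] at hβ
    have hmem : ∀ j, β j ∈ S := fun j => by
      rw [← hβ]
      exact Finset.mem_image_of_mem _ (Finset.mem_univ j)
    have hsurj : Function.Surjective (fun j => (⟨β j, hmem j⟩ : S)) := by
      rintro ⟨a, ha⟩
      rw [← hβ, Finset.mem_image] at ha
      obtain ⟨j, _, hj⟩ := ha
      exact ⟨j, Subtype.ext hj⟩
    have hbij := (Fintype.bijective_iff_surjective_and_card _).mpr
      ⟨hsurj, Fintype.card_congr e⟩
    exact ⟨Equiv.ofBijective _ hbij, Finset.mem_univ _, rfl⟩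

lemma card_compatible {N n : ℕ} {m : Fin (N - 1) → ℕ} {f : Fin n → Fin N}
    (hf : f ∈ labelings N n m) :
    (Finset.univ.filter fun α : (k : Fin (N - 1)) → Fin (m k) → Fin n => Compatible α f).card =
      ∏ k, (m k).factorial := by
  have : (Finset.univ.filter fun α : (k : Fin (N - 1)) → Fin (m k) → Fin n => Compatible α f) =
      Fintype.piFinset fun k => Finset.univ.filter fun β : Fin (m k) → Fin n =>
        Finset.univ.image β = labelFiber f k := by
    ext α
    rw [Finset.mem_filter, Fintype.mem_piFinset]
    simp only [Finset.mem_univ, true_and, Finset.mem_filter]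
    rfl
  rw [this, Fintype.card_piFinset]
  exact Finset.prod_congr rfl fun k _ => card_image_eq (mem_labelings.mp hf k)

lemma Compatible.injective {N n : ℕ} {m : Fin (N - 1) → ℕ}
    {α : (k : Fin (N - 1)) → Fin (m k) → Fin n} {f : Fin n → Fin N} (h : Compatible α f)
    (hf : f ∈ labelings N n m) (k : Fin (N - 1)) : Function.Injective (α k) := by
  have h1 : (Finset.univ.image (α k)).card = (Finset.univ : Finset (Fin (m k))).card := by
    rw [h k, mem_labelings.mp hf k, Finset.card_univ, Fintype.card_fin]
  intro i j hij
  exact Finset.card_image_iff.mp h1 (Finset.mem_coe.mpr (Finset.mem_univ i))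
    (Finset.mem_coe.mpr (Finset.mem_univ j)) hij

lemma Compatible.label {N n : ℕ} {m : Fin (N - 1) → ℕ}
    {α : (k : Fin (N - 1)) → Fin (m k) → Fin n} {f : Fin n → Fin N} (h : Compatible α f)
    (k : Fin (N - 1)) (j : Fin (m k)) : (f (α k j) : ℕ) = k + 1 := by
  rw [← mem_labelFiber, ← h k]
  exact Finset.mem_image_of_mem _ (Finset.mem_univ j)

lemma Compatible.unique {N n : ℕ} {m : Fin (N - 1) → ℕ}
    {α : (k : Fin (N - 1)) → Fin (m k) → Fin n} {f f' : Fin n → Fin N} (h : Compatible α f)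
    (h' : Compatible α f') : f = f' := by
  have key : ∀ (a : Fin n) (k : Fin (N - 1)), (f a : ℕ) = k + 1 ↔ (f' a : ℕ) = k + 1 :=
      fun a k => by
    rw [← mem_labelFiber, ← mem_labelFiber, ← h k, h' k]
  ext a
  rcases Nat.eq_zero_or_pos (f a : ℕ) with h0 | h0
  · rcases Nat.eq_zero_or_pos (f' a : ℕ) with h0' | h0'
    · rw [h0, h0']
    · have := (key a ⟨f' a - 1, by omega⟩).mpr (by simp; omega)
      simp at this
      omega
  · have := (key a ⟨f a - 1, by omega⟩).mp (by simp; omega)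
    simp at this
    omega

lemma Compatible.eq_of_eq {N n : ℕ} {m : Fin (N - 1) → ℕ}
    {α : (k : Fin (N - 1)) → Fin (m k) → Fin n} {f : Fin n → Fin N} (h : Compatible α f)
    (hf : f ∈ labelings N n m) {x y : Σ k, Fin (m k)} (hxy : α x.1 x.2 = α y.1 y.2) : x = y := by
  obtain ⟨k, i⟩ := x
  obtain ⟨l, j⟩ := y
  have h1 := h.label k i
  have h2 := h.label l j
  simp only at hxy
  rw [hxy, h2] at h1
  obtain rfl : k = l := by
    ext
    omega
  rw [h.injective hf k hxy]

lemma exists_compatible {N n : ℕ} (hN : 2 ≤ N) {m : Fin (N - 1) → ℕ}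
    {α : (k : Fin (N - 1)) → Fin (m k) → Fin n}
    (hα : Function.Injective fun x : Σ k, Fin (m k) => α x.1 x.2) :
    ∃ f ∈ labelings N n m, Compatible α f := by
  classical
  set f : Fin n → Fin N := fun a =>
    if h : ∃ x : Σ k, Fin (m k), α x.1 x.2 = a then ⟨h.choose.1 + 1, by omega⟩
    else ⟨0, by omega⟩ with hfdef
  have hval : ∀ k j, (f (α k j) : ℕ) = k + 1 := by
    intro k j
    have h : ∃ x : Σ k, Fin (m k), α x.1 x.2 = α k j := ⟨⟨k, j⟩, rfl⟩
    have h2 : h.choose = ⟨k, j⟩ := hα h.choose_spec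
    simp only [hfdef, dif_pos h]
    rw [h2]
  have hcomp : Compatible α f := by
    intro k
    ext a
    rw [mem_labelFiber, Finset.mem_image]
    constructor
    · rintro ⟨j, _, rfl⟩
      exact hval k j
    · intro ha
      by_cases h : ∃ x : Σ k, Fin (m k), α x.1 x.2 = a
      · obtain ⟨⟨l, j⟩, rfl⟩ := h
        have ha' : (l : ℕ) + 1 = k + 1 := (hval l j).symm.trans ha
        obtain rfl : l = k := by
          ext
          omega
        exact ⟨j, Finset.mem_univ _, rfl⟩
      · simp only [hfdef, dif_neg h] at ha
        omega
  refine ⟨f, mem_labelings.mpr fun k => ?_, hcomp⟩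
  rw [← hcomp k, Finset.card_image_of_injective, Finset.card_univ, Fintype.card_fin]
  intro i j hij
  have := @hα ⟨k, i⟩ ⟨k, j⟩ hij
  simpa using this

/-! ### The building block as a sum over labelings -/

/-- The weight of a labeling. -/
def labelWeight (N : ℕ) {n : ℕ} (θ : Fin n → ℂ) (f : Fin n → Fin N) : ℂ :=
  ∏ a, ∏ b ∈ Finset.univ.erase a, if f b < f a then phi N (θ a - θ b) else 1

@[to_additive]
lemma prod_labelFiber {M : Type*} [CommMonoid M] {N n : ℕ} (f : Fin n → Fin N)
    (T : Finset (Fin (N - 1))) (X : Fin n → M) :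
    ∏ k ∈ T, ∏ a ∈ labelFiber f k, X a =
      ∏ a, if ∃ k ∈ T, (f a : ℕ) = k + 1 then X a else 1 := by
  classical
  rw [← Finset.prod_biUnion, ← Finset.prod_filter]
  · congr 1
    ext a
    simp [mem_labelFiber]
  · intro k _ l _ hkl
    rw [Function.onFun, Finset.disjoint_left]
    intro a ha hb
    rw [mem_labelFiber] at ha hb
    apply hkl
    ext
    omega

lemma exists_label_iff {N : ℕ} (i : Fin N) :
    (∃ k ∈ (Finset.univ : Finset (Fin (N - 1))), (i : ℕ) = k + 1) ↔ 0 < (i : ℕ) := by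
  constructor
  · rintro ⟨k, _, hk⟩
    omega
  · intro h
    exact ⟨⟨i - 1, by omega⟩, Finset.mem_univ _, by simp; omega⟩

lemma exists_label_Ioi_iff {N : ℕ} (i : Fin N) (l : Fin (N - 1)) :
    (∃ k ∈ Finset.Ioi l, (i : ℕ) = k + 1) ↔ (l : ℕ) + 1 < (i : ℕ) := by
  constructor
  · rintro ⟨k, hl, hk⟩
    rw [Finset.mem_Ioi, Fin.lt_def] at hl
    omega
  · intro h
    refine ⟨⟨i - 1, by omega⟩, ?_, by simp; omega⟩
    rw [Finset.mem_Ioi, Fin.lt_def]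
    simp
    omega

lemma prod_Ioi_mul_swap {m : ℕ} (X : Fin m → Fin m → ℂ) :
    ∏ i, ∏ j ∈ Finset.Ioi i, (X i j * X j i) = ∏ i, ∏ j ∈ Finset.univ.erase i, X i j := by
  have h : ∀ i : Fin m, ∏ j ∈ Finset.univ.erase i, X i j =
      (∏ j ∈ Finset.Ioi i, X i j) * ∏ j ∈ Finset.Iio i, X i j := by
    intro i
    rw [← Finset.prod_union]
    · congr 1
      ext j
      simp only [Finset.mem_erase, Finset.mem_univ, and_true, Finset.mem_union, Finset.mem_Ioi,
        Finset.mem_Iio]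
      exact ⟨fun h => (lt_or_gt_of_ne h).symm, fun h => h.elim ne_of_gt ne_of_lt⟩
    · rw [Finset.disjoint_left]
      intro j h1 h2
      rw [Finset.mem_Ioi] at h1
      rw [Finset.mem_Iio] at h2
      exact lt_asymm h1 h2
  simp_rw [h, Finset.prod_mul_distrib]
  congr 1
  exact Finset.prod_comm' (by simp)

lemma kappa_zero (N : ℕ) : kappa N 0 = 0 := by simp [kappa_eq, hs_zero]

lemma tau_zero (N : ℕ) : tau N 0 = 0 := by simp [tau, kappa_zero]

/-- The entire factor of the integrand. -/
def entireFactor (N : ℕ) (m : Fin (N - 1) → ℕ) (z : (k : Fin (N - 1)) → Fin (m k) → ℂ) : ℂ :=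
  (∏ k, ∏ i, ∏ j ∈ Finset.Ioi i, tau N (z k i - z k j)) *
    ∏ k, ∏ l ∈ Finset.Ioi k, ∏ i, ∏ j, kappa N (z k i - z l j)

lemma hFunction_eq (N n : ℕ) (m : Fin (N - 1) → ℕ) (θ : Fin n → ℂ)
    (z : (k : Fin (N - 1)) → Fin (m k) → ℂ) :
    hFunction N n m θ z = (∏ k, ∏ j, ∏ i, phi N (z k j - θ i)) * entireFactor N m z := by
  rw [hFunction, entireFactor, Finset.prod_mul_distrib, mul_assoc]

lemma differentiable_kappa (N : ℕ) : Differentiable ℂ (kappa N) := by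
  unfold kappa
  fun_prop

lemma differentiable_finsetProd {E ι : Type*} [NormedAddCommGroup E] [NormedSpace ℂ E]
    {s : Finset ι} {f : ι → E → ℂ} (h : ∀ i ∈ s, Differentiable ℂ (f i)) :
    Differentiable ℂ fun x => ∏ i ∈ s, f i x := by
  classical
  induction s using Finset.induction_on with
  | empty => simp
  | insert a s ha ih =>
    simp_rw [Finset.prod_insert ha]
    exact (h a (Finset.mem_insert_self a s)).mul
      (ih fun i hi => h i (Finset.mem_insert_of_mem hi))

lemma differentiable_entireFactor (N : ℕ) (m : Fin (N - 1) → ℕ) :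
    Differentiable ℂ (entireFactor N m) := by
  have hz : ∀ k (i : Fin (m k)) l (j : Fin (m l)), Differentiable ℂ
      (fun z : (k : Fin (N - 1)) → Fin (m k) → ℂ => z k i - z l j) := fun k i l j => by fun_prop
  unfold entireFactor
  refine Differentiable.mul ?_ ?_
  · refine differentiable_finsetProd fun k _ => ?_
    refine differentiable_finsetProd fun i _ => ?_
    refine differentiable_finsetProd fun j _ => ?_
    exact ((differentiable_kappa N).comp (hz k i k j)).mul
      ((differentiable_kappa N).comp (hz k i k j).neg)
  · refine differentiable_finsetProd fun k _ => ?_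
    refine differentiable_finsetProd fun l _ => ?_
    refine differentiable_finsetProd fun i _ => ?_
    refine differentiable_finsetProd fun j _ => ?_
    exact (differentiable_kappa N).comp (hz k i l j)

lemma entireFactor_eq_zero {N n : ℕ} {m : Fin (N - 1) → ℕ} (θ : Fin n → ℂ)
    {α : (k : Fin (N - 1)) → Fin (m k) → Fin n}
    (hα : ¬ Function.Injective fun x : Σ k, Fin (m k) => α x.1 x.2) :
    entireFactor N m (fun k j => θ (α k j)) = 0 := by
  rw [Function.Injective] at hα
  push Not at hα
  obtain ⟨⟨k, i⟩, ⟨l, j⟩, hij, hne⟩ := hα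
  simp only at hij
  rcases eq_or_ne k l with rfl | hkl
  · have hij' : i ≠ j := fun h => hne (by rw [h])
    rw [entireFactor]
    apply mul_eq_zero_of_left
    refine Finset.prod_eq_zero (Finset.mem_univ k) ?_
    rcases lt_or_gt_of_ne hij' with h | h
    · refine Finset.prod_eq_zero (Finset.mem_univ i) (Finset.prod_eq_zero (Finset.mem_Ioi.mpr h) ?_)
      rw [hij, sub_self, tau_zero]
    · refine Finset.prod_eq_zero (Finset.mem_univ j) (Finset.prod_eq_zero (Finset.mem_Ioi.mpr h) ?_)
      rw [hij, sub_self, tau_zero]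
  · rw [entireFactor]
    apply mul_eq_zero_of_right
    rcases lt_or_gt_of_ne hkl with h | h
    · refine Finset.prod_eq_zero (Finset.mem_univ k) (Finset.prod_eq_zero (Finset.mem_Ioi.mpr h)
        (Finset.prod_eq_zero (Finset.mem_univ i) (Finset.prod_eq_zero (Finset.mem_univ j) ?_)))
      rw [hij, sub_self, kappa_zero]
    · refine Finset.prod_eq_zero (Finset.mem_univ l) (Finset.prod_eq_zero (Finset.mem_Ioi.mpr h)
        (Finset.prod_eq_zero (Finset.mem_univ j) (Finset.prod_eq_zero (Finset.mem_univ i) ?_)))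
      rw [hij, sub_self, kappa_zero]

lemma kappa_mul_phi {N n : ℕ} {θ : Fin n → ℂ} (hgen : θ ∈ generic N n) (hsep : Separated θ)
    {a b : Fin n} (hab : a ≠ b) : kappa N (θ a - θ b) * phi N (θ a - θ b) = 1 := by
  rw [phi_eq_inv_kappa, mul_inv_cancel₀]
  rw [kappa_eq]
  exact mul_ne_zero (hsep a b hab) (regular_of_mem_generic hgen a b).2

lemma weight_of_compatible {N n : ℕ} {m : Fin (N - 1) → ℕ} {θ : Fin n → ℂ}
    (hgen : θ ∈ generic N n) (hsep : Separated θ) {α : (k : Fin (N - 1)) → Fin (m k) → Fin n}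
    {f : Fin n → Fin N} (hf : f ∈ labelings N n m) (hα : Compatible α f) :
    (∏ k, ∏ j, poleWeight N θ (α k j)) * entireFactor N m (fun k j => θ (α k j)) =
      labelWeight N θ f := by
  have hinj := fun k => hα.injective hf k
  have himg : ∀ k (X : Fin n → ℂ), ∏ j, X (α k j) = ∏ a ∈ labelFiber f k, X a := by
    intro k X
    rw [← hα k, Finset.prod_image fun i _ j _ h => hinj k h]
  have h1 : ∏ k, ∏ j, poleWeight N θ (α k j) =
      ∏ k, ∏ a ∈ labelFiber f k, poleWeight N θ a :=
    Finset.prod_congr rfl fun k _ => himg k _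
  have h2 : ∏ k, ∏ i, ∏ j ∈ Finset.Ioi i, tau N (θ (α k i) - θ (α k j)) =
      ∏ k, ∏ a ∈ labelFiber f k, ∏ b ∈ Finset.univ.erase a,
        if f b = f a then kappa N (θ a - θ b) else 1 := by
    refine Finset.prod_congr rfl fun k _ => ?_
    have e : ∀ i j, tau N (θ (α k i) - θ (α k j)) =
        kappa N (θ (α k i) - θ (α k j)) * kappa N (θ (α k j) - θ (α k i)) := by
      intro i j
      rw [tau, neg_sub]
    simp_rw [e]
    rw [prod_Ioi_mul_swap fun i j => kappa N (θ (α k i) - θ (α k j)), ← himg k]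
    refine Finset.prod_congr rfl fun i _ => ?_
    rw [← Finset.prod_filter]
    have : ((Finset.univ.erase (α k i)).filter fun b => f b = f (α k i)) =
        (Finset.univ.erase i).image (α k) := by
      ext b
      simp only [Finset.mem_filter, Finset.mem_erase, Finset.mem_univ, and_true,
        Finset.mem_image]
      constructor
      · rintro ⟨hb1, hb2⟩
        have hb : b ∈ labelFiber f k := by
          rw [mem_labelFiber, hb2]
          exact hα.label k i
        rw [← hα k, Finset.mem_image] at hb
        obtain ⟨j, _, rfl⟩ := hb
        exact ⟨j, fun h => hb1 (by rw [h]), rfl⟩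
      · rintro ⟨j, hj, rfl⟩
        refine ⟨fun h => hj (hinj k h), ?_⟩
        ext
        rw [hα.label, hα.label]
    rw [this, Finset.prod_image fun i _ j _ h => hinj k h]
  have h3 : ∏ k, ∏ l ∈ Finset.Ioi k, ∏ i, ∏ j, kappa N (θ (α k i) - θ (α l j)) =
      ∏ k, ∏ a ∈ labelFiber f k, ∏ b ∈ Finset.univ.erase a,
        if f a < f b then kappa N (θ a - θ b) else 1 := by
    refine Finset.prod_congr rfl fun k _ => ?_
    rw [Finset.prod_comm, ← himg k]
    refine Finset.prod_congr rfl fun i _ => ?_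
    rw [Finset.prod_congr rfl fun l _ => himg l fun b => kappa N (θ (α k i) - θ b),
      prod_labelFiber]
    rw [← Finset.mul_prod_erase _ _ (Finset.mem_univ (α k i)), if_neg, one_mul]
    · refine Finset.prod_congr rfl fun b _ => ?_
      refine if_congr ?_ rfl rfl
      rw [exists_label_Ioi_iff, Fin.lt_def, hα.label k i]
    · rw [exists_label_Ioi_iff, hα.label k i]
      omega
  rw [entireFactor, h1, h2, h3, ← Finset.prod_mul_distrib, ← Finset.prod_mul_distrib]
  simp_rw [← Finset.prod_mul_distrib]
  rw [prod_labelFiber, labelWeight]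
  refine Finset.prod_congr rfl fun a _ => ?_
  simp only [exists_label_iff]
  split_ifs with ha
  · rw [poleWeight, ← Finset.prod_mul_distrib]
    refine Finset.prod_congr rfl fun b hb => ?_
    have hk := kappa_mul_phi hgen hsep (Finset.ne_of_mem_erase hb).symm
    rcases lt_trichotomy (f a) (f b) with h | h | h
    · rw [if_neg h.ne', if_pos h, if_neg h.not_gt]
      linear_combination hk
    · rw [if_pos h.symm, if_neg h.not_lt, if_neg h.not_gt]
      linear_combination hk
    · rw [if_neg h.ne, if_neg h.not_gt, if_pos h]
      ring
  · refine (Finset.prod_eq_one fun b _ => if_neg ?_).symm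
    rw [Fin.lt_def]
    omega

lemma buildingBlock_eq {N n : ℕ} (hN : 2 ≤ N) {m : Fin (N - 1) → ℕ} {θ : Fin n → ℂ}
    (hgen : θ ∈ generic N n) (hsep : Separated θ)
    {p : (Fin n → ℂ) → ((k : Fin (N - 1)) → Fin (m k) → ℂ) → ℂ} (hp : Differentiable ℂ (p θ))
    (P : (Fin n → Fin N) → ℂ)
    (hP : ∀ f ∈ labelings N n m, ∀ α, Compatible α f → p θ (fun k j => θ (α k j)) = P f) :
    buildingBlock N n m θ p = ∑ f ∈ labelings N n m, P f * labelWeight N θ f := by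
  obtain ⟨r₀, hr₀, hJ⟩ := exists_contourIntegral_eq hN hgen hsep
  have hval : ∀ r, 0 < r → r < r₀ → iterIntegralFamily (contourIntegral N θ r) (N - 1) m
      (fun z => hFunction N n m θ z * p θ z) =
      (∏ k, ((m k).factorial : ℂ)) * ∑ f ∈ labelings N n m, P f * labelWeight N θ f := by
    intro r hr hrr
    have h1 := iterIntegralFamily_eq_sum (hJ r hr hrr) (N - 1) m
      (fun z => entireFactor N m z * p θ z) ((differentiable_entireFactor N m).mul hp)
    simp_rw [hFunction_eq, mul_assoc]
    rw [h1]
    have h2 : ∀ α : (k : Fin (N - 1)) → Fin (m k) → Fin n,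
        (∏ k, ∏ j, poleWeight N θ (α k j)) *
          (entireFactor N m (fun k j => θ (α k j)) * p θ (fun k j => θ (α k j))) =
        ∑ f ∈ labelings N n m, if Compatible α f then P f * labelWeight N θ f else 0 := by
      intro α
      by_cases hα : Function.Injective fun x : Σ k, Fin (m k) => α x.1 x.2
      · obtain ⟨f, hf, hc⟩ := exists_compatible hN hα
        rw [Finset.sum_eq_single_of_mem f hf fun f' _ hne => if_neg fun hc' => hne (hc'.unique hc),
          if_pos hc, ← mul_assoc, weight_of_compatible hgen hsep hf hc, hP f hf α hc, mul_comm]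
      · rw [entireFactor_eq_zero θ hα, zero_mul, mul_zero, eq_comm]
        refine Finset.sum_eq_zero fun f hf => if_neg fun hc => hα fun x y hxy => ?_
        exact hc.eq_of_eq hf hxy
    simp_rw [h2]
    rw [Finset.sum_comm, Finset.mul_sum]
    refine Finset.sum_congr rfl fun f hf => ?_
    rw [← Finset.sum_filter, Finset.sum_const, card_compatible hf, nsmul_eq_mul, Nat.cast_prod]
  have hlim : limUnder (𝓝[>] (0 : ℝ)) (fun r => iterIntegralFamily (contourIntegral N θ r) (N - 1) m
      (fun z => hFunction N n m θ z * p θ z)) =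
      (∏ k, ((m k).factorial : ℂ)) * ∑ f ∈ labelings N n m, P f * labelWeight N θ f := by
    refine Tendsto.limUnder_eq (tendsto_const_nhds.congr' ?_)
    filter_upwards [Ioo_mem_nhdsGT hr₀] with r hr
    exact (hval r hr.1 hr.2).symm
  rw [buildingBlock, hlim, ← mul_assoc, ← Finset.prod_mul_distrib]
  have : ∏ k, (1 / ((m k).factorial : ℂ) * ((m k).factorial : ℂ)) = 1 :=
    Finset.prod_eq_one fun k _ => one_div_mul_cancel (by exact_mod_cast (m k).factorial_ne_zero)
  rw [this, one_mul]

/-! ### The state sum -/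

/-- The factor of a pair of particles with labels `a` and `b`. -/
def pairFactor (N : ℕ) (a b : Fin N) (z : ℂ) : ℂ :=
  if a < b then (hs (z - Complex.I * eta N))⁻¹
  else if b < a then (hs (z + Complex.I * eta N))⁻¹ else hs z

lemma pairFactor_of_lt {N : ℕ} {a b : Fin N} (h : a < b) (z : ℂ) :
    pairFactor N a b z = (hs (z - Complex.I * eta N))⁻¹ := if_pos h

lemma pairFactor_of_gt {N : ℕ} {a b : Fin N} (h : b < a) (z : ℂ) :
    pairFactor N a b z = (hs (z + Complex.I * eta N))⁻¹ := by
  rw [pairFactor, if_neg h.not_gt, if_pos h]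

lemma pairFactor_self {N : ℕ} (a : Fin N) (z : ℂ) : pairFactor N a a z = hs z := by
  simp [pairFactor]

lemma pairFactor_swap {N : ℕ} (a b : Fin N) (z : ℂ) :
    pairFactor N b a (-z) = -pairFactor N a b z := by
  rcases lt_trichotomy a b with h | rfl | h
  · rw [pairFactor_of_gt h, pairFactor_of_lt h,
      show -z + Complex.I * eta N = -(z - Complex.I * eta N) by ring, hs_neg, inv_neg]
  · rw [pairFactor_self, pairFactor_self, hs_neg]
  · rw [pairFactor_of_lt h, pairFactor_of_gt h,
      show -z - Complex.I * eta N = -(z + Complex.I * eta N) by ring, hs_neg, inv_neg]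

lemma pairFactor_add_two_pi {N : ℕ} (a b : Fin N) (z : ℂ) :
    pairFactor N a b (z + 2 * Real.pi * Complex.I) = -pairFactor N a b z := by
  rcases lt_trichotomy a b with h | rfl | h
  · rw [pairFactor_of_lt h, pairFactor_of_lt h, add_sub_right_comm, hs_add_two_pi, inv_neg]
  · rw [pairFactor_self, pairFactor_self, hs_add_two_pi]
  · rw [pairFactor_of_gt h, pairFactor_of_gt h, add_right_comm, hs_add_two_pi, inv_neg]

lemma pairFactor_sub_two_pi {N : ℕ} (a b : Fin N) (z : ℂ) :
    pairFactor N a b (z - 2 * Real.pi * Complex.I) = -pairFactor N a b z := by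
  have := pairFactor_add_two_pi a b (z - 2 * Real.pi * Complex.I)
  rw [sub_add_cancel] at this
  rw [this, neg_neg]

lemma analyticAt_hs_add (c z : ℂ) : AnalyticAt ℂ (fun z => hs (z + c)) z :=
  (analyticAt_hs _).fun_comp (f := fun z => z + c) (by fun_prop)

lemma analyticAt_pairFactor {N : ℕ} (a b : Fin N) {z : ℂ} (h : Regular N z) :
    AnalyticAt ℂ (pairFactor N a b) z := by
  rcases lt_trichotomy a b with hab | rfl | hab
  · rw [show pairFactor N a b = _ from funext (pairFactor_of_lt hab)]
    exact (analyticAt_hs_add (-(Complex.I * eta N)) z).inv h.1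
  · rw [show pairFactor N a a = _ from funext (pairFactor_self a)]
    exact analyticAt_hs z
  · rw [show pairFactor N a b = _ from funext (pairFactor_of_gt hab)]
    exact (analyticAt_hs_add _ z).inv h.2

lemma meromorphicAt_pairFactor {N : ℕ} (a b : Fin N) (z : ℂ) :
    MeromorphicAt (pairFactor N a b) z := by
  rcases lt_trichotomy a b with hab | rfl | hab
  · rw [show pairFactor N a b = _ from funext (pairFactor_of_lt hab)]
    exact (analyticAt_hs_add (-(Complex.I * eta N)) z).meromorphicAt.inv
  · rw [show pairFactor N a a = _ from funext (pairFactor_self a)]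
    exact (analyticAt_hs z).meromorphicAt
  · rw [show pairFactor N a b = _ from funext (pairFactor_of_gt hab)]
    exact (analyticAt_hs_add _ z).meromorphicAt.inv

/-- The value of the p-function for the integration variables given by the labeling `f`. -/
def labelValue (N Qt n : ℕ) (θ : Fin n → ℂ) (f : Fin n → Fin N) : ℂ :=
  rho N Qt n * Complex.exp ((∑ a, if 0 < (f a : ℕ) ∧ (f a : ℕ) ≤ Qt then θ a else 0) -
    (Qt : ℂ) / N * ∑ a, θ a)

/-- The building block multiplied by `∏ sinh (θ_{ij} / 2)`. -/
def stateSum (N Qt n : ℕ) (m : Fin (N - 1) → ℕ) (θ : Fin n → ℂ) : ℂ :=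
  ∑ f ∈ labelings N n m,
    labelValue N Qt n θ f * ∏ i, ∏ j ∈ Finset.Ioi i, pairFactor N (f i) (f j) (θ i - θ j)

lemma exists_label_lt_iff {N : ℕ} (i : Fin N) (Qt : ℕ) :
    (∃ k ∈ Finset.univ.filter fun k : Fin (N - 1) => (k : ℕ) < Qt, (i : ℕ) = k + 1) ↔
      0 < (i : ℕ) ∧ (i : ℕ) ≤ Qt := by
  constructor
  · rintro ⟨k, hk, h⟩
    have := (Finset.mem_filter.mp hk).2
    omega
  · rintro ⟨h1, h2⟩
    exact ⟨⟨i - 1, by omega⟩, by simp; omega, by simp; omega⟩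

lemma pFunction_of_compatible {N n : ℕ} (Qt : ℕ) {m : Fin (N - 1) → ℕ} (θ : Fin n → ℂ)
    {f : Fin n → Fin N} (hf : f ∈ labelings N n m) {α : (k : Fin (N - 1)) → Fin (m k) → Fin n}
    (hα : Compatible α f) :
    pFunction N Qt n m θ (fun k j => θ (α k j)) = labelValue N Qt n θ f := by
  rw [pFunction, labelValue, ← Finset.sum_filter]
  congr 3
  have := sum_labelFiber f (Finset.univ.filter fun k : Fin (N - 1) => (k : ℕ) < Qt) θ
  simp only [exists_label_lt_iff] at this
  rw [← this]
  refine Finset.sum_congr rfl fun k _ => ?_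
  rw [← hα k, Finset.sum_image fun i _ j _ h => hα.injective hf k h]

lemma labelWeight_mul_prod {N n : ℕ} {θ : Fin n → ℂ} (hsep : Separated θ) (f : Fin n → Fin N) :
    labelWeight N θ f * ∏ i, ∏ j ∈ Finset.Ioi i, hs (θ i - θ j) =
      ∏ i, ∏ j ∈ Finset.Ioi i, pairFactor N (f i) (f j) (θ i - θ j) := by
  rw [labelWeight,
    ← prod_Ioi_mul_swap fun a b => if f b < f a then phi N (θ a - θ b) else 1]
  simp_rw [← Finset.prod_mul_distrib]
  refine Finset.prod_congr rfl fun i _ => Finset.prod_congr rfl fun j hj => ?_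
  have hne := hsep i j (Finset.mem_Ioi.mp hj).ne
  rcases lt_trichotomy (f i) (f j) with h | h | h
  · rw [if_neg h.not_gt, if_pos h, pairFactor_of_lt h, ← neg_sub (θ i) (θ j), phi_neg, mul_inv]
    field_simp
  · rw [if_neg h.not_gt, if_neg h.not_lt, h, pairFactor_self]
    ring
  · rw [if_pos h, if_neg h.not_gt, pairFactor_of_gt h, phi_eq, mul_inv]
    field_simp

lemma differentiable_pFunction (N Qt n : ℕ) (m : Fin (N - 1) → ℕ) (θ : Fin n → ℂ) :
    Differentiable ℂ (pFunction N Qt n m θ) := by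
  unfold pFunction
  refine (Differentiable.cexp ?_).const_mul _
  refine Differentiable.sub_const ?_ _
  refine Differentiable.fun_sum fun k _ => ?_
  split_ifs <;> fun_prop

lemma buildingBlock_mul_prod {N n : ℕ} (hN : 2 ≤ N) (Qt : ℕ) {m : Fin (N - 1) → ℕ}
    {θ : Fin n → ℂ} (hgen : θ ∈ generic N n) (hsep : Separated θ) :
    buildingBlock N n m θ (pFunction N Qt n m) * ∏ i, ∏ j ∈ Finset.Ioi i, hs (θ i - θ j) =
      stateSum N Qt n m θ := by
  rw [buildingBlock_eq hN hgen hsep (differentiable_pFunction N Qt n m θ) (labelValue N Qt n θ)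
    fun f hf α hα => pFunction_of_compatible Qt θ hf hα, stateSum, Finset.sum_mul]
  refine Finset.sum_congr rfl fun f _ => ?_
  rw [mul_assoc, labelWeight_mul_prod hsep]

/-! ### Symmetries of the state sum -/

lemma comp_perm_mem_labelings {N n : ℕ} {m : Fin (N - 1) → ℕ} {f : Fin n → Fin N}
    (π : Equiv.Perm (Fin n)) : f ∘ π ∈ labelings N n m ↔ f ∈ labelings N n m := by
  rw [mem_labelings, mem_labelings]
  refine forall_congr' fun k => ?_
  have : (labelFiber (f ∘ π) k).card = (labelFiber f k).card := by
    refine Finset.card_bij (fun a _ => π a) ?_ ?_ ?_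
    · intro a ha
      rw [mem_labelFiber] at ha ⊢
      exact ha
    · intro a _ b _ h
      exact π.injective h
    · intro b hb
      refine ⟨π.symm b, ?_, by simp⟩
      rw [mem_labelFiber] at hb ⊢
      simpa using hb
  rw [this]

lemma stateSum_perm (N Qt n : ℕ) (m : Fin (N - 1) → ℕ) (θ : Fin n → ℂ)
    (π : Equiv.Perm (Fin n)) :
    stateSum N Qt n m (θ ∘ π) = (Equiv.Perm.sign π : ℤ) * stateSum N Qt n m θ := by
  rw [stateSum, stateSum, Finset.mul_sum]
  refine (Finset.sum_bij (fun f _ => f ∘ π) ?_ ?_ ?_ ?_).symm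
  · intro f hf
    exact (comp_perm_mem_labelings π).mpr hf
  · intro f _ f' _ h
    exact (Function.Surjective.injective_comp_right π.surjective) h
  · intro f hf
    refine ⟨f ∘ π.symm, ?_, ?_⟩
    · exact (comp_perm_mem_labelings π.symm).mpr hf
    · ext a
      simp
  · intro f _
    have h1 : labelValue N Qt n (θ ∘ π) (f ∘ π) = labelValue N Qt n θ f := by
      rw [labelValue, labelValue]
      simp only [Function.comp_apply]
      rw [Equiv.sum_comp π θ, Equiv.sum_comp π
        fun a => if 0 < (f a : ℕ) ∧ (f a : ℕ) ≤ Qt then θ a else 0]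
    have h2 := Equiv.Perm.prod_Ioi_comp_eq_sign_mul_prod π
      (f := fun i j => pairFactor N (f i) (f j) (θ i - θ j)) fun i j => by
        rw [← pairFactor_swap, neg_sub]
    rw [h1]
    simp only [Function.comp_apply]
    rw [h2]
    ring

lemma stateSum_eq_zero_of_eq {N Qt n : ℕ} {m : Fin (N - 1) → ℕ} {θ : Fin n → ℂ} {i j : Fin n}
    (hij : i ≠ j) (h : θ i = θ j) : stateSum N Qt n m θ = 0 := by
  have h1 := stateSum_perm N Qt n m θ (Equiv.swap i j)
  have h2 : θ ∘ Equiv.swap i j = θ := by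
    ext a
    rw [Function.comp_apply, Equiv.swap_apply_def]
    split_ifs with h3 h4
    · rw [h3, h]
    · rw [h4, h]
    · rfl
  rw [h2, Equiv.Perm.sign_swap hij] at h1
  push_cast at h1
  linear_combination h1 / 2

lemma stateSum_shift (N Qt n : ℕ) (m : Fin (N - 1) → ℕ) (θ : Fin n → ℂ) (i : Fin n) :
    stateSum N Qt n m (fun a => θ a + if a = i then 2 * Real.pi * Complex.I else 0) =
      (∏ a : Fin n, ∏ b ∈ Finset.Ioi a, if a = i ∨ b = i then (-1 : ℂ) else 1) *
        Complex.exp (-((Qt : ℂ) / N * (2 * Real.pi * Complex.I))) * stateSum N Qt n m θ := by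
  rw [stateSum, stateSum, Finset.mul_sum]
  refine Finset.sum_congr rfl fun f _ => ?_
  have h1 : labelValue N Qt n (fun a => θ a + if a = i then 2 * Real.pi * Complex.I else 0) f =
      Complex.exp (-((Qt : ℂ) / N * (2 * Real.pi * Complex.I))) * labelValue N Qt n θ f := by
    rw [labelValue, labelValue, mul_left_comm, ← Complex.exp_add]
    have e1 : ∑ a, (θ a + if a = i then 2 * Real.pi * Complex.I else 0) =
        ∑ a, θ a + 2 * Real.pi * Complex.I := by
      rw [Finset.sum_add_distrib]
      simp
    have e2 : ∑ a, (if 0 < (f a : ℕ) ∧ (f a : ℕ) ≤ Qt then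
          (θ a + if a = i then 2 * Real.pi * Complex.I else 0) else 0) =
        (∑ a, if 0 < (f a : ℕ) ∧ (f a : ℕ) ≤ Qt then θ a else 0) +
          if 0 < (f i : ℕ) ∧ (f i : ℕ) ≤ Qt then 2 * Real.pi * Complex.I else 0 := by
      rw [show (if 0 < (f i : ℕ) ∧ (f i : ℕ) ≤ Qt then 2 * Real.pi * Complex.I else 0) =
        ∑ a, if a = i then
          (if 0 < (f a : ℕ) ∧ (f a : ℕ) ≤ Qt then 2 * Real.pi * Complex.I else 0) else 0 by simp,
        ← Finset.sum_add_distrib]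
      refine Finset.sum_congr rfl fun a _ => ?_
      split_ifs <;> simp
    rw [e1, e2]
    congr 1
    split_ifs
    · rw [show ∀ A B : ℂ,
        A + 2 * Real.pi * Complex.I - (Qt : ℂ) / N * (B + 2 * Real.pi * Complex.I) =
        -((Qt : ℂ) / N * (2 * Real.pi * Complex.I)) + (A - (Qt : ℂ) / N * B) +
          2 * Real.pi * Complex.I from fun A B => by ring,
        Complex.exp_add _ (2 * Real.pi * Complex.I),
        Complex.exp_two_pi_mul_I, mul_one]
    · congr 1
      ring
  rw [h1]
  have h2 : ∏ a, ∏ b ∈ Finset.Ioi a, pairFactor N (f a) (f b)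
      (θ a + (if a = i then 2 * Real.pi * Complex.I else 0) -
        (θ b + if b = i then 2 * Real.pi * Complex.I else 0)) =
      (∏ a : Fin n, ∏ b ∈ Finset.Ioi a, if a = i ∨ b = i then (-1 : ℂ) else 1) *
        ∏ a, ∏ b ∈ Finset.Ioi a, pairFactor N (f a) (f b) (θ a - θ b) := by
    rw [← Finset.prod_mul_distrib]
    refine Finset.prod_congr rfl fun a _ => ?_
    rw [← Finset.prod_mul_distrib]
    refine Finset.prod_congr rfl fun b hb => ?_
    have hab := (Finset.mem_Ioi.mp hb).ne
    by_cases ha : a = i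
    · have hbi : b ≠ i := fun h => hab (ha.trans h.symm)
      rw [if_pos ha, if_neg hbi, if_pos (Or.inl ha), add_zero, add_sub_right_comm,
        pairFactor_add_two_pi]
      ring
    · by_cases hbi : b = i
      · rw [if_neg ha, if_pos hbi, if_pos (Or.inr hbi), add_zero, ← sub_sub,
          pairFactor_sub_two_pi]
        ring
      · rw [if_neg ha, if_neg hbi, if_neg (by tauto), add_zero, add_zero, one_mul]
  rw [h2]
  ring

lemma stateSum_shift_eq_zero_iff (N Qt n : ℕ) (m : Fin (N - 1) → ℕ) (θ : Fin n → ℂ) (i : Fin n) :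
    stateSum N Qt n m (fun a => θ a + if a = i then 2 * Real.pi * Complex.I else 0) = 0 ↔
      stateSum N Qt n m θ = 0 := by
  rw [stateSum_shift, mul_eq_zero, or_iff_right]
  refine mul_ne_zero (Finset.prod_ne_zero_iff.mpr fun a _ => Finset.prod_ne_zero_iff.mpr
    fun b _ => ?_) (Complex.exp_ne_zero _)
  split_ifs <;> simp

lemma stateSum_shift_int_eq_zero_iff (N Qt n : ℕ) (m : Fin (N - 1) → ℕ) (θ : Fin n → ℂ)
    (i : Fin n) (k : ℤ) :
    stateSum N Qt n m (fun a => θ a + if a = i then 2 * Real.pi * Complex.I * k else 0) = 0 ↔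
      stateSum N Qt n m θ = 0 := by
  have key : ∀ l : ℤ, (fun a => θ a + if a = i then 2 * Real.pi * Complex.I * (l + 1 : ℤ) else 0) =
      fun a => (θ a + if a = i then 2 * Real.pi * Complex.I * l else 0) +
        if a = i then 2 * Real.pi * Complex.I else 0 := by
    intro l
    ext a
    split_ifs
    · push_cast
      ring
    · ring
  induction k using Int.induction_on with
  | zero => simp
  | succ l ih =>
    rw [key, stateSum_shift_eq_zero_iff]
    exact ih
  | pred l ih =>
    have h := stateSum_shift_eq_zero_iff N Qt n m
      (fun a => θ a + if a = i then 2 * Real.pi * Complex.I * (-(l : ℤ) - 1 : ℤ) else 0) i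
    rw [← key, sub_add_cancel] at h
    exact h.symm.trans ih

lemma stateSum_eq_zero {N Qt n : ℕ} {m : Fin (N - 1) → ℕ} {θ : Fin n → ℂ} {i j : Fin n}
    (hij : i ≠ j) (h : hs (θ i - θ j) = 0) : stateSum N Qt n m θ = 0 := by
  obtain ⟨k, hk⟩ := hs_eq_zero_iff.mp h
  rw [← stateSum_shift_int_eq_zero_iff N Qt n m θ i (-k)]
  apply stateSum_eq_zero_of_eq hij
  rw [if_pos rfl, if_neg hij.symm]
  push_cast
  linear_combination hk

/-! ### The form factors as a state sum -/

lemma formFactor_eq {N : ℕ} (hN : 2 ≤ N) {E F : ℂ → ℂ} (hE : IsRegularPart N E F) (Q Qt : ℕ)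
    (c : ℕ → ℂ) {n : ℕ} (hn : n % N = Q) {θ : Fin n → ℂ} (hgen : θ ∈ generic N n) :
    formFactor N F Q Qt c n θ = c n * stateSum N Qt n (multiplicity N Q n) θ *
      ∏ i, ∏ j ∈ Finset.Ioi i, E (θ i - θ j) := by
  have hF : ∏ i, ∏ j ∈ Finset.Ioi i, F (θ i - θ j) =
      (∏ i, ∏ j ∈ Finset.Ioi i, hs (θ i - θ j)) * ∏ i, ∏ j ∈ Finset.Ioi i, E (θ i - θ j) := by
    simp_rw [← Finset.prod_mul_distrib]
    refine Finset.prod_congr rfl fun i _ => Finset.prod_congr rfl fun j _ => ?_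
    exact hE.eq_regular _ (regular_of_mem_generic hgen i j)
  rw [formFactor, if_pos hn, hF]
  by_cases hsep : Separated θ
  · rw [← buildingBlock_mul_prod hN Qt hgen hsep]
    ring
  · rw [Separated] at hsep
    push Not at hsep
    obtain ⟨i, j, hij, h⟩ := hsep
    rw [stateSum_eq_zero hij h]
    have : ∏ i, ∏ j ∈ Finset.Ioi i, hs (θ i - θ j) = 0 := by
      rcases lt_or_gt_of_ne hij with hlt | hlt
      · exact Finset.prod_eq_zero (Finset.mem_univ i)
          (Finset.prod_eq_zero (Finset.mem_Ioi.mpr hlt) h)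
      · refine Finset.prod_eq_zero (Finset.mem_univ j)
          (Finset.prod_eq_zero (Finset.mem_Ioi.mpr hlt) ?_)
        rw [hs_sub_comm, h, neg_zero]
    rw [this]
    ring

/-! ### Analyticity and meromorphy of the form factors -/

lemma formFactor_of_ne {N : ℕ} {F : ℂ → ℂ} {Q Qt : ℕ} {c : ℕ → ℂ} {n : ℕ} (hn : n % N ≠ Q) :
    formFactor N F Q Qt c n = 0 := by
  ext θ
  rw [formFactor, if_neg hn, Pi.zero_apply]

lemma formFactor_eq_sum {N : ℕ} (hN : 2 ≤ N) {E F : ℂ → ℂ} (hE : IsRegularPart N E F) (Q Qt : ℕ)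
    (c : ℕ → ℂ) {n : ℕ} (hn : n % N = Q) {θ : Fin n → ℂ} (hgen : θ ∈ generic N n) :
    formFactor N F Q Qt c n θ = c n * ∑ f ∈ labelings N n (multiplicity N Q n),
      labelValue N Qt n θ f * ∏ i, ∏ j ∈ Finset.Ioi i,
        (pairFactor N (f i) (f j) (θ i - θ j) * E (θ i - θ j)) := by
  rw [formFactor_eq hN hE Q Qt c hn hgen, stateSum, mul_assoc, Finset.sum_mul]
  congr 1
  refine Finset.sum_congr rfl fun f _ => ?_
  simp_rw [Finset.prod_mul_distrib]
  ring

lemma isOpen_generic (N n : ℕ) : IsOpen (generic N n) := by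
  have : generic N n = ⋂ i, ⋂ j, {θ | hs (θ i - θ j - Complex.I * eta N) ≠ 0} := by
    ext θ
    simp only [Set.mem_iInter, Set.mem_ofPred_eq]
    exact mem_generic_iff
  rw [this]
  refine isOpen_iInter_of_finite fun i => isOpen_iInter_of_finite fun j => ?_
  refine isOpen_ne_fun ?_ continuous_const
  exact continuous_hs.comp (by fun_prop)

lemma analyticAt_labelValue {N Qt n : ℕ} (f : Fin n → Fin N) (θ : Fin n → ℂ) :
    AnalyticAt ℂ (fun θ => labelValue N Qt n θ f) θ := by
  unfold labelValue
  refine analyticAt_const.mul (AnalyticAt.cexp ?_)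
  refine AnalyticAt.sub (Finset.analyticAt_fun_sum _ fun a _ => ?_)
    (analyticAt_const.mul (Finset.analyticAt_fun_sum _ fun a _ => ?_))
  · split_ifs
    · exact (ContinuousLinearMap.proj (R := ℂ) (φ := fun _ : Fin n => ℂ) a).analyticAt θ
    · exact analyticAt_const
  · exact (ContinuousLinearMap.proj (R := ℂ) (φ := fun _ : Fin n => ℂ) a).analyticAt θ

lemma analyticAt_apply_sub {n : ℕ} (i j : Fin n) (θ : Fin n → ℂ) :
    AnalyticAt ℂ (fun θ : Fin n → ℂ => θ i - θ j) θ :=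
  (ContinuousLinearMap.proj (R := ℂ) (φ := fun _ : Fin n => ℂ) i -
    ContinuousLinearMap.proj (R := ℂ) (φ := fun _ : Fin n => ℂ) j).analyticAt θ

lemma analyticOnNhd_formFactor {N : ℕ} (hN : 2 ≤ N) {E F : ℂ → ℂ} (hE : IsRegularPart N E F)
    (Q Qt : ℕ) (c : ℕ → ℂ) (n : ℕ) :
    AnalyticOnNhd ℂ (formFactor N F Q Qt c n) (generic N n) := by
  intro θ hθ
  by_cases hn : n % N = Q
  · refine AnalyticAt.congr (f := fun θ => c n * ∑ f ∈ labelings N n (multiplicity N Q n),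
      labelValue N Qt n θ f * ∏ i, ∏ j ∈ Finset.Ioi i,
        (pairFactor N (f i) (f j) (θ i - θ j) * E (θ i - θ j))) ?_ ?_
    · refine analyticAt_const.mul (Finset.analyticAt_fun_sum _ fun f _ =>
        (analyticAt_labelValue f θ).mul (Finset.analyticAt_fun_prod _ fun i _ =>
          Finset.analyticAt_fun_prod _ fun j _ => ?_))
      have hreg := regular_of_mem_generic hθ i j
      exact ((analyticAt_pairFactor (f i) (f j) hreg).mul (hE.analyticAt _ hreg)).fun_comp
        (f := fun θ : Fin n → ℂ => θ i - θ j) (analyticAt_apply_sub i j θ)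
    · filter_upwards [(isOpen_generic N n).mem_nhds hθ] with y hy
      exact (formFactor_eq_sum hN hE Q Qt c hn hy).symm
  · rw [formFactor_of_ne hn]
    exact analyticAt_const

lemma eventually_hs_sub_ne_zero (w c : ℂ) : ∀ᶠ z in 𝓝[≠] w, hs (z - c) ≠ 0 := by
  by_cases h : hs (w - c) = 0
  · have hd : HasDerivAt (fun z => hs (z - c)) (Complex.cosh ((w - c) / 2) * (1 / 2)) w := by
      unfold hs
      exact (((hasDerivAt_id w).sub_const c).div_const 2).csinh
    refine hd.eventually_ne (mul_ne_zero ?_ (by norm_num))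
    intro h0
    have := Complex.cosh_sq ((w - c) / 2)
    rw [h0, show Complex.sinh ((w - c) / 2) = 0 from h] at this
    norm_num at this
  · have : ContinuousAt (fun z => hs (z - c)) w := (continuous_hs.comp (by fun_prop)).continuousAt
    exact (this.eventually_ne h).filter_mono nhdsWithin_le_nhds

lemma eventually_regular (N : ℕ) (w : ℂ) : ∀ᶠ z in 𝓝[≠] w, Regular N z := by
  filter_upwards [eventually_hs_sub_ne_zero w (Complex.I * eta N),
    eventually_hs_sub_ne_zero w (-(Complex.I * eta N))] with z h1 h2
  exact ⟨h1, by rwa [sub_neg_eq_add] at h2⟩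

lemma mem_generic_of_lt {N n : ℕ} (hN : 2 ≤ N) {θ : Fin n → ℂ}
    (h : ∀ i j, i < j → Regular N (θ i - θ j)) : θ ∈ generic N n := by
  rw [mem_generic_iff]
  intro i j
  rcases lt_trichotomy i j with hij | rfl | hij
  · exact (h i j hij).1
  · rw [sub_self, zero_sub, hs_neg, neg_ne_zero]
    exact hs_I_eta_ne_zero hN
  · have := (h j i hij).neg.1
    rwa [neg_sub] at this

lemma exists_pow_mul_analyticAt {ι : Type*} [Finite ι] {u : ι → ℂ → ℂ} {w : ι → ℂ}
    (h : ∀ i, MeromorphicAt (u i) (w i)) :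
    ∃ K : ℕ, ∀ i, AnalyticAt ℂ (fun z => (z - w i) ^ K * u i z) (w i) := by
  have := Fintype.ofFinite ι
  choose k hk using h
  refine ⟨∑ i, k i, fun i => ?_⟩
  have hle : k i ≤ ∑ i, k i := Finset.single_le_sum (fun _ _ => Nat.zero_le _) (Finset.mem_univ i)
  have : (fun z => (z - w i) ^ (∑ i, k i) * u i z) =
      fun z => (z - w i) ^ (∑ i, k i - k i) * ((z - w i) ^ k i • u i z) := by
    ext z
    rw [smul_eq_mul, ← mul_assoc, ← pow_add, Nat.sub_add_cancel hle]
  rw [this]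
  refine AnalyticAt.mul ?_ (hk i)
  fun_prop

lemma isMeromorphicAt_formFactor {N : ℕ} (hN : 2 ≤ N) {E F : ℂ → ℂ} (hE : IsRegularPart N E F)
    (Q Qt : ℕ) (c : ℕ → ℂ) (n : ℕ) (x : Fin n → ℂ) :
    IsMeromorphicAt (formFactor N F Q Qt c n) x := by
  by_cases hn : n % N = Q
  swap
  · rw [formFactor_of_ne hn]
    refine ⟨0, 1, analyticAt_const, analyticAt_const, ?_, ?_⟩
    · intro h
      simpa using h.self_of_nhds
    · exact Eventually.of_forall fun y _ => by simp
  obtain ⟨K, hK⟩ := exists_pow_mul_analyticAt (ι := (Fin N × Fin N) × Fin n × Fin n)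
    (u := fun q z => pairFactor N q.1.1 q.1.2 z * E z) (w := fun q => x q.2.1 - x q.2.2)
    fun q => (meromorphicAt_pairFactor _ _ _).mul (hE.meromorphicAt _)
  refine ⟨fun y => c n * ∑ f ∈ labelings N n (multiplicity N Q n), labelValue N Qt n y f *
      ∏ i, ∏ j ∈ Finset.Ioi i, ((y i - y j - (x i - x j)) ^ K *
        (pairFactor N (f i) (f j) (y i - y j) * E (y i - y j))) *
          (y i - y j - (x i - x j)),
    fun y => ∏ i, ∏ j ∈ Finset.Ioi i, (y i - y j - (x i - x j)) ^ (K + 1), ?_, ?_, ?_, ?_⟩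
  · refine analyticAt_const.mul (Finset.analyticAt_fun_sum _ fun f _ =>
      (analyticAt_labelValue f x).mul (Finset.analyticAt_fun_prod _ fun i _ =>
        Finset.analyticAt_fun_prod _ fun j _ => AnalyticAt.mul ?_ ?_))
    · exact (hK ((f i, f j), (i, j))).fun_comp (f := fun θ : Fin n → ℂ => θ i - θ j)
        (analyticAt_apply_sub i j x)
    · exact (analyticAt_apply_sub i j x).sub analyticAt_const
  · exact Finset.analyticAt_fun_prod _ fun i _ => Finset.analyticAt_fun_prod _ fun j _ =>
      ((analyticAt_apply_sub i j x).sub analyticAt_const).pow _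
  · intro h
    have hp : Tendsto (fun t : ℂ => fun i => x i + t * ((i : ℕ) : ℂ)) (𝓝[≠] 0) (𝓝 x) := by
      have : Continuous fun t : ℂ => fun i => x i + t * ((i : ℕ) : ℂ) := by fun_prop
      have h0 := this.tendsto 0
      simp only [zero_mul, add_zero] at h0
      exact h0.mono_left nhdsWithin_le_nhds
    obtain ⟨t, ht, ht0⟩ := ((hp.eventually h).and self_mem_nhdsWithin).exists
    revert ht
    refine Finset.prod_ne_zero_iff.mpr fun i _ => Finset.prod_ne_zero_iff.mpr fun j hj =>
      pow_ne_zero _ ?_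
    rw [show x i + t * ((i : ℕ) : ℂ) - (x j + t * ((j : ℕ) : ℂ)) - (x i - x j) =
      t * (((i : ℕ) : ℂ) - ((j : ℕ) : ℂ)) by ring]
    refine mul_ne_zero ht0 (sub_ne_zero.mpr ?_)
    have := (Finset.mem_Ioi.mp hj).ne
    rw [Ne, Nat.cast_inj, Fin.val_inj]
    exact this
  · have hreg : ∀ᶠ y in 𝓝 x, ∀ i j : Fin n, y i - y j ≠ x i - x j → Regular N (y i - y j) := by
      rw [eventually_all]
      intro i
      rw [eventually_all]
      intro j
      have h1 := eventually_nhdsWithin_iff.mp (eventually_regular N (x i - x j))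
      exact (analyticAt_apply_sub i j x).continuousAt.eventually h1
    filter_upwards [hreg] with y hy hne
    have hne' : ∀ i j : Fin n, i < j → y i - y j - (x i - x j) ≠ 0 := by
      intro i j hij h0
      apply hne
      refine Finset.prod_eq_zero (Finset.mem_univ i) (Finset.prod_eq_zero
        (Finset.mem_Ioi.mpr hij) ?_)
      rw [h0, zero_pow (Nat.succ_ne_zero K)]
    have hgen : y ∈ generic N n :=
      mem_generic_of_lt hN fun i j hij => hy i j (sub_ne_zero.mp (hne' i j hij))
    rw [eq_div_iff hne, formFactor_eq_sum hN hE Q Qt c hn hgen, mul_assoc, Finset.sum_mul]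
    congr 1
    refine Finset.sum_congr rfl fun f _ => ?_
    rw [mul_assoc]
    congr 1
    simp_rw [← Finset.prod_mul_distrib]
    refine Finset.prod_congr rfl fun i _ => Finset.prod_congr rfl fun j _ => ?_
    ring

/-! ### Watson's equations -/

lemma prod_Ioi_eq_prod_filter {n : ℕ} (G : Fin n → Fin n → ℂ) :
    ∏ a, ∏ b ∈ Finset.Ioi a, G a b =
      ∏ p ∈ Finset.univ.filter (fun p : Fin n × Fin n => p.1 < p.2), G p.1 p.2 := by
  rw [Finset.prod_filter, Fintype.prod_prod_type]
  refine Finset.prod_congr rfl fun a _ => ?_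
  rw [← Finset.prod_filter]
  refine Finset.prod_congr ?_ fun _ _ => rfl
  ext b
  simp

lemma prod_Ioi_swap {n : ℕ} (g : Fin n → Fin n → ℂ) (i : Fin n) (hi : (i : ℕ) + 1 < n) :
    (∏ a, ∏ b ∈ Finset.Ioi a, g (Equiv.swap i ⟨i + 1, hi⟩ a) (Equiv.swap i ⟨i + 1, hi⟩ b)) *
        g i ⟨i + 1, hi⟩ =
      (∏ a, ∏ b ∈ Finset.Ioi a, g a b) * g ⟨i + 1, hi⟩ i := by
  set i' : Fin n := ⟨i + 1, hi⟩ with hi'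
  set s := Equiv.swap i i' with hs'
  have hlt : i < i' := by
    rw [Fin.lt_def, hi']
    simp
  have hmem : (i, i') ∈ Finset.univ.filter (fun p : Fin n × Fin n => p.1 < p.2) := by
    simp [hlt]
  have hval : ∀ a : Fin n, ((s a : Fin n) : ℕ) =
      if (a : ℕ) = i then (i : ℕ) + 1 else if (a : ℕ) = i + 1 then (i : ℕ) else a := by
    intro a
    rw [hs', Equiv.swap_apply_def]
    simp only [Fin.ext_iff, hi']
    split_ifs <;> rfl
  have hsub : ∀ p : Fin n × Fin n,
      p ∈ (Finset.univ.filter (fun p : Fin n × Fin n => p.1 < p.2)).erase (i, i') →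
      (s p.1, s p.2) ∈ (Finset.univ.filter (fun p : Fin n × Fin n => p.1 < p.2)).erase (i, i') := by
    rintro ⟨a, b⟩ hp
    simp only [Finset.mem_erase, Finset.mem_filter, Finset.mem_univ, true_and, ne_eq,
      Prod.mk.injEq, Fin.lt_def, Fin.ext_iff, hval, hi'] at hp ⊢
    split_ifs <;> omega
  rw [prod_Ioi_eq_prod_filter fun a b => g (s a) (s b), prod_Ioi_eq_prod_filter g,
    ← Finset.mul_prod_erase _ _ hmem,
    ← Finset.mul_prod_erase _ _ hmem]
  have hbij : ∏ p ∈ (Finset.univ.filter (fun p : Fin n × Fin n => p.1 < p.2)).erase (i, i'),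
      g (s p.1) (s p.2) =
      ∏ p ∈ (Finset.univ.filter (fun p : Fin n × Fin n => p.1 < p.2)).erase (i, i'), g p.1 p.2 :=
    Finset.prod_nbij' (fun p => (s p.1, s p.2)) (fun p => (s p.1, s p.2)) hsub hsub
      (fun p _ => by simp [hs']) (fun p _ => by simp [hs']) fun p _ => rfl
  rw [hbij]
  have h1 : s i = i' := Equiv.swap_apply_left _ _
  have h2 : s i' = i := Equiv.swap_apply_right _ _
  simp only [h1, h2]
  ring

lemma comp_mem_generic {N n m : ℕ} {θ : Fin n → ℂ} (h : θ ∈ generic N n) (σ : Fin m → Fin n) :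
    θ ∘ σ ∈ generic N m := fun i j k => h (σ i) (σ j) k

lemma formFactor_watson {N : ℕ} (hN : 2 ≤ N) {E F : ℂ → ℂ} (hE : IsRegularPart N E F)
    (Q Qt : ℕ) (c : ℕ → ℂ) (n : ℕ) (i : Fin n) (hi : (i : ℕ) + 1 < n) {θ : Fin n → ℂ}
    (hθ : θ ∈ generic N n) :
    formFactor N F Q Qt c n θ = formFactor N F Q Qt c n (θ ∘ Equiv.swap i ⟨i + 1, hi⟩) *
      smatrix N (θ i - θ ⟨i + 1, hi⟩) := by
  by_cases hn : n % N = Q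
  swap
  · simp [formFactor_of_ne hn]
  have hne : i ≠ ⟨i + 1, hi⟩ := by simp [Fin.ext_iff]
  have hreg := regular_of_mem_generic hθ i ⟨i + 1, hi⟩
  rw [formFactor_eq hN hE Q Qt c hn hθ, formFactor_eq hN hE Q Qt c hn (comp_mem_generic hθ _),
    stateSum_perm, Equiv.Perm.sign_swap hne]
  have h1 := prod_Ioi_swap (fun a b => E (θ a - θ b)) i hi
  have h2 := hE.watson _ hreg
  have h3 := hE.ne_zero _ hreg
  rw [neg_sub] at h2
  simp only [Function.comp_apply]
  push_cast
  apply mul_right_cancel₀ h3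
  set P := ∏ a, ∏ b ∈ Finset.Ioi a, E (θ a - θ b)
  linear_combination c n * stateSum N Qt n (multiplicity N Q n) θ * P * h2 +
    c n * stateSum N Qt n (multiplicity N Q n) θ * smatrix N (θ i - θ ⟨i + 1, hi⟩) * h1

/-! ### Crossing -/

lemma prod_Ioi_univ_succ {n : ℕ} (g : Fin (n + 1) → Fin (n + 1) → ℂ) :
    ∏ a, ∏ b ∈ Finset.Ioi a, g a b =
      (∏ b : Fin n, g 0 b.succ) * ∏ a : Fin n, ∏ b ∈ Finset.Ioi a, g a.succ b.succ := by
  rw [Fin.prod_univ_succ, Fin.prod_Ioi_zero]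
  simp_rw [Fin.prod_Ioi_succ]

lemma prod_Ioi_eq_ite {n : ℕ} (g : Fin n → ℂ) (a : Fin n) :
    ∏ b ∈ Finset.Ioi a, g b = ∏ b, if a < b then g b else 1 := by
  rw [← Finset.prod_filter]
  refine Finset.prod_congr ?_ fun _ _ => rfl
  ext b
  simp

lemma prod_Ioi_univ_castSucc {n : ℕ} (g : Fin (n + 1) → Fin (n + 1) → ℂ) :
    ∏ a, ∏ b ∈ Finset.Ioi a, g a b =
      (∏ a : Fin n, ∏ b ∈ Finset.Ioi a, g a.castSucc b.castSucc) *
        ∏ a : Fin n, g a.castSucc (Fin.last n) := by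
  simp_rw [prod_Ioi_eq_ite]
  rw [Fin.prod_univ_castSucc]
  simp only [Fin.prod_univ_castSucc, Fin.castSucc_lt_last, if_true, Fin.castSucc_lt_castSucc_iff,
    if_false, Finset.prod_mul_distrib, Fin.not_lt.mpr (Fin.le_last _),
    Finset.prod_const_one, mul_one]

lemma prod_Ioi_eq_zero_or {n : ℕ} :
    (∏ a : Fin (n + 1), ∏ b ∈ Finset.Ioi a, if a = 0 ∨ b = 0 then (-1 : ℂ) else 1) = (-1) ^ n := by
  rw [prod_Ioi_univ_succ]
  simp [Fin.succ_ne_zero]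

lemma exp_mul_statistics {N : ℕ} (Qt : ℕ) :
    Complex.exp (-((Qt : ℂ) / N * (2 * Real.pi * Complex.I))) * statistics N Qt = 1 := by
  rw [statistics, omega, eta, ← Complex.exp_nat_mul, ← Complex.exp_add, Complex.exp_eq_one_iff]
  exact ⟨0, by push_cast; ring⟩

lemma formFactor_crossing {N : ℕ} (hN : 2 ≤ N) {E F : ℂ → ℂ} (hE : IsRegularPart N E F)
    (Q Qt : ℕ) (c : ℕ → ℂ) (n : ℕ) (x : ℂ) (θ : Fin n → ℂ)
    (hgen : (Fin.cons (x + Complex.I * Real.pi) θ : Fin (n + 1) → ℂ) ∈ generic N (n + 1)) :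
    statistics N Qt * formFactor N F Q Qt c (n + 1) (Fin.cons (x + Complex.I * Real.pi) θ) =
      formFactor N F Q Qt c (n + 1) (Fin.snoc θ (x - Complex.I * Real.pi)) := by
  by_cases hn : (n + 1) % N = Q
  swap
  · simp [formFactor_of_ne hn]
  have hy : x + Complex.I * Real.pi = x - Complex.I * Real.pi + 2 * Real.pi * Complex.I := by ring
  rw [hy] at hgen ⊢
  generalize x - Complex.I * Real.pi = y at hgen ⊢
  have hreg : ∀ b, Regular N (y - θ b) := by
    intro b
    have := (regular_of_mem_generic hgen 0 b.succ).sub_two_pi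
    rw [Fin.cons_zero, Fin.cons_succ] at this
    convert this using 1
    ring
  have hθ : ∀ a b, Regular N (θ a - θ b) := by
    intro a b
    have := regular_of_mem_generic hgen a.succ b.succ
    rwa [Fin.cons_succ, Fin.cons_succ] at this
  have hgen' : (Fin.snoc θ y : Fin (n + 1) → ℂ) ∈ generic N (n + 1) := by
    refine mem_generic_of_lt hN fun i j hij => ?_
    obtain ⟨i, rfl⟩ := Fin.exists_castSucc_eq.mpr (ne_of_lt (lt_of_lt_of_le hij (Fin.le_last j)))
    rw [Fin.snoc_castSucc]
    induction j using Fin.lastCases with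
    | last =>
      have := (hreg i).neg
      rwa [neg_sub, ← Fin.snoc_last (α := fun _ => ℂ) y θ] at this
    | cast j =>
      rw [Fin.snoc_castSucc]
      exact hθ i j
  have hV1 : stateSum N Qt (n + 1) (multiplicity N Q (n + 1))
      (Fin.cons (y + 2 * Real.pi * Complex.I) θ) =
      (-1) ^ n * Complex.exp (-((Qt : ℂ) / N * (2 * Real.pi * Complex.I))) *
        stateSum N Qt (n + 1) (multiplicity N Q (n + 1)) (Fin.cons y θ) := by
    rw [← prod_Ioi_eq_zero_or, ← stateSum_shift]
    congr 1
    ext a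
    refine Fin.cases ?_ (fun a => ?_) a
    · simp
    · simp [Fin.succ_ne_zero]
  have hV2 : stateSum N Qt (n + 1) (multiplicity N Q (n + 1)) (Fin.snoc θ y) =
      (-1) ^ n * stateSum N Qt (n + 1) (multiplicity N Q (n + 1)) (Fin.cons y θ) := by
    rw [Fin.snoc_eq_cons_rotate]
    have := stateSum_perm N Qt (n + 1) (multiplicity N Q (n + 1)) (Fin.cons y θ) (finRotate (n + 1))
    rw [sign_finRotate] at this
    push_cast at this
    exact this
  rw [formFactor_eq hN hE Q Qt c hn hgen, formFactor_eq hN hE Q Qt c hn hgen', hV1, hV2,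
    prod_Ioi_univ_succ, prod_Ioi_univ_castSucc]
  simp only [Fin.cons_zero, Fin.cons_succ, Fin.snoc_castSucc, Fin.snoc_last]
  have hE' : ∀ b, E (y + 2 * Real.pi * Complex.I - θ b) = E (θ b - y) := by
    intro b
    rw [add_sub_right_comm, hE.crossing _ (hreg b), neg_sub]
  simp_rw [hE']
  linear_combination (c (n + 1) * (-1) ^ n *
    stateSum N Qt (n + 1) (multiplicity N Q (n + 1)) (Fin.cons y θ) * (∏ b, E (θ b - y)) *
    ∏ a, ∏ b ∈ Finset.Ioi a, E (θ a - θ b)) * exp_mul_statistics (N := N) Qt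

/-! ### Lorentz covariance -/

lemma sum_range_multiplicity (A Q Qt M : ℕ) :
    (∑ k ∈ Finset.range M, if k < Qt then A + (if k < Q then 1 else 0) else 0) =
      min M Qt * A + min (min M Qt) Q := by
  induction M with
  | zero => simp
  | succ M ih =>
    rw [Finset.sum_range_succ, ih]
    by_cases h1 : M < Qt
    · rw [if_pos h1, show min (M + 1) Qt = M + 1 by omega, show min M Qt = M by omega, add_mul]
      split_ifs <;> omega
    · rw [if_neg h1, show min (M + 1) Qt = Qt by omega, show min M Qt = Qt by omega, add_zero]

lemma sum_multiplicity {N Q Qt : ℕ} (hQt : Qt < N) (n : ℕ) :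
    (∑ k : Fin (N - 1), if (k : ℕ) < Qt then multiplicity N Q n k else 0) =
      Qt * (n / N) + min Q Qt := by
  have := Fin.sum_univ_eq_sum_range
    (fun k => if k < Qt then n / N + (if k < Q then 1 else 0) else 0) (N - 1)
  rw [sum_range_multiplicity, show min (N - 1) Qt = Qt by omega, min_comm Qt Q] at this
  exact this

lemma spin_eq {N Q n : ℕ} (hN : 2 ≤ N) (hn : n % N = Q) (Qt : ℕ) :
    ((Qt * (n / N) + min Q Qt : ℕ) : ℂ) - (Qt : ℂ) / N * n = spin N Q Qt := by
  have hN0 : (N : ℂ) ≠ 0 := by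
    rw [Nat.cast_ne_zero]
    omega
  have hn' : (n : ℂ) = N * (n / N : ℕ) + Q := by
    rw [← hn]
    exact_mod_cast (Nat.div_add_mod n N).symm
  rw [spin, hn']
  push_cast
  field_simp
  ring

lemma card_label_le {N Q Qt n : ℕ} (hQt : Qt < N) {f : Fin n → Fin N}
    (hf : f ∈ labelings N n (multiplicity N Q n)) :
    (∑ a, if 0 < (f a : ℕ) ∧ (f a : ℕ) ≤ Qt then (1 : ℂ) else 0) =
      ((Qt * (n / N) + min Q Qt : ℕ) : ℂ) := by
  have := sum_labelFiber f (Finset.univ.filter fun k : Fin (N - 1) => (k : ℕ) < Qt) fun _ => (1 : ℂ)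
  simp only [exists_label_lt_iff] at this
  rw [← this, ← sum_multiplicity hQt, Finset.sum_filter]
  push_cast
  refine Finset.sum_congr rfl fun k _ => ?_
  rw [Finset.sum_const, nsmul_eq_mul, mul_one, mem_labelings.mp hf k]

lemma labelValue_add {N Q Qt n : ℕ} (hN : 2 ≤ N) (hQt : Qt < N) (hn : n % N = Q)
    {f : Fin n → Fin N} (hf : f ∈ labelings N n (multiplicity N Q n)) (θ : Fin n → ℂ) (μ : ℂ) :
    labelValue N Qt n (fun a => θ a + μ) f =
      Complex.exp (spin N Q Qt * μ) * labelValue N Qt n θ f := by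
  rw [labelValue, labelValue, mul_left_comm, ← Complex.exp_add, ← spin_eq hN hn,
    ← card_label_le hQt hf, Finset.sum_add_distrib, Finset.sum_const, Finset.card_univ,
    Fintype.card_fin, nsmul_eq_mul]
  have : (∑ a, if 0 < (f a : ℕ) ∧ (f a : ℕ) ≤ Qt then θ a + μ else 0) =
      (∑ a, if 0 < (f a : ℕ) ∧ (f a : ℕ) ≤ Qt then θ a else 0) +
        (∑ a, if 0 < (f a : ℕ) ∧ (f a : ℕ) ≤ Qt then (1 : ℂ) else 0) * μ := by
    rw [Finset.sum_mul, ← Finset.sum_add_distrib]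
    refine Finset.sum_congr rfl fun a _ => ?_
    split_ifs <;> ring
  rw [this]
  congr 2
  ring

lemma formFactor_lorentz {N : ℕ} (hN : 2 ≤ N) {E F : ℂ → ℂ} (hE : IsRegularPart N E F)
    {Q Qt : ℕ} (hQt : Qt < N) (c : ℕ → ℂ) (n : ℕ) (μ : ℂ) {θ : Fin n → ℂ} (hθ : θ ∈ generic N n) :
    formFactor N F Q Qt c n (fun i => θ i + μ) =
      Complex.exp (spin N Q Qt * μ) * formFactor N F Q Qt c n θ := by
  by_cases hn : n % N = Q
  swap
  · simp [formFactor_of_ne hn]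
  have hθ' : (fun i => θ i + μ) ∈ generic N n := by
    rw [mem_generic_iff] at hθ ⊢
    intro i j
    rw [add_sub_add_right_eq_sub]
    exact hθ i j
  rw [formFactor_eq_sum hN hE Q Qt c hn hθ, formFactor_eq_sum hN hE Q Qt c hn hθ',
    mul_left_comm (Complex.exp _)]
  congr 1
  rw [Finset.mul_sum]
  refine Finset.sum_congr rfl fun f hf => ?_
  rw [labelValue_add hN hQt hn hf, mul_assoc]
  simp only [add_sub_add_right_eq_sub]

/-! ### Iterated residues -/

/-- The rapidities of the constituents of a bound state, the last of them being `x`. -/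
def chain (N m : ℕ) (x : ℂ) (i : Fin (m + 1)) : ℂ :=
  x + ((m : ℂ) - ((i : ℕ) : ℂ)) * (Complex.I * eta N)

lemma continuous_chain (N m : ℕ) : Continuous (chain N m) := by
  refine continuous_pi fun i => ?_
  unfold chain
  fun_prop

lemma snoc_chain (N m : ℕ) (x : ℂ) :
    (Fin.snoc (chain N m (x + Complex.I * eta N)) x : Fin (m + 2) → ℂ) = chain N (m + 1) x := by
  ext i
  induction i using Fin.lastCases with
  | last =>
    rw [Fin.snoc_last, chain, Fin.val_last]
    ring
  | cast i =>
    rw [Fin.snoc_castSucc, chain, chain, Fin.val_castSucc]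
    push_cast
    ring

lemma continuous_snoc {m : ℕ} (x : ℂ) :
    Continuous fun a : Fin m → ℂ => (Fin.snoc a x : Fin (m + 1) → ℂ) := by
  refine continuous_pi fun i => ?_
  induction i using Fin.lastCases with
  | last =>
    simp only [Fin.snoc_last]
    exact continuous_const
  | cast i =>
    simp only [Fin.snoc_castSucc]
    exact continuous_apply i

lemma hasIteratedResidue_of_continuousOn {N m : ℕ} {G H : (Fin (m + 1) → ℂ) → ℂ} {x : ℂ}
    {U : Set (Fin (m + 1) → ℂ)} (hU : IsOpen U) (hx : chain N m x ∈ U) (hH : ContinuousOn H U)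
    (hG : ∀ a ∈ U, (∀ i : Fin m, a i.castSucc - a i.succ - Complex.I * eta N ≠ 0) →
      G a * ∏ i : Fin m, (a i.castSucc - a i.succ - Complex.I * eta N) = H a) :
    HasIteratedResidue N (m + 1) G x (H (chain N m x)) := by
  induction m generalizing x with
  | zero =>
    have := hG _ hx fun i => i.elim0
    rw [Fin.prod_univ_zero, mul_one] at this
    rw [HasIteratedResidue, ← this]
    congr 1
    ext i
    simp [chain]
  | succ m ih =>
    have hcont : Continuous fun y => (Fin.snoc (chain N m y) x : Fin (m + 2) → ℂ) :=
      (continuous_snoc x).comp (continuous_chain N m)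
    have hmem : ∀ᶠ y in 𝓝 (x + Complex.I * eta N),
        (Fin.snoc (chain N m y) x : Fin (m + 2) → ℂ) ∈ U := by
      refine hcont.continuousAt.eventually_mem ?_
      rw [snoc_chain]
      exact hU.mem_nhds hx
    refine ⟨fun y => H (Fin.snoc (chain N m y) x) / (y - x - Complex.I * eta N), ?_, ?_⟩
    · filter_upwards [hmem.filter_mono nhdsWithin_le_nhds, self_mem_nhdsWithin] with y hy hne
      have hne' : y - x - Complex.I * eta N ≠ 0 := fun h => hne (by
        rw [Set.mem_singleton_iff]
        linear_combination h)
      have hlast : chain N m y (Fin.last m) = y := by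
        rw [chain, Fin.val_last]
        ring
      have key := ih (G := fun θ => G (Fin.snoc θ x)) (x := y)
        (H := fun a => H (Fin.snoc a x) / (a (Fin.last m) - x - Complex.I * eta N))
        (U := {a | (Fin.snoc a x : Fin (m + 2) → ℂ) ∈ U ∧
          a (Fin.last m) - x - Complex.I * eta N ≠ 0}) ?_ ?_ ?_ ?_
      · rw [hlast] at key
        exact key
      · exact (hU.preimage (continuous_snoc x)).inter
          (isOpen_ne_fun (by fun_prop) continuous_const)
      · refine ⟨hy, ?_⟩
        rwa [hlast]
      · refine ContinuousOn.div ?_ (by fun_prop) fun a ha => ha.2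
        exact hH.comp (continuous_snoc x).continuousOn fun a ha => ha.1
      · rintro a ⟨ha, ha'⟩ hd
        rw [eq_div_iff ha', ← hG _ ha, Fin.prod_univ_castSucc]
        · simp only [← Fin.castSucc_succ, Fin.succ_last, Fin.snoc_castSucc, Fin.snoc_last]
          ring
        · intro i
          induction i using Fin.lastCases with
          | last => simpa only [Fin.succ_last, Fin.snoc_castSucc, Fin.snoc_last] using ha'
          | cast i => simpa only [← Fin.castSucc_succ, Fin.snoc_castSucc] using hd i
    · have hlim : Tendsto (fun y => H (Fin.snoc (chain N m y) x)) (𝓝 (x + Complex.I * eta N))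
          (𝓝 (H (chain N (m + 1) x))) := by
        have h1 : ContinuousAt H (chain N (m + 1) x) := hH.continuousAt (hU.mem_nhds hx)
        rw [← snoc_chain] at h1 ⊢
        exact ContinuousAt.comp (f := fun y => (Fin.snoc (chain N m y) x : Fin (m + 2) → ℂ)) h1
          hcont.continuousAt
      refine (hlim.mono_left nhdsWithin_le_nhds).congr' ?_
      filter_upwards [self_mem_nhdsWithin] with y hne
      have hne' : y - x - Complex.I * eta N ≠ 0 := fun h => hne (by
        rw [Set.mem_singleton_iff]
        linear_combination h)
      rw [← sub_sub, mul_div_cancel₀ _ hne']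

lemma hasIteratedResidue_of_eventually {N m : ℕ} {G H : (Fin (m + 1) → ℂ) → ℂ} {x : ℂ}
    (hH : AnalyticAt ℂ H (chain N m x))
    (hG : ∀ᶠ a in 𝓝 (chain N m x),
      (∀ i : Fin m, a i.castSucc - a i.succ - Complex.I * eta N ≠ 0) →
        G a * ∏ i : Fin m, (a i.castSucc - a i.succ - Complex.I * eta N) = H a) :
    HasIteratedResidue N (m + 1) G x (H (chain N m x)) := by
  obtain ⟨U, hU, hUo, hxU⟩ := eventually_nhds_iff.mp (hH.eventually_analyticAt.and hG)
  exact hasIteratedResidue_of_continuousOn hUo hxU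
    (fun a ha => (hU a ha).1.continuousAt.continuousWithinAt) fun a ha => (hU a ha).2

/-! ### Residues of the form factors -/

/-- The factor of two neighbouring constituents of a bound state, multiplied by `z - i η`. -/
def residueFactor (N : ℕ) (E : ℂ → ℂ) (p q : Fin N) (z : ℂ) : ℂ :=
  if p < q then hsRec (z - Complex.I * eta N) * E z
  else (z - Complex.I * eta N) * (pairFactor N p q z * E z)

lemma residueFactor_eq {N : ℕ} (E : ℂ → ℂ) (p q : Fin N) {z : ℂ} (h : z - Complex.I * eta N ≠ 0) :
    residueFactor N E p q z = (z - Complex.I * eta N) * (pairFactor N p q z * E z) := by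
  rw [residueFactor]
  split_ifs with hpq
  · rw [hsRec_of_ne h, pairFactor_of_lt hpq]
    ring
  · rfl

/-- The factor of the particles `i < j` if the first `r` particles form a bound state. -/
def chainFactor (N : ℕ) (E : ℂ → ℂ) (r i j : ℕ) (p q : Fin N) (z : ℂ) : ℂ :=
  if j = i + 1 ∧ j < r then residueFactor N E p q z else pairFactor N p q z * E z

/-- The rapidities `a` of the first particles, followed by those in `t`. -/
def splice {r L : ℕ} (a : Fin r → ℂ) (t : Fin L → ℂ) (i : Fin L) : ℂ :=
  if h : (i : ℕ) < r then a ⟨i, h⟩ else t i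

lemma splice_of_lt {r L : ℕ} (a : Fin r → ℂ) (t : Fin L → ℂ) {i : Fin L} (h : (i : ℕ) < r) :
    splice a t i = a ⟨i, h⟩ := dif_pos h

lemma splice_of_le {r L : ℕ} (a : Fin r → ℂ) (t : Fin L → ℂ) {i : Fin L} (h : r ≤ (i : ℕ)) :
    splice a t i = t i := dif_neg h.not_gt

lemma analyticAt_splice {r L : ℕ} (t : Fin L → ℂ) (a : Fin r → ℂ) :
    AnalyticAt ℂ (fun a : Fin r → ℂ => splice a t) a := by
  refine AnalyticAt.pi fun i => ?_
  by_cases h : (i : ℕ) < r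
  · simp only [splice, dif_pos h]
    exact (ContinuousLinearMap.proj (R := ℂ) (φ := fun _ : Fin r => ℂ) ⟨i, h⟩).analyticAt a
  · simp only [splice, dif_neg h]
    exact analyticAt_const

lemma prod_consecutive {L m : ℕ} (hm : m + 1 ≤ L) (d : Fin L → Fin L → ℂ) :
    (∏ i : Fin L, ∏ j ∈ Finset.Ioi i,
      if (j : ℕ) = i + 1 ∧ (j : ℕ) < m + 1 then d i j else 1) =
      ∏ i : Fin m, d ⟨i, by omega⟩ ⟨i + 1, by omega⟩ := by
  rw [prod_Ioi_eq_prod_filter, Finset.prod_filter]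
  symm
  refine Fintype.prod_of_injective
    (fun i : Fin m => ((⟨i, by omega⟩, ⟨i + 1, by omega⟩) : Fin L × Fin L)) ?_ _ _ ?_ ?_
  · intro i j h
    simp only [Prod.mk.injEq, Fin.mk.injEq] at h
    exact Fin.ext h.1
  · rintro ⟨i, j⟩ h
    dsimp only
    split_ifs with h1 h2
    · exfalso
      apply h
      refine ⟨⟨i, by omega⟩, ?_⟩
      exact Prod.ext rfl (Fin.ext h2.1.symm)
    · rfl
    · rfl
  · intro i
    simp [Fin.lt_def]

/-- The rapidities `t i` with `m < i` are generic with respect to each other and to a bound state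
of `m + 1` particles, the last of which has rapidity `x`. -/
structure IsSpectator (N m : ℕ) {L : ℕ} (x : ℂ) (t : Fin L → ℂ) : Prop where
  regular : ∀ i j : Fin L, m + 1 ≤ (i : ℕ) → i < j → Regular N (t i - t j)
  notMem : ∀ i : Fin L, m + 1 ≤ (i : ℕ) → ∀ k : ℤ, t i - x ≠ Complex.I * eta N * k

lemma splice_chain_sub {N m L : ℕ} {x : ℂ} {t : Fin L → ℂ} {i j : Fin L}
    (hij : i < j) (hj : (j : ℕ) < m + 1) :
    splice (chain N m x) t i - splice (chain N m x) t j =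
      ((j : ℕ) - (i : ℕ) : ℕ) * (Complex.I * eta N) := by
  have hij' : (i : ℕ) < j := hij
  rw [splice_of_lt _ _ (hij'.trans hj), splice_of_lt _ _ hj, chain, chain,
    Nat.cast_sub hij'.le]
  ring

lemma regular_splice_chain {N m L : ℕ} (hN : 2 ≤ N) (hm : m + 1 < N) {x : ℂ}
    {t : Fin L → ℂ} (ht : IsSpectator N m x t) {i j : Fin L}
    (hij : i < j) (h : ¬((j : ℕ) = i + 1 ∧ (j : ℕ) < m + 1)) :
    Regular N (splice (chain N m x) t i - splice (chain N m x) t j) := by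
  have hij' : (i : ℕ) < j := hij
  by_cases hj : (j : ℕ) < m + 1
  · rw [splice_chain_sub hij hj]
    obtain ⟨k, hk⟩ : ∃ k : ℕ, (j : ℕ) - i = k + 2 := ⟨j - i - 2, by omega⟩
    rw [hk]
    refine ⟨?_, ?_⟩
    · have := hs_mul_ne_zero (N := N) (k := k + 1) (by omega) (by omega)
      convert this using 2
      push_cast
      ring
    · have := hs_mul_ne_zero (N := N) (k := k + 3) (by omega) (by omega)
      convert this using 2
      push_cast
      ring
  · rw [splice_of_le _ _ (not_lt.mp hj)]
    by_cases hi : (i : ℕ) < m + 1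
    · rw [splice_of_lt _ _ hi, chain]
      refine regular_of_notMem_lattice hN fun k hk => ht.notMem j (not_lt.mp hj) (m - (i : ℕ) - k) ?_
      push_cast
      linear_combination -hk
    · rw [splice_of_le _ _ (not_lt.mp hi)]
      exact ht.regular i j (not_lt.mp hi) hij

lemma analyticAt_residueFactor {N : ℕ} {E F : ℂ → ℂ} (hE : IsRegularPart N E F) (hN : 3 ≤ N)
    (p q : Fin N) : AnalyticAt ℂ (residueFactor N E p q) (Complex.I * eta N) := by
  have hE' : AnalyticAt ℂ E (Complex.I * eta N) := by
    refine hE.analyticAt_strip _ ?_ ?_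
    · rw [I_mul_eta_im]
      positivity
    · rw [I_mul_eta_im]
      refine div_lt_self (by positivity) ?_
      exact_mod_cast (by omega : 1 < N)
  have hsub : AnalyticAt ℂ (fun z => z - Complex.I * eta N) (Complex.I * eta N) := by fun_prop
  unfold residueFactor
  split_ifs with hpq
  · refine AnalyticAt.mul ?_ hE'
    refine AnalyticAt.fun_comp (f := fun z => z - Complex.I * eta N) ?_ hsub
    exact analyticAt_hsRec (Or.inl (sub_self _))
  · refine hsub.mul (AnalyticAt.mul ?_ hE')
    rcases eq_or_lt_of_le (not_lt.mp hpq) with h | h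
    · rw [h, show pairFactor N p p = _ from funext (pairFactor_self p)]
      exact analyticAt_hs _
    · rw [show pairFactor N p q = _ from funext (pairFactor_of_gt h)]
      refine (analyticAt_hs_add _ _).inv ?_
      rw [← two_mul]
      exact_mod_cast hs_mul_ne_zero (N := N) (k := 2) (by omega) (by omega)

lemma analyticAt_chainFactor {N m L : ℕ} (hN : 2 ≤ N) (hm : m + 1 < N) {x : ℂ}
    {t : Fin L → ℂ} (ht : IsSpectator N m x t) {E F : ℂ → ℂ}
    (hE : IsRegularPart N E F) (p q : Fin N) {i j : Fin L}
    (hij : i < j) : AnalyticAt ℂ (chainFactor N E (m + 1) i j p q)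
      (splice (chain N m x) t i - splice (chain N m x) t j) := by
  unfold chainFactor
  split_ifs with h
  · rw [splice_chain_sub hij h.2, h.1, Nat.add_sub_cancel_left, Nat.cast_one, one_mul]
    exact analyticAt_residueFactor hE (by omega) p q
  · have hreg := regular_splice_chain hN hm ht hij h
    exact (analyticAt_pairFactor p q hreg).mul (hE.analyticAt _ hreg)

/-- The iterated residue of the sum over the labelings. -/
def chainSum (N Q Qt m L : ℕ) (E : ℂ → ℂ) (θ : Fin L → ℂ) : ℂ :=
  ∑ f ∈ labelings N L (multiplicity N Q L), labelValue N Qt L θ f *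
    ∏ i : Fin L, ∏ j ∈ Finset.Ioi i, chainFactor N E (m + 1) i j (f i) (f j) (θ i - θ j)

lemma hasIteratedResidue_formFactor {N m L : ℕ} (hN : 2 ≤ N) (hm : m + 1 < N) {x : ℂ}
    {t : Fin L → ℂ} (ht : IsSpectator N m x t) {E F : ℂ → ℂ}
    (hE : IsRegularPart N E F) (hL : m + 1 ≤ L)
    (Q Qt : ℕ) (c : ℕ → ℂ) (hQ : L % N = Q) :
    HasIteratedResidue N (m + 1) (fun a => formFactor N F Q Qt c L (splice a t)) x
      (c L * chainSum N Q Qt m L E (splice (chain N m x) t)) := by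
  have hsub : ∀ i j, AnalyticAt ℂ (fun a : Fin (m + 1) → ℂ => splice a t i - splice a t j)
      (chain N m x) := fun i j =>
    (analyticAt_apply_sub i j _).fun_comp (analyticAt_splice t (chain N m x))
  refine hasIteratedResidue_of_eventually
    (H := fun a => c L * chainSum N Q Qt m L E (splice a t)) ?_ ?_
  · unfold chainSum
    refine analyticAt_const.mul (Finset.analyticAt_fun_sum _ fun f _ =>
      AnalyticAt.mul ?_ (Finset.analyticAt_fun_prod _ fun i _ =>
        Finset.analyticAt_fun_prod _ fun j hj => ?_))
    · exact AnalyticAt.fun_comp (f := fun a : Fin (m + 1) → ℂ => splice a t)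
        (analyticAt_labelValue f _) (analyticAt_splice t _)
    · exact AnalyticAt.fun_comp (f := fun a : Fin (m + 1) → ℂ => splice a t i - splice a t j)
        (analyticAt_chainFactor hN hm ht hE _ _ (Finset.mem_Ioi.mp hj)) (hsub i j)
  · have hreg : ∀ᶠ a in 𝓝 (chain N m x), ∀ i j : Fin L, i < j →
        ((j : ℕ) = i + 1 ∧ (j : ℕ) < m + 1 → splice a t i - splice a t j ≠ Complex.I * eta N) →
        Regular N (splice a t i - splice a t j) := by
      rw [eventually_all]
      intro i
      rw [eventually_all]
      intro j
      by_cases hij : i < j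
      swap
      · exact Eventually.of_forall fun a h => absurd h hij
      by_cases h : (j : ℕ) = i + 1 ∧ (j : ℕ) < m + 1
      · have h1 := eventually_nhdsWithin_iff.mp (eventually_regular N (Complex.I * eta N))
        have h2 := (hsub i j).continuousAt.tendsto
        rw [splice_chain_sub hij h.2, h.1, Nat.add_sub_cancel_left, Nat.cast_one, one_mul] at h2
        filter_upwards [h2.eventually h1] with a ha _ hne
        exact ha (hne h)
      · have h1 := (isOpen_regular N).mem_nhds (regular_splice_chain hN hm ht hij h)
        filter_upwards [(hsub i j).continuousAt.eventually_mem h1] with a ha _ _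
        exact ha
    filter_upwards [hreg] with a ha hd
    have hd' : ∀ i j : Fin L, i < j → (j : ℕ) = i + 1 ∧ (j : ℕ) < m + 1 →
        splice a t i - splice a t j - Complex.I * eta N ≠ 0 := by
      intro i j hij h
      have := hd ⟨i, by omega⟩
      rw [splice_of_lt _ _ (by omega : (i : ℕ) < m + 1), splice_of_lt _ _ h.2]
      convert this using 4
      · rfl
      · exact Fin.ext h.1
    have hgen : splice a t ∈ generic N L :=
      mem_generic_of_lt hN fun i j hij => ha i j hij fun h => sub_ne_zero.mp (hd' i j hij h)
    have hprod : ∏ i : Fin m, (a i.castSucc - a i.succ - Complex.I * eta N) =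
        ∏ i : Fin L, ∏ j ∈ Finset.Ioi i, if (j : ℕ) = i + 1 ∧ (j : ℕ) < m + 1 then
          splice a t i - splice a t j - Complex.I * eta N else 1 := by
      rw [prod_consecutive hL fun i j => splice a t i - splice a t j - Complex.I * eta N]
      refine Finset.prod_congr rfl fun i _ => ?_
      have h0 : (i : ℕ) < m + 1 := by omega
      have h1 : (i : ℕ) + 1 < m + 1 := by omega
      rw [splice_of_lt a t (i := ⟨i, by omega⟩) h0, splice_of_lt a t (i := ⟨i + 1, by omega⟩) h1]
      rfl
    rw [hprod, formFactor_eq_sum hN hE Q Qt c hQ hgen, mul_assoc, Finset.sum_mul, chainSum]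
    congr 1
    refine Finset.sum_congr rfl fun f _ => ?_
    rw [mul_assoc]
    congr 1
    simp_rw [← Finset.prod_mul_distrib]
    refine Finset.prod_congr rfl fun i _ => Finset.prod_congr rfl fun j hj => ?_
    rw [chainFactor]
    split_ifs with h
    · rw [residueFactor_eq _ _ _ (hd' i j (Finset.mem_Ioi.mp hj) h)]
      ring
    · ring

lemma hasIteratedResidue_zero (N m : ℕ) (x : ℂ) :
    HasIteratedResidue N (m + 1) (fun _ => 0) x 0 :=
  hasIteratedResidue_of_continuousOn (H := fun _ => 0) isOpen_univ (Set.mem_univ _)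
    continuousOn_const fun _ _ _ => zero_mul _

lemma append_eq_splice {r n : ℕ} (a : Fin r → ℂ) (θ : Fin n → ℂ) :
    Fin.append a θ = splice a (Fin.append (fun _ => 0) θ) := by
  ext i
  induction i using Fin.addCases with
  | left i =>
    rw [Fin.append_left, splice_of_lt _ _ (by simp)]
    rfl
  | right i => rw [Fin.append_right, splice_of_le _ _ (by simp), Fin.append_right]

lemma formFactor_boundState {N : ℕ} (hN : 2 ≤ N) {E F : ℂ → ℂ} (hE : IsRegularPart N E F)
    (Q Qt : ℕ) (c : ℕ → ℂ) {r n : ℕ} (h₀ : 1 ≤ r) (h₁ : r < N) (x : ℂ) {θ : Fin n → ℂ}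
    (hθ : θ ∈ generic N n) (hx : ∀ i, ∀ k : ℤ, θ i - x ≠ Complex.I * eta N * k) :
    ∃ b, HasIteratedResidue N r (fun a => formFactor N F Q Qt c (r + n) (Fin.append a θ)) x b := by
  obtain ⟨m, rfl⟩ : ∃ m, r = m + 1 := ⟨r - 1, by omega⟩
  by_cases hQ : (m + 1 + n) % N = Q
  · rw [show (fun a : Fin (m + 1) → ℂ => formFactor N F Q Qt c (m + 1 + n) (Fin.append a θ)) =
      fun a => formFactor N F Q Qt c (m + 1 + n) (splice a (Fin.append (fun _ => 0) θ)) from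
        funext fun a => by rw [← append_eq_splice]]
    refine ⟨_, hasIteratedResidue_formFactor hN h₁ ⟨?_, ?_⟩ hE (by omega) Q Qt c hQ⟩
    · intro i j hi hij
      have hij' : (i : ℕ) < j := hij
      induction i using Fin.addCases with
      | left i => simp at hi; omega
      | right i =>
        induction j using Fin.addCases with
        | left j => simp at hij'; omega
        | right j =>
          rw [Fin.append_right, Fin.append_right]
          exact regular_of_mem_generic hθ i j
    · intro i hi
      induction i using Fin.addCases with
      | left i => simp at hi; omega
      | right i =>
        rw [Fin.append_right]
        exact hx i
  · exact ⟨0, by simpa [formFactor_of_ne hQ] using hasIteratedResidue_zero N m x⟩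

/-! ### A complete chain of particles and its spectators -/

lemma prod_Ioi_univ_add {m n : ℕ} (g : Fin (m + n) → Fin (m + n) → ℂ) :
    ∏ a, ∏ b ∈ Finset.Ioi a, g a b =
      (∏ a : Fin m, ∏ b ∈ Finset.Ioi a, g (Fin.castAdd n a) (Fin.castAdd n b)) *
        (∏ a : Fin m, ∏ b : Fin n, g (Fin.castAdd n a) (Fin.natAdd m b)) *
          ∏ a : Fin n, ∏ b ∈ Finset.Ioi a, g (Fin.natAdd m a) (Fin.natAdd m b) := by
  have h1 : ∀ (a : Fin m) (b : Fin n), Fin.castAdd n a < Fin.natAdd m b := by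
    intro a b
    rw [Fin.lt_def, Fin.val_castAdd, Fin.val_natAdd]
    omega
  have h2 : ∀ (a : Fin n) (b : Fin m), ¬Fin.natAdd m a < Fin.castAdd n b :=
    fun a b => (h1 b a).not_gt
  have h3 : ∀ a b : Fin m, Fin.castAdd n a < Fin.castAdd n b ↔ a < b := fun a b => Iff.rfl
  have h4 : ∀ a b : Fin n, Fin.natAdd m a < Fin.natAdd m b ↔ a < b := fun a b => by
    rw [Fin.lt_def, Fin.lt_def, Fin.val_natAdd, Fin.val_natAdd, add_lt_add_iff_left]
  simp_rw [prod_Ioi_eq_ite]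
  rw [Fin.prod_univ_add]
  simp only [Fin.prod_univ_add, h1, h2, h3, h4, if_true, if_false, Finset.prod_const_one, one_mul,
    Finset.prod_mul_distrib]

lemma multiplicity_add {N : ℕ} (hN : 2 ≤ N) (Q n : ℕ) (k : Fin (N - 1)) :
    multiplicity N Q (N + n) k = 1 + multiplicity N Q n k := by
  rw [multiplicity, multiplicity, Nat.add_div_left _ (by omega)]
  ring

lemma card_labelFiber_perm {N : ℕ} (u : Equiv.Perm (Fin N)) (k : Fin (N - 1)) :
    (labelFiber u k).card = 1 := by
  rw [Finset.card_eq_one]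
  refine ⟨u.symm ⟨k + 1, by omega⟩, ?_⟩
  ext a
  rw [mem_labelFiber, Finset.mem_singleton, Equiv.eq_symm_apply, Fin.ext_iff]

lemma card_labelFiber_append {N m n : ℕ} (u : Fin m → Fin N) (v : Fin n → Fin N)
    (k : Fin (N - 1)) :
    (labelFiber (Fin.append u v) k).card = (labelFiber u k).card + (labelFiber v k).card := by
  simp only [labelFiber, Finset.card_filter, Fin.sum_univ_add, Fin.append_left, Fin.append_right]

lemma append_mem_labelings {N : ℕ} (hN : 2 ≤ N) (Q n : ℕ) (u : Equiv.Perm (Fin N))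
    (v : Fin n → Fin N) :
    Fin.append u v ∈ labelings N (N + n) (multiplicity N Q (N + n)) ↔
      v ∈ labelings N n (multiplicity N Q n) := by
  rw [mem_labelings, mem_labelings]
  refine forall_congr' fun k => ?_
  rw [card_labelFiber_append, card_labelFiber_perm, multiplicity_add hN]
  omega

lemma rho_add {N : ℕ} (hN : 2 ≤ N) (Qt n : ℕ) :
    rho N Qt (N + n) =
      Complex.exp (Complex.I * Real.pi / N * ((Qt : ℂ) * ((Qt : ℂ) - N + 2))) * rho N Qt n := by
  have hN0 : (N : ℂ) ≠ 0 := by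
    rw [Nat.cast_ne_zero]
    omega
  rw [rho, rho, ← Complex.exp_add]
  congr 1
  push_cast
  field_simp

/-- The contribution to `labelValue` of a chain of `N` particles with rapidities `χ` and
labels `u`. -/
def chainValue (N Qt : ℕ) (χ : Fin N → ℂ) (u : Fin N → Fin N) : ℂ :=
  Complex.exp (Complex.I * Real.pi / N * ((Qt : ℂ) * ((Qt : ℂ) - N + 2))) *
    Complex.exp ((∑ i, if 0 < (u i : ℕ) ∧ (u i : ℕ) ≤ Qt then χ i else 0) -
      (Qt : ℂ) / N * ∑ i, χ i)

lemma labelValue_append {N : ℕ} (hN : 2 ≤ N) (Qt n : ℕ) (χ : Fin N → ℂ) (θ : Fin n → ℂ)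
    (u : Fin N → Fin N) (v : Fin n → Fin N) :
    labelValue N Qt (N + n) (Fin.append χ θ) (Fin.append u v) =
      chainValue N Qt χ u * labelValue N Qt n θ v := by
  rw [labelValue, labelValue, chainValue, rho_add hN]
  simp only [Fin.sum_univ_add, Fin.append_left, Fin.append_right]
  rw [show ∀ A B C D : ℂ, A * B * (C * D) = A * C * (B * D) from fun A B C D => by ring,
    ← Complex.exp_add]
  congr 2
  ring

lemma sum_range_linear (k : ℕ) (α β : ℂ) :
    ∑ i ∈ Finset.range k, (α + β * i) = k * α + β * (k * (k - 1) / 2) := by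
  induction k with
  | zero => simp
  | succ k ih =>
    rw [Finset.sum_range_succ, ih]
    push_cast
    ring

lemma sum_fin_ite_lt {K Qt : ℕ} (h : Qt ≤ K) (g : ℕ → ℂ) :
    (∑ k : Fin K, if (k : ℕ) < Qt then g k else 0) = ∑ k ∈ Finset.range Qt, g k := by
  rw [Fin.sum_univ_eq_sum_range (fun k => if k < Qt then g k else 0), ← Finset.sum_filter]
  refine Finset.sum_congr ?_ fun _ _ => rfl
  ext k
  rw [Finset.mem_filter, Finset.mem_range, Finset.mem_range]
  omega

lemma exp_chain_shift {N : ℕ} (hN : 2 ≤ N) (Qt : ℕ) {g : ℕ → ℂ} {x : ℂ}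
    (hg : ∀ i, g i = x + ((N : ℂ) - 1 - i) * (Complex.I * eta N)) :
    Complex.exp (Complex.I * Real.pi / N * ((Qt : ℂ) * ((Qt : ℂ) - N + 2))) *
      Complex.exp (∑ i ∈ Finset.range Qt, g (i + 1) -
        (Qt : ℂ) / N * ∑ i ∈ Finset.range N, g i) = 1 := by
  have hN0 : (N : ℂ) ≠ 0 := by
    rw [Nat.cast_ne_zero]
    omega
  have h1 : ∀ i : ℕ, g (i + 1) = (x + ((N : ℂ) - 2) * (Complex.I * eta N)) +
      -(Complex.I * eta N) * i := by
    intro i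
    rw [hg]
    push_cast
    ring
  have h2 : ∀ i : ℕ, g i = (x + ((N : ℂ) - 1) * (Complex.I * eta N)) +
      -(Complex.I * eta N) * i := by
    intro i
    rw [hg]
    ring
  simp_rw [h1]
  simp_rw [h2]
  rw [sum_range_linear, sum_range_linear, ← Complex.exp_add, Complex.exp_eq_one_iff]
  refine ⟨0, ?_⟩
  rw [eta]
  push_cast
  field_simp
  ring

lemma exp_chain {N : ℕ} (hN : 2 ≤ N) (Qt : ℕ) {g : ℕ → ℂ} {x : ℂ}
    (hg : ∀ i, g i = x + ((N : ℂ) - 1 - i) * (Complex.I * eta N)) :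
    Complex.exp (Complex.I * Real.pi / N * ((Qt : ℂ) * ((Qt : ℂ) - N + 2))) *
      Complex.exp (∑ i ∈ Finset.range Qt, g i -
        (Qt : ℂ) / N * ∑ i ∈ Finset.range N, g i) = statistics N Qt := by
  have h : ∑ i ∈ Finset.range Qt, g i =
      ∑ i ∈ Finset.range Qt, g (i + 1) + Qt * (Complex.I * eta N) := by
    have : ∀ i : ℕ, g i = g (i + 1) + Complex.I * eta N := by
      intro i
      rw [hg, hg]
      push_cast
      ring
    rw [Finset.sum_congr rfl fun i _ => this i, Finset.sum_add_distrib, Finset.sum_const,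
      Finset.card_range, nsmul_eq_mul]
  rw [h, add_sub_right_comm, Complex.exp_add, ← mul_assoc, exp_chain_shift hN Qt hg, one_mul,
    statistics, omega, ← Complex.exp_nat_mul]

lemma chain_eq {M : ℕ} (x : ℂ) (i : Fin (M + 2)) : chain (M + 2) (M + 1) x i =
    x + (((M + 2 : ℕ) : ℂ) - 1 - (i : ℕ)) * (Complex.I * eta (M + 2)) := by
  rw [chain]
  push_cast
  ring

lemma chainValue_id {M Qt : ℕ} (hQt : Qt < M + 2) (x : ℂ) :
    chainValue (M + 2) Qt (chain (M + 2) (M + 1) x) (Equiv.refl _) = 1 := by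
  rw [chainValue, ← exp_chain_shift (N := M + 2) (by omega) Qt (x := x)
    (g := fun i => x + (((M + 2 : ℕ) : ℂ) - 1 - i) * (Complex.I * eta (M + 2))) fun _ => rfl]
  congr 3
  · simp only [Equiv.refl_apply, chain_eq]
    rw [Fin.sum_univ_succ, ← sum_fin_ite_lt (K := M + 1) (by omega)]
    simp
  · simp only [chain_eq]
    rw [Fin.sum_univ_eq_sum_range
      (fun i => x + (((M + 2 : ℕ) : ℂ) - 1 - i) * (Complex.I * eta (M + 2)))]

lemma chainValue_rotate {M Qt : ℕ} (hQt : Qt < M + 2) (x : ℂ) :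
    chainValue (M + 2) Qt (chain (M + 2) (M + 1) x) (finRotate (M + 2)) =
      statistics (M + 2) Qt := by
  rw [chainValue, ← exp_chain (N := M + 2) (by omega) Qt (x := x)
    (g := fun i => x + (((M + 2 : ℕ) : ℂ) - 1 - i) * (Complex.I * eta (M + 2))) fun _ => rfl]
  congr 3
  · simp only [chain_eq]
    rw [Fin.sum_univ_castSucc, ← sum_fin_ite_lt (K := M + 1) (by omega)]
    simp
  · simp only [chain_eq]
    rw [Fin.sum_univ_eq_sum_range
      (fun i => x + (((M + 2 : ℕ) : ℂ) - 1 - i) * (Complex.I * eta (M + 2)))]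

/-! ### The factors of a complete chain and a spectator -/

lemma prod_range_shift {h : ℕ → ℂ} (hh : ∀ j, h j ≠ 0) (p q : ℕ) :
    (∏ j ∈ Finset.range (p + (q + 1)),
        if p < j then (h (j - 1))⁻¹ else if j < p then (h (j + 1))⁻¹ else h j) *
      ∏ j ∈ Finset.range (p + q), (h j * h (j + 1)) = ∏ j ∈ Finset.range (p + (q + 1)), h j := by
  have e1 : ∏ j ∈ Finset.range p,
      (if p < j then (h (j - 1))⁻¹ else if j < p then (h (j + 1))⁻¹ else h j) =
      (∏ j ∈ Finset.range p, h (j + 1))⁻¹ := by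
    rw [← Finset.prod_inv_distrib]
    refine Finset.prod_congr rfl fun j hj => ?_
    have := Finset.mem_range.mp hj
    rw [if_neg (by omega), if_pos this]
  have e2 : ∏ j ∈ Finset.range q, (if p < p + (j + 1) then (h (p + (j + 1) - 1))⁻¹
      else if p + (j + 1) < p then (h (p + (j + 1) + 1))⁻¹ else h (p + (j + 1))) =
      (∏ j ∈ Finset.range q, h (p + j))⁻¹ := by
    rw [← Finset.prod_inv_distrib]
    refine Finset.prod_congr rfl fun j hj => ?_
    rw [if_pos (by omega)]
    rfl
  have key : ∀ f : ℕ → ℂ, ∏ j ∈ Finset.range (p + (q + 1)), f j =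
      (∏ j ∈ Finset.range p, f j) * ((∏ j ∈ Finset.range q, f (p + (j + 1))) * f p) := by
    intro f
    rw [Finset.prod_range_add, Finset.prod_range_succ', add_zero]
  rw [Finset.prod_mul_distrib, key, key, Finset.prod_range_add, Finset.prod_range_add, e1, e2,
    if_neg (lt_irrefl p), if_neg (lt_irrefl p)]
  have n1 : ∏ j ∈ Finset.range p, h (j + 1) ≠ 0 := Finset.prod_ne_zero_iff.mpr fun j _ => hh _
  have n2 : ∏ j ∈ Finset.range q, h (p + j) ≠ 0 := Finset.prod_ne_zero_iff.mpr fun j _ => hh _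
  simp only [add_assoc] at *
  field_simp

lemma prod_chain_id {N : ℕ} (hN : 2 ≤ N) {E F : ℂ → ℂ} (hE : IsRegularPart N E F) {w : ℂ}
    (hw : ∀ k : ℤ, w ≠ Complex.I * eta N * k) (v : Fin N) :
    ∏ i : Fin N, (pairFactor N i v (w + ((N : ℂ) - 1 - (i : ℕ)) * (Complex.I * eta N)) *
      E (w + ((N : ℂ) - 1 - (i : ℕ)) * (Complex.I * eta N))) = 1 := by
  set h : ℕ → ℂ := fun j => hs (w + j * (Complex.I * eta N)) with hdef
  have hh : ∀ j, h j ≠ 0 := by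
    intro j
    have := hs_ne_zero_of_notMem_lattice hN hw j
    rw [hdef]
    convert this using 2
    push_cast
    ring
  obtain ⟨q, hq⟩ : ∃ q, N = (N - 1 - v) + (q + 1) := ⟨v, by omega⟩
  have hq' : N - 1 = (N - 1 - v) + q := by omega
  have hrev : ∏ i : Fin N, (pairFactor N i v (w + ((N : ℂ) - 1 - (i : ℕ)) * (Complex.I * eta N)) *
      E (w + ((N : ℂ) - 1 - (i : ℕ)) * (Complex.I * eta N))) =
      ∏ j ∈ Finset.range N, ((if N - 1 - v < j then (h (j - 1))⁻¹ else
        if j < N - 1 - v then (h (j + 1))⁻¹ else h j) * E (w + j * (Complex.I * eta N))) := by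
    rw [← Equiv.prod_comp Fin.revPerm, ← Fin.prod_univ_eq_prod_range]
    refine Finset.prod_congr rfl fun j _ => ?_
    have hz : w + ((N : ℂ) - 1 - ((Fin.revPerm j : Fin N) : ℕ)) * (Complex.I * eta N) =
        w + (j : ℕ) * (Complex.I * eta N) := by
      rw [Fin.revPerm_apply, Fin.val_rev, Nat.cast_sub (by omega)]
      push_cast
      ring
    rw [hz]
    congr 1
    have hv : ((Fin.revPerm j : Fin N) : ℕ) = N - 1 - j := by
      rw [Fin.revPerm_apply, Fin.val_rev]
      omega
    split_ifs with h1 h2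
    · rw [pairFactor_of_lt (by rw [Fin.lt_def, hv]; omega), hdef]
      dsimp only
      rw [Nat.cast_sub (by omega)]
      congr 2
      push_cast
      ring
    · rw [pairFactor_of_gt (by rw [Fin.lt_def, hv]; omega), hdef]
      dsimp only
      congr 2
      push_cast
      ring
    · rw [show Fin.revPerm j = v from Fin.ext (by rw [hv]; omega), pairFactor_self]
  have hprod := hE.prod_eq w hw
  have hk : ∏ j ∈ Finset.range (N - 1), kappa N (w + j * (Complex.I * eta N)) =
      ∏ j ∈ Finset.range (N - 1), (h j * h (j + 1)) := by
    refine Finset.prod_congr rfl fun j _ => ?_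
    rw [kappa_eq, hdef]
    dsimp only
    congr 2
    push_cast
    ring
  have hne : ∏ j ∈ Finset.range N, h j ≠ 0 := Finset.prod_ne_zero_iff.mpr fun j _ => hh j
  have hs1 := prod_range_shift hh (N - 1 - v) q
  rw [← hq, ← hq'] at hs1
  rw [hk, Finset.prod_mul_distrib] at hprod
  rw [hrev, Finset.prod_mul_distrib]
  apply mul_right_cancel₀ hne
  rw [one_mul]
  refine Eq.trans ?_ hs1
  rw [← hprod]
  ring

lemma prod_chain_rotate {M : ℕ} {E F : ℂ → ℂ} (hE : IsRegularPart (M + 2) E F) {w : ℂ}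
    (hw : ∀ k : ℤ, w ≠ Complex.I * eta (M + 2) * k) (v : Fin (M + 2)) :
    ∏ i : Fin (M + 2), (pairFactor (M + 2) (finRotate (M + 2) i) v
        (w + (((M + 2 : ℕ) : ℂ) - 1 - (i : ℕ)) * (Complex.I * eta (M + 2))) *
      E (w + (((M + 2 : ℕ) : ℂ) - 1 - (i : ℕ)) * (Complex.I * eta (M + 2)))) =
      smatrix (M + 2) w := by
  have hN : 2 ≤ M + 2 := by omega
  have hw' : ∀ k : ℤ, w + Complex.I * eta (M + 2) ≠ Complex.I * eta (M + 2) * k := by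
    intro k hk
    apply hw (k - 1)
    push_cast
    linear_combination hk
  have hreg := regular_of_notMem_lattice hN hw
  have h1 := prod_chain_id hN hE hw' v
  rw [Fin.prod_univ_succ] at h1
  rw [Fin.prod_univ_castSucc]
  have hz0 : w + Complex.I * eta (M + 2) +
      (((M + 2 : ℕ) : ℂ) - 1 - ((0 : Fin (M + 2)) : ℕ)) * (Complex.I * eta (M + 2)) =
      w + 2 * Real.pi * Complex.I := by
    rw [← N_mul_I_mul_eta hN, Fin.val_zero]
    push_cast
    ring
  have hzl : w + (((M + 2 : ℕ) : ℂ) - 1 - ((Fin.last (M + 1) : Fin (M + 2)) : ℕ)) *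
      (Complex.I * eta (M + 2)) = w := by
    rw [Fin.val_last]
    push_cast
    ring
  have hzs : ∀ i : Fin (M + 1), w + Complex.I * eta (M + 2) +
      (((M + 2 : ℕ) : ℂ) - 1 - (i.succ : ℕ)) * (Complex.I * eta (M + 2)) =
      w + (((M + 2 : ℕ) : ℂ) - 1 - (i.castSucc : ℕ)) * (Complex.I * eta (M + 2)) := by
    intro i
    rw [Fin.val_succ, Fin.val_castSucc]
    push_cast
    ring
  simp only [hz0, hzs, pairFactor_add_two_pi, hE.crossing w hreg] at h1
  have hr : ∀ i : Fin (M + 1), finRotate (M + 2) i.castSucc = i.succ := by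
    intro i
    rw [finRotate_apply, Fin.coeSucc_eq_succ]
  simp only [hr, finRotate_last, hzl, hE.watson w hreg]
  linear_combination smatrix (M + 2) w * h1

/-! ### The residue of a complete chain -/

/-- The factor of two particles at distance `k` in a chain with increasing labels. -/
def orderedFactor (N : ℕ) (E : ℂ → ℂ) (k : ℕ) : ℂ :=
  (if k = 1 then 2 else (hs (((k - 1 : ℕ) : ℂ) * (Complex.I * eta N)))⁻¹) *
    E (k * (Complex.I * eta N))

/-- The iterated residue of the factors of a chain of `N` particles with increasing labels. -/
def chainConstant (N : ℕ) (E : ℂ → ℂ) : ℂ :=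
  ∏ i : Fin N, ∏ j ∈ Finset.Ioi i, orderedFactor N E (j - i)

lemma analyticAt_chain_lattice {N : ℕ} {E F : ℂ → ℂ} (hE : IsRegularPart N E F) {k : ℕ}
    (h₀ : 0 < k) (h₁ : k < N) : AnalyticAt ℂ E (k * (Complex.I * eta N)) := by
  have hN : (0 : ℝ) < N := by exact_mod_cast (by omega : 0 < N)
  have him := mul_I_mul_eta_im N k
  rw [Complex.ofReal_natCast] at him
  refine hE.analyticAt_strip _ ?_ ?_
  · rw [him]
    positivity
  · rw [him, mul_div_assoc', div_lt_iff₀ hN, mul_comm]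
    have : (k : ℝ) < N := by exact_mod_cast h₁
    exact mul_lt_mul_of_pos_left this (by positivity)

lemma ne_zero_lattice {N : ℕ} {E F : ℂ → ℂ} (hE : IsRegularPart N E F) {k : ℕ}
    (h₀ : 0 < k) (h₁ : k < N) : E (k * (Complex.I * eta N)) ≠ 0 := by
  have hN : (0 : ℝ) < N := by exact_mod_cast (by omega : 0 < N)
  have him := mul_I_mul_eta_im N k
  rw [Complex.ofReal_natCast] at him
  refine hE.ne_zero_strip _ ?_ ?_
  · rw [him]
    positivity
  · rw [him, mul_div_assoc', div_lt_iff₀ hN, mul_comm]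
    have : (k : ℝ) < N := by exact_mod_cast h₁
    exact mul_lt_mul_of_pos_left this (by positivity)

lemma orderedFactor_ne_zero {N : ℕ} {E F : ℂ → ℂ} (hE : IsRegularPart N E F) {k : ℕ}
    (h₀ : 0 < k) (h₁ : k < N) : orderedFactor N E k ≠ 0 := by
  refine mul_ne_zero ?_ (ne_zero_lattice hE h₀ h₁)
  split_ifs with h
  · exact two_ne_zero
  · exact inv_ne_zero (hs_mul_ne_zero (by omega) (by omega))

lemma chainConstant_ne_zero {N : ℕ} {E F : ℂ → ℂ} (hE : IsRegularPart N E F) :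
    chainConstant N E ≠ 0 := by
  refine Finset.prod_ne_zero_iff.mpr fun i _ => Finset.prod_ne_zero_iff.mpr fun j hj => ?_
  have : (i : ℕ) < j := Fin.lt_def.mp (Finset.mem_Ioi.mp hj)
  exact orderedFactor_ne_zero hE (by omega) (by omega)

lemma continuousAt_pairFactor_mul {N : ℕ} {E F : ℂ → ℂ} (hE : IsRegularPart N E F) {p q : Fin N}
    {k : ℕ} (h₀ : 0 < k) (h₁ : k < N) (hlt : p < q → 2 ≤ k) (hgt : q < p → k + 2 ≤ N) :
    ContinuousAt (fun z => pairFactor N p q z * E z) (k * (Complex.I * eta N)) := by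
  refine ContinuousAt.mul ?_ (analyticAt_chain_lattice hE h₀ h₁).continuousAt
  rcases lt_trichotomy p q with h | rfl | h
  · rw [show pairFactor N p q = _ from funext (pairFactor_of_lt h)]
    refine ContinuousAt.inv₀ (continuous_hs.comp (by fun_prop)).continuousAt ?_
    have := hs_mul_ne_zero (N := N) (k := k - 1) (by have := hlt h; omega) (by omega)
    rw [Nat.cast_sub h₀] at this
    convert this using 2
    push_cast
    ring
  · rw [show pairFactor N p p = _ from funext (pairFactor_self p)]
    exact continuous_hs.continuousAt
  · rw [show pairFactor N p q = _ from funext (pairFactor_of_gt h)]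
    refine ContinuousAt.inv₀ (continuous_hs.comp (by fun_prop)).continuousAt ?_
    have := hs_mul_ne_zero (N := N) (k := k + 1) (by omega) (by have := hgt h; omega)
    convert this using 2
    push_cast
    ring

lemma continuousAt_hsRec_zero : ContinuousAt hsRec 0 := (analyticAt_hsRec (Or.inl rfl)).continuousAt

section

variable {M : ℕ} {E F : ℂ → ℂ}

lemma tendsto_chain_sub (M : ℕ) (x : ℂ) (i : Fin (M + 1)) :
    Tendsto (fun y => chain (M + 2) M y i - x) (𝓝[≠] (x + Complex.I * eta (M + 2)))
      (𝓝 (((M + 1 - i : ℕ) : ℂ) * (Complex.I * eta (M + 2)))) := by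
  have h : Continuous fun y => chain (M + 2) M y i - x := by
    unfold chain
    fun_prop
  have h1 := (h.tendsto (x + Complex.I * eta (M + 2))).mono_left
    (nhdsWithin_le_nhds (s := {x + Complex.I * eta (M + 2)}ᶜ))
  convert h1 using 2
  rw [chain, Nat.cast_sub (by omega)]
  push_cast
  ring

lemma tendsto_last_of_gt (hE : IsRegularPart (M + 2) E F) (x : ℂ) {u : Fin (M + 1) → Fin (M + 2)}
    {v : Fin (M + 2)} (hu : ∀ i, u i < v) :
    Tendsto (fun y => (y - (x + Complex.I * eta (M + 2))) * ∏ i : Fin (M + 1),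
        (pairFactor (M + 2) (u i) v (chain (M + 2) M y i - x) * E (chain (M + 2) M y i - x)))
      (𝓝[≠] (x + Complex.I * eta (M + 2)))
      (𝓝 (∏ i : Fin (M + 1), orderedFactor (M + 2) E (M + 1 - i))) := by
  simp only [Fin.prod_univ_castSucc]
  rw [show (fun y => (y - (x + Complex.I * eta (M + 2))) * ((∏ i : Fin M,
      (pairFactor (M + 2) (u i.castSucc) v (chain (M + 2) M y i.castSucc - x) *
        E (chain (M + 2) M y i.castSucc - x))) *
      (pairFactor (M + 2) (u (Fin.last M)) v (chain (M + 2) M y (Fin.last M) - x) *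
        E (chain (M + 2) M y (Fin.last M) - x)))) = fun y => (∏ i : Fin M,
      (pairFactor (M + 2) (u i.castSucc) v (chain (M + 2) M y i.castSucc - x) *
        E (chain (M + 2) M y i.castSucc - x))) * ((y - (x + Complex.I * eta (M + 2))) *
      (pairFactor (M + 2) (u (Fin.last M)) v (chain (M + 2) M y (Fin.last M) - x) *
        E (chain (M + 2) M y (Fin.last M) - x))) from funext fun y => by ring]
  refine Tendsto.mul (tendsto_finsetProd _ fun i _ => ?_) ?_
  · have hk : 2 ≤ M + 1 - (i.castSucc : ℕ) := by
      rw [Fin.val_castSucc]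
      omega
    have h1 := (continuousAt_pairFactor_mul hE (p := u i.castSucc) (q := v)
      (k := M + 1 - (i.castSucc : ℕ)) (by omega) (by omega) (fun _ => hk)
      fun h => absurd h (hu _).not_gt).tendsto
    have h2 := h1.comp (tendsto_chain_sub M x i.castSucc)
    have hval : orderedFactor (M + 2) E (M + 1 - (i.castSucc : ℕ)) =
        pairFactor (M + 2) (u i.castSucc) v
          (((M + 1 - (i.castSucc : ℕ) : ℕ) : ℂ) * (Complex.I * eta (M + 2))) *
        E (((M + 1 - (i.castSucc : ℕ) : ℕ) : ℂ) * (Complex.I * eta (M + 2))) := by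
      rw [orderedFactor, if_neg (by omega), pairFactor_of_lt (hu _),
        Nat.cast_sub (by omega : 1 ≤ M + 1 - (i.castSucc : ℕ))]
      congr 3
      push_cast
      ring
    rw [hval]
    exact h2
  · have h2 := tendsto_chain_sub M x (Fin.last M)
    have h3 : Tendsto (fun y => y - (x + Complex.I * eta (M + 2)))
        (𝓝[≠] (x + Complex.I * eta (M + 2))) (𝓝 0) := by
      have : Continuous fun y : ℂ => y - (x + Complex.I * eta (M + 2)) := by fun_prop
      have h4 := this.tendsto (x + Complex.I * eta (M + 2))
      rw [sub_self] at h4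
      exact h4.mono_left nhdsWithin_le_nhds
    have h4 := (continuousAt_hsRec_zero.tendsto.comp h3).mul
      ((analyticAt_chain_lattice hE (k := M + 1 - (Fin.last M : ℕ)) (by simp)
        (by simp)).continuousAt.tendsto.comp h2)
    rw [hsRec_zero] at h4
    have h5 : orderedFactor (M + 2) E (M + 1 - (Fin.last M : ℕ)) =
        2 * E (((M + 1 - (Fin.last M : ℕ) : ℕ) : ℂ) * (Complex.I * eta (M + 2))) := by
      rw [orderedFactor, if_pos (by rw [Fin.val_last]; omega)]
    rw [h5]
    refine h4.congr' ?_
    filter_upwards [self_mem_nhdsWithin] with y hy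
    have hy' : y - (x + Complex.I * eta (M + 2)) ≠ 0 := sub_ne_zero.mpr hy
    rw [Function.comp_apply, Function.comp_apply, hsRec_of_ne hy', pairFactor_of_lt (hu _),
      show chain (M + 2) M y (Fin.last M) = y by rw [chain, Fin.val_last]; ring]
    rw [← sub_sub]
    ring

lemma tendsto_last_of_lt (hE : IsRegularPart (M + 2) E F) (x : ℂ) {u : Fin (M + 1) → Fin (M + 2)}
    {v : Fin (M + 2)} (hu : ∀ i, v < u i) :
    Tendsto (fun y => (y - (x + Complex.I * eta (M + 2))) * ∏ i : Fin (M + 1),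
        (pairFactor (M + 2) (u i) v (chain (M + 2) M y i - x) * E (chain (M + 2) M y i - x)))
      (𝓝[≠] (x + Complex.I * eta (M + 2)))
      (𝓝 (-∏ i : Fin (M + 1), orderedFactor (M + 2) E (M + 1 - i))) := by
  have hN : 2 ≤ M + 2 := by omega
  set h : ℕ → ℂ := fun k => hs (k * (Complex.I * eta (M + 2))) with hdef
  set e : ℕ → ℂ := fun k => E (k * (Complex.I * eta (M + 2))) with edef
  have hlim : -∏ i : Fin (M + 1), orderedFactor (M + 2) E (M + 1 - i) =
      -(2 * e (M + 1)) * ∏ i : Fin M, ((h (M - i + 1))⁻¹ * e (M - i)) := by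
    have e1 : e (M + 1) * ∏ i : Fin M, e (M - i) = (∏ i : Fin M, e (M + 1 - i)) * e 1 := by
      have h1 := Fin.prod_univ_succ fun i : Fin (M + 1) => e (M + 1 - i)
      rw [Fin.prod_univ_castSucc] at h1
      simp only [Fin.val_castSucc, Fin.val_last, Fin.val_zero, Fin.val_succ, Nat.sub_zero,
        Nat.add_sub_cancel_left, Nat.add_sub_add_right] at h1
      exact h1.symm
    have e2 : ∏ i : Fin M, h (M - i + 1) = ∏ i : Fin M, h (M - i) := by
      rw [← Equiv.prod_comp Fin.revPerm]
      refine Finset.prod_congr rfl fun i _ => ?_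
      rw [Fin.revPerm_apply, Fin.val_rev, hdef]
      dsimp only
      rw [← hs_reflect hN]
      congr 1
      rw [show M - (M - ((i : ℕ) + 1)) + 1 = (i : ℕ) + 2 by omega, Nat.cast_sub (by omega)]
      push_cast
      ring
    have e3 : ∀ i : Fin M, orderedFactor (M + 2) E (M + 1 - (i.castSucc : ℕ)) =
        (h (M - i))⁻¹ * e (M + 1 - i) := by
      intro i
      rw [orderedFactor, Fin.val_castSucc, if_neg (by omega),
        show M + 1 - (i : ℕ) - 1 = M - i by omega]
    rw [Fin.prod_univ_castSucc]
    simp only [e3, Finset.prod_mul_distrib, Finset.prod_inv_distrib]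
    rw [e2, orderedFactor, if_pos (by rw [Fin.val_last]; omega), Fin.val_last,
      Nat.add_sub_cancel_left]
    linear_combination 2 * (∏ i : Fin M, h (M - i))⁻¹ * e1
  rw [hlim]
  simp only [Fin.prod_univ_succ, ← mul_assoc]
  refine Tendsto.mul ?_ (tendsto_finsetProd _ fun i _ => ?_)
  · have h2 := tendsto_chain_sub M x 0
    have h3 : Tendsto (fun y => y - (x + Complex.I * eta (M + 2)))
        (𝓝[≠] (x + Complex.I * eta (M + 2))) (𝓝 0) := by
      have : Continuous fun y : ℂ => y - (x + Complex.I * eta (M + 2)) := by fun_prop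
      have h4 := this.tendsto (x + Complex.I * eta (M + 2))
      rw [sub_self] at h4
      exact h4.mono_left nhdsWithin_le_nhds
    have h4 := ((continuousAt_hsRec_zero.tendsto.comp h3).mul
      ((analyticAt_chain_lattice hE (k := M + 1 - ((0 : Fin (M + 1)) : ℕ)) (by simp)
        (by simp)).continuousAt.tendsto.comp h2)).neg
    rw [hsRec_zero] at h4
    refine h4.congr' ?_
    filter_upwards [self_mem_nhdsWithin] with y hy
    have hy' : y - (x + Complex.I * eta (M + 2)) ≠ 0 := sub_ne_zero.mpr hy
    rw [Function.comp_apply, Function.comp_apply, hsRec_of_ne hy', pairFactor_of_gt (hu _)]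
    have hz : chain (M + 2) M y 0 - x + Complex.I * eta (M + 2) =
        y - (x + Complex.I * eta (M + 2)) + 2 * Real.pi * Complex.I := by
      rw [← N_mul_I_mul_eta hN, chain, Fin.val_zero]
      push_cast
      ring
    rw [hz, hs_add_two_pi, inv_neg]
    ring
  · have h1 := (continuousAt_pairFactor_mul hE (p := u i.succ) (q := v)
      (k := M + 1 - (i.succ : ℕ)) (by rw [Fin.val_succ]; omega) (by omega)
      (fun h => absurd h (hu _).not_gt) fun _ => by rw [Fin.val_succ]; omega).tendsto
    have h2 := h1.comp (tendsto_chain_sub M x i.succ)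
    have hval : (h (M - i + 1))⁻¹ * e (M - i) = pairFactor (M + 2) (u i.succ) v
          (((M + 1 - (i.succ : ℕ) : ℕ) : ℂ) * (Complex.I * eta (M + 2))) *
        E (((M + 1 - (i.succ : ℕ) : ℕ) : ℂ) * (Complex.I * eta (M + 2))) := by
      rw [pairFactor_of_gt (hu _), hdef, edef, Fin.val_succ, Nat.add_sub_add_right]
      dsimp only
      congr 3
      push_cast
      ring
    rw [hval]
    exact h2

lemma tendsto_last_of_mem (hE : IsRegularPart (M + 2) E F) (x : ℂ) {u : Fin (M + 1) → Fin (M + 2)}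
    {v : Fin (M + 2)} (h₀ : u 0 ≤ v) (h₁ : v ≤ u (Fin.last M)) :
    Tendsto (fun y => (y - (x + Complex.I * eta (M + 2))) * ∏ i : Fin (M + 1),
        (pairFactor (M + 2) (u i) v (chain (M + 2) M y i - x) * E (chain (M + 2) M y i - x)))
      (𝓝[≠] (x + Complex.I * eta (M + 2))) (𝓝 0) := by
  have h3 : Tendsto (fun y => y - (x + Complex.I * eta (M + 2)))
      (𝓝[≠] (x + Complex.I * eta (M + 2))) (𝓝 0) := by
    have : Continuous fun y : ℂ => y - (x + Complex.I * eta (M + 2)) := by fun_prop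
    have h4 := this.tendsto (x + Complex.I * eta (M + 2))
    rw [sub_self] at h4
    exact h4.mono_left nhdsWithin_le_nhds
  rw [← zero_mul (∏ i : Fin (M + 1),
    (pairFactor (M + 2) (u i) v (((M + 1 - i : ℕ) : ℂ) * (Complex.I * eta (M + 2))) *
      E (((M + 1 - i : ℕ) : ℂ) * (Complex.I * eta (M + 2)))))]
  refine h3.mul (tendsto_finsetProd _ fun i _ => ?_)
  refine (continuousAt_pairFactor_mul hE (by omega) (by omega) ?_ ?_).tendsto.comp
    (tendsto_chain_sub M x i)
  · intro h
    by_contra hk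
    have : i = Fin.last M := Fin.ext (by rw [Fin.val_last]; omega)
    rw [this] at h
    exact h.not_ge h₁
  · intro h
    by_contra hk
    have : i = 0 := Fin.ext (by rw [Fin.val_zero]; omega)
    rw [this] at h
    exact h.not_ge h₀

lemma prod_chainFactor_of_strictMono {N m : ℕ} (E : ℂ → ℂ) {u : Fin (m + 1) → Fin N}
    (hu : StrictMono u) :
    ∏ i : Fin (m + 1), ∏ j ∈ Finset.Ioi i, chainFactor N E (m + 1) i j (u i) (u j)
      (((j - i : ℕ) : ℂ) * (Complex.I * eta N)) =
      ∏ i : Fin (m + 1), ∏ j ∈ Finset.Ioi i, orderedFactor N E (j - i) := by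
  refine Finset.prod_congr rfl fun i _ => Finset.prod_congr rfl fun j hj => ?_
  have hij : (i : ℕ) < j := Fin.lt_def.mp (Finset.mem_Ioi.mp hj)
  have hlt := hu (Finset.mem_Ioi.mp hj)
  rw [chainFactor, orderedFactor]
  split_ifs with h1 h2 h2
  · rw [residueFactor, if_pos hlt, h2, Nat.cast_one, one_mul, sub_self, hsRec_zero]
  · omega
  · omega
  · rw [pairFactor_of_lt hlt, Nat.cast_sub (by omega : 1 ≤ (j : ℕ) - i)]
    congr 3
    push_cast
    ring

lemma prod_chainFactor_of_not_strictMono {N m : ℕ} (E : ℂ → ℂ) {u : Fin (m + 1) → Fin N}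
    (hu : ¬StrictMono u) :
    ∏ i : Fin (m + 1), ∏ j ∈ Finset.Ioi i, chainFactor N E (m + 1) i j (u i) (u j)
      (((j - i : ℕ) : ℂ) * (Complex.I * eta N)) = 0 := by
  rw [Fin.strictMono_iff_lt_succ] at hu
  push Not at hu
  obtain ⟨i, hi⟩ := hu
  refine Finset.prod_eq_zero (Finset.mem_univ i.castSucc) (Finset.prod_eq_zero
    (Finset.mem_Ioi.mpr (Fin.castSucc_lt_succ (i := i))) ?_)
  rw [chainFactor, if_pos (by simp), residueFactor, if_neg hi.not_gt, Fin.val_succ,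
    Fin.val_castSucc, Nat.add_sub_cancel_left, Nat.cast_one, one_mul, sub_self, zero_mul]

lemma prod_chainFactor_chain (N m : ℕ) (E : ℂ → ℂ) (u : Fin (m + 1) → Fin N) (y : ℂ) :
    ∏ i : Fin (m + 1), ∏ j ∈ Finset.Ioi i, chainFactor N E (m + 1) i j (u i) (u j)
      (chain N m y i - chain N m y j) =
    ∏ i : Fin (m + 1), ∏ j ∈ Finset.Ioi i, chainFactor N E (m + 1) i j (u i) (u j)
      (((j - i : ℕ) : ℂ) * (Complex.I * eta N)) := by
  refine Finset.prod_congr rfl fun i _ => Finset.prod_congr rfl fun j hj => ?_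
  have hij : (i : ℕ) < j := Fin.lt_def.mp (Finset.mem_Ioi.mp hj)
  congr 1
  rw [chain, chain, Nat.cast_sub hij.le]
  ring

lemma tendsto_mul_prod_chain (hE : IsRegularPart (M + 2) E F) (x : ℂ)
    (u : Fin (M + 2) → Fin (M + 2)) :
    Tendsto (fun y => (y - (x + Complex.I * eta (M + 2))) *
        ∏ i : Fin (M + 2), ∏ j ∈ Finset.Ioi i, chainFactor (M + 2) E (M + 1) i j (u i) (u j)
          ((Fin.snoc (chain (M + 2) M y) x : Fin (M + 2) → ℂ) i -
            (Fin.snoc (chain (M + 2) M y) x : Fin (M + 2) → ℂ) j))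
      (𝓝[≠] (x + Complex.I * eta (M + 2)))
      (𝓝 (chainConstant (M + 2) E *
        ((if u = id then 1 else 0) - if u = finRotate (M + 2) then 1 else 0))) := by
  set B := ∏ i : Fin (M + 1), ∏ j ∈ Finset.Ioi i, chainFactor (M + 2) E (M + 1) i j
    (u i.castSucc) (u j.castSucc) (((j - i : ℕ) : ℂ) * (Complex.I * eta (M + 2))) with hB
  have hsplit : (fun y => (y - (x + Complex.I * eta (M + 2))) *
        ∏ i : Fin (M + 2), ∏ j ∈ Finset.Ioi i, chainFactor (M + 2) E (M + 1) i j (u i) (u j)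
          ((Fin.snoc (chain (M + 2) M y) x : Fin (M + 2) → ℂ) i -
            (Fin.snoc (chain (M + 2) M y) x : Fin (M + 2) → ℂ) j)) =
      fun y => B * ((y - (x + Complex.I * eta (M + 2))) * ∏ i : Fin (M + 1),
        (pairFactor (M + 2) (u i.castSucc) (u (Fin.last (M + 1))) (chain (M + 2) M y i - x) *
          E (chain (M + 2) M y i - x))) := by
    ext y
    rw [prod_Ioi_univ_castSucc]
    simp only [Fin.snoc_castSucc, Fin.snoc_last, Fin.val_castSucc, Fin.val_last]
    have h1 : ∀ (i : Fin (M + 1)) (z : ℂ) (p q : Fin (M + 2)),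
        chainFactor (M + 2) E (M + 1) i (M + 1) p q z = pairFactor (M + 2) p q z * E z := by
      intro i z p q
      rw [chainFactor, if_neg (by omega)]
    have h2 := prod_chainFactor_chain (M + 2) M E (fun i => u i.castSucc) y
    simp only [h1, h2]
    ring
  rw [hsplit]
  have hid : StrictMono fun i : Fin (M + 1) => i.castSucc := Fin.strictMono_castSucc
  have hrot : ∀ i : Fin (M + 1), finRotate (M + 2) i.castSucc = i.succ := fun i => by
    rw [finRotate_apply, Fin.coeSucc_eq_succ]
  by_cases hmono : StrictMono fun i : Fin (M + 1) => u i.castSucc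
  · have hBv := prod_chainFactor_of_strictMono E hmono
    rw [← hB] at hBv
    have hA : chainConstant (M + 2) E =
        B * ∏ i : Fin (M + 1), orderedFactor (M + 2) E (M + 1 - i) := by
      rw [chainConstant, prod_Ioi_univ_castSucc, hBv]
      simp only [Fin.val_castSucc, Fin.val_last]
    rcases lt_or_ge (u (Fin.last M).castSucc) (u (Fin.last (M + 1))) with hlast | hlast
    · have hu : u = id := by
        refine StrictMono.eq_id (Fin.strictMono_iff_lt_succ.mpr fun i => ?_)
        induction i using Fin.lastCases with
        | last => rwa [Fin.succ_last]
        | cast i =>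
          rw [← Fin.castSucc_succ]
          exact hmono (Fin.castSucc_lt_succ)
      have hne : u ≠ finRotate (M + 2) := by
        intro h
        have h0 := congrFun h (Fin.last (M + 1))
        rw [finRotate_last, hu] at h0
        exact absurd h0 (Fin.last_pos).ne'
      rw [if_pos hu, if_neg hne, sub_zero, mul_one, hA]
      refine (tendsto_last_of_gt hE x fun i => ?_).const_mul B
      exact lt_of_le_of_lt (hmono.monotone (Fin.le_last i)) hlast
    · rcases lt_or_ge (u (Fin.last (M + 1))) (u (0 : Fin (M + 1)).castSucc) with hzero | hzero
      · have hu : u = finRotate (M + 2) := by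
          have hc : (Fin.cons (u (Fin.last (M + 1))) fun i : Fin (M + 1) => u i.castSucc :
              Fin (M + 2) → Fin (M + 2)) = id := by
            refine StrictMono.eq_id (Fin.strictMono_iff_lt_succ.mpr fun i => ?_)
            rw [Fin.cons_succ]
            induction i using Fin.cases with
            | zero => exact hzero
            | succ i =>
              rw [← Fin.succ_castSucc, Fin.cons_succ]
              exact hmono (Fin.castSucc_lt_succ)
          ext1 i
          induction i using Fin.lastCases with
          | last =>
            rw [finRotate_last]
            exact congrFun hc 0
          | cast i =>
            rw [hrot]
            have := congrFun hc i.succ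
            rwa [Fin.cons_succ] at this
        have hne : u ≠ id := by
          intro h
          rw [h] at hlast
          exact absurd hlast (not_le.mpr (Fin.castSucc_lt_last _))
        rw [if_neg hne, if_pos hu, zero_sub, mul_neg, mul_one, hA, ← mul_neg]
        refine (tendsto_last_of_lt hE x fun i => ?_).const_mul B
        exact lt_of_lt_of_le hzero (hmono.monotone (Fin.zero_le i))
      · have hne : u ≠ id := by
          intro h
          rw [h] at hlast
          exact absurd hlast (not_le.mpr (Fin.castSucc_lt_last _))
        have hne' : u ≠ finRotate (M + 2) := by
          intro h
          rw [h, finRotate_last, hrot] at hzero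
          exact absurd hzero (not_le.mpr (Fin.succ_pos _))
        rw [if_neg hne, if_neg hne', sub_self, mul_zero, ← mul_zero B]
        exact (tendsto_last_of_mem hE x hzero hlast).const_mul B
  · have hne : u ≠ id := by
      rintro rfl
      exact hmono hid
    have hne' : u ≠ finRotate (M + 2) := by
      rintro rfl
      apply hmono
      simp only [hrot]
      exact Fin.strictMono_succ
    have hB0 : B = 0 := prod_chainFactor_of_not_strictMono E hmono
    rw [if_neg hne, if_neg hne', sub_self, mul_zero]
    simp only [hB0, zero_mul]
    exact tendsto_const_nhds

end

/-! ### The normalization constant -/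

lemma prod_Ioi_sub {n : ℕ} (g : ℕ → ℂ) :
    ∏ i : Fin n, ∏ j ∈ Finset.Ioi i, g (j - i) = ∏ k ∈ Finset.range n, g (k + 1) ^ (n - 1 - k) := by
  induction n with
  | zero => simp
  | succ n ih =>
    rw [prod_Ioi_univ_succ]
    simp only [Fin.val_succ, Fin.val_zero, Nat.sub_zero, Nat.add_sub_add_right, ih]
    rw [Fin.prod_univ_eq_prod_range (fun b => g (b + 1)), Finset.prod_range_succ,
      ← Finset.prod_mul_distrib, Nat.add_sub_cancel, Nat.sub_self, pow_zero, mul_one]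
    refine Finset.prod_congr rfl fun k hk => ?_
    have := Finset.mem_range.mp hk
    rw [← pow_succ', show n - 1 - k + 1 = n - k by omega]

lemma prod_Icc_one (n : ℕ) (f : ℕ → ℂ) :
    ∏ k ∈ Finset.Icc 1 n, f k = ∏ k ∈ Finset.range n, f (k + 1) := by
  induction n with
  | zero => simp
  | succ n ih => rw [Finset.prod_Icc_succ_top (by omega), ih, Finset.prod_range_succ]

lemma simpleResidue_phi {N : ℕ} (hN : 2 ≤ N) :
    simpleResidue (fun θ => phi N (-θ)) (Complex.I * eta N) =
      2 / hs (Complex.I * eta N) := by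
  refine Tendsto.limUnder_eq ?_
  have h1 : ContinuousAt (fun z => hsRec (z - Complex.I * eta N) / hs z) (Complex.I * eta N) := by
    refine ContinuousAt.div ?_ continuous_hs.continuousAt (hs_I_eta_ne_zero hN)
    refine ContinuousAt.comp' ?_ (by fun_prop)
    rw [sub_self]
    exact continuousAt_hsRec_zero
  have h2 := h1.tendsto.mono_left (nhdsWithin_le_nhds (s := {Complex.I * eta N}ᶜ))
  rw [sub_self, hsRec_zero] at h2
  refine h2.congr' ?_
  filter_upwards [self_mem_nhdsWithin] with z hz
  rw [hsRec_of_ne (sub_ne_zero.mpr hz), phi_neg, mul_inv]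
  ring

lemma chainConstant_eq {N : ℕ} (hN : 2 ≤ N) {E F : ℂ → ℂ} (hE : IsRegularPart N E F) :
    simpleResidue (fun θ => phi N (-θ)) (Complex.I * eta N) ^ (N - 1) *
        (∏ k ∈ Finset.Icc 1 (N - 2), phi N (k * (Complex.I * eta N)) ^ k) *
        ∏ k ∈ Finset.Icc 1 (N - 1), F (k * (Complex.I * eta N)) ^ (N - k) =
      chainConstant N E := by
  obtain ⟨M, rfl⟩ : ∃ M, N = M + 2 := ⟨N - 2, by omega⟩
  set h : ℕ → ℂ := fun k => hs (k * (Complex.I * eta (M + 2))) with hdef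
  set e : ℕ → ℂ := fun k => E (k * (Complex.I * eta (M + 2))) with edef
  have hh : ∀ k, 0 < k → k < M + 2 → h k ≠ 0 := fun k h₀ h₁ => hs_mul_ne_zero h₀ h₁
  have hrefl : ∀ k ≤ M + 2, h (M + 2 - k) = h k := by
    intro k hk
    rw [hdef]
    dsimp only
    rw [← hs_reflect hN ((k : ℂ) * _)]
    congr 1
    rw [Nat.cast_sub hk]
    ring
  have h1 : ∏ k ∈ Finset.range M, phi (M + 2) (((k + 1 : ℕ) : ℂ) * (Complex.I * eta (M + 2))) ^
      (k + 1) = ∏ k ∈ Finset.range M, ((h (k + 1) * h (k + 2))⁻¹) ^ (M - k) := by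
    rw [← Finset.prod_range_reflect]
    refine Finset.prod_congr rfl fun k hk => ?_
    have hk' := Finset.mem_range.mp hk
    rw [show M - 1 - k + 1 = M - k by omega, phi_eq]
    congr 2
    rw [mul_comm]
    congr 1
    · rw [← hrefl (k + 1) (by omega), show M + 2 - (k + 1) = M - k + 1 by omega, hdef]
      dsimp only
      congr 1
      push_cast
      ring
    · rw [← hrefl (k + 2) (by omega), show M + 2 - (k + 2) = M - k by omega]
  have h2 : ∏ k ∈ Finset.range (M + 1),
      F (((k + 1 : ℕ) : ℂ) * (Complex.I * eta (M + 2))) ^ (M + 2 - (k + 1)) =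
      (∏ k ∈ Finset.range (M + 1), h (k + 1) ^ (M + 1 - k)) *
        ∏ k ∈ Finset.range (M + 1), e (k + 1) ^ (M + 1 - k) := by
    rw [← Finset.prod_mul_distrib]
    refine Finset.prod_congr rfl fun k hk => ?_
    have hk' := Finset.mem_range.mp hk
    have hN0 : (0 : ℝ) < (M + 2 : ℕ) := by positivity
    have him := mul_I_mul_eta_im (M + 2) ((k + 1 : ℕ) : ℝ)
    rw [Complex.ofReal_natCast] at him
    rw [show M + 2 - (k + 1) = M + 1 - k by omega, ← mul_pow, hE.eq_strip]
    · rw [him]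
      positivity
    · rw [him, mul_div_assoc', div_lt_iff₀ hN0, mul_comm]
      have : ((k + 1 : ℕ) : ℝ) < (M + 2 : ℕ) := by exact_mod_cast (by omega : k + 1 < M + 2)
      exact mul_lt_mul_of_pos_left this (by positivity)
  have h3 : chainConstant (M + 2) E = 2 ^ (M + 1) * (∏ k ∈ Finset.range M, (h (k + 1))⁻¹ ^ (M - k)) *
      ∏ k ∈ Finset.range (M + 1), e (k + 1) ^ (M + 1 - k) := by
    rw [chainConstant, prod_Ioi_sub, Finset.prod_range_succ, show M + 2 - 1 - (M + 1) = 0 by omega,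
      pow_zero, mul_one]
    have : ∀ k, orderedFactor (M + 2) E (k + 1) ^ (M + 2 - 1 - k) =
        (if k = 0 then 2 else (h k)⁻¹) ^ (M + 1 - k) * e (k + 1) ^ (M + 1 - k) := by
      intro k
      rw [orderedFactor, ← mul_pow, show M + 2 - 1 - k = M + 1 - k by omega, Nat.add_sub_cancel]
      simp only [Nat.add_eq_right]
      rfl
    simp only [this, Finset.prod_mul_distrib]
    congr 1
    rw [Finset.prod_range_succ', if_pos rfl, mul_comm, Nat.sub_zero]
    simp only [Nat.add_eq_zero_iff, one_ne_zero, and_false, if_false, Nat.add_sub_add_right]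
  have h4 : (∏ k ∈ Finset.range M, ((h (k + 1) * h (k + 2))⁻¹) ^ (M - k)) *
      ∏ k ∈ Finset.range (M + 1), h (k + 1) ^ (M + 1 - k) =
      h 1 ^ (M + 1) * ∏ k ∈ Finset.range M, (h (k + 1))⁻¹ ^ (M - k) := by
    rw [Finset.prod_range_succ']
    simp only [Nat.add_sub_add_right, Nat.sub_zero, zero_add]
    rw [← mul_assoc, ← Finset.prod_mul_distrib, mul_comm]
    congr 1
    refine Finset.prod_congr rfl fun k hk => ?_
    have hk' := Finset.mem_range.mp hk
    rw [← mul_pow]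
    congr 1
    have := hh (k + 2) (by omega) (by omega)
    rw [mul_inv, show k + 1 + 1 = k + 2 from rfl]
    field_simp
  have h5 : hs (Complex.I * eta (M + 2)) = h 1 := by rw [hdef]; simp
  have h6 : h 1 ≠ 0 := hh 1 (by omega) (by omega)
  rw [prod_Icc_one, prod_Icc_one, show M + 2 - 2 = M by omega, show M + 2 - 1 = M + 1 by omega,
    simpleResidue_phi hN, h1, h2, h3, h5, div_pow]
  calc _ = 2 ^ (M + 1) / h 1 ^ (M + 1) *
        ((∏ k ∈ Finset.range M, ((h (k + 1) * h (k + 2))⁻¹) ^ (M - k)) *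
          ∏ k ∈ Finset.range (M + 1), h (k + 1) ^ (M + 1 - k)) *
        ∏ k ∈ Finset.range (M + 1), e (k + 1) ^ (M + 1 - k) := by ring
    _ = _ := by
      rw [h4]
      field_simp

/-! ### The annihilation recursion relation -/

lemma eventually_notMem_lattice {N : ℕ} (hN : 2 ≤ N) (w c : ℂ) :
    ∀ᶠ y in 𝓝[≠] w, ∀ k : ℤ, c - y ≠ Complex.I * eta N * k := by
  have h : ∀ᶠ y in 𝓝[≠] w, ∀ r : Fin N, hs (y - (c - (r : ℕ) * (Complex.I * eta N))) ≠ 0 :=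
    eventually_all.mpr fun r => eventually_hs_sub_ne_zero w _
  filter_upwards [h] with y hy k hk
  have hN0 : (0 : ℤ) < N := by exact_mod_cast (by omega : 0 < N)
  have h1 := Int.emod_nonneg k hN0.ne'
  have h2 := Int.emod_lt_of_pos k hN0
  obtain ⟨r, hr⟩ := Int.eq_ofNat_of_zero_le h1
  refine hy ⟨r, by omega⟩ (hs_eq_zero_iff.mpr ⟨-(k / N), ?_⟩)
  have h3 : (k : ℂ) = N * (k / N : ℤ) + r := by
    have := Int.mul_ediv_add_emod k N
    rw [hr] at this
    exact_mod_cast this.symm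
  rw [← N_mul_I_mul_eta hN]
  push_cast
  linear_combination -hk - Complex.I * eta N * h3

lemma append_snoc_eq_splice {m n : ℕ} (a : Fin m → ℂ) (x : ℂ) (θ : Fin n → ℂ) :
    Fin.append (Fin.snoc a x : Fin (m + 1) → ℂ) θ =
      splice a (Fin.append (Fin.snoc (fun _ => 0) x : Fin (m + 1) → ℂ) θ) := by
  ext i
  induction i using Fin.addCases with
  | left i =>
    rw [Fin.append_left]
    induction i using Fin.lastCases with
    | last => rw [splice_of_le _ _ (by simp), Fin.append_left, Fin.snoc_last, Fin.snoc_last]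
    | cast i =>
      rw [splice_of_lt _ _ (by simp), Fin.snoc_castSucc]
      rfl
  | right i =>
    rw [Fin.append_right, splice_of_le _ _ (by simp; omega), Fin.append_right]

lemma isSpectator_append_snoc {N m n : ℕ} (hN : 2 ≤ N) {x y : ℂ} {θ : Fin n → ℂ}
    (hθ : θ ∈ generic N n) (hx : ∀ i, ∀ k : ℤ, θ i - x ≠ Complex.I * eta N * k)
    (hy : ∀ i, ∀ k : ℤ, θ i - y ≠ Complex.I * eta N * k)
    (hxy : ∀ k : ℤ, x - y ≠ Complex.I * eta N * k) :
    IsSpectator N m y (Fin.append (Fin.snoc (fun _ => 0) x : Fin (m + 2) → ℂ) θ) := by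
  have hlast : ∀ i : Fin (m + 2), m + 1 ≤ (i : ℕ) → i = Fin.last (m + 1) := fun i hi =>
    Fin.ext (by rw [Fin.val_last]; omega)
  refine ⟨fun i j hi hij => ?_, fun i hi => ?_⟩
  · have hij' : (i : ℕ) < j := Fin.lt_def.mp hij
    induction j using Fin.addCases with
    | left j =>
      rw [Fin.val_castAdd] at hij'
      omega
    | right j =>
      rw [Fin.append_right]
      induction i using Fin.addCases with
      | left i =>
        rw [Fin.append_left, hlast i hi, Fin.snoc_last, ← neg_sub]
        exact (regular_of_notMem_lattice hN (hx j)).neg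
      | right i =>
        rw [Fin.append_right]
        exact regular_of_mem_generic hθ i j
  · induction i using Fin.addCases with
    | left i =>
      rw [Fin.append_left, hlast i hi, Fin.snoc_last]
      exact hxy
    | right i =>
      rw [Fin.append_right]
      exact hy i

lemma sum_labelings_append {M n : ℕ} (S : Finset (Fin (M + 2 + n) → Fin (M + 2))) (A : ℂ)
    (X : (Fin (M + 2 + n) → Fin (M + 2)) → ℂ) :
    ∑ f ∈ S, A * ((if (fun i => f (Fin.castAdd n i)) = id then 1 else 0) -
        if (fun i => f (Fin.castAdd n i)) = finRotate (M + 2) then 1 else 0) * X f =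
      A * ((∑ v : Fin n → Fin (M + 2), if Fin.append (Equiv.refl _) v ∈ S then
          X (Fin.append (Equiv.refl _) v) else 0) -
        ∑ v : Fin n → Fin (M + 2), if Fin.append (finRotate (M + 2)) v ∈ S then
          X (Fin.append (finRotate (M + 2)) v) else 0) := by
  have h : ∀ u₀ : Fin (M + 2) → Fin (M + 2),
      (∑ f ∈ S, (if (fun i => f (Fin.castAdd n i)) = u₀ then 1 else 0) * X f) =
        ∑ v : Fin n → Fin (M + 2), if Fin.append u₀ v ∈ S then X (Fin.append u₀ v) else 0 := by
    intro u₀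
    rw [← Finset.sum_filter_add_sum_filter_not S (fun f => (fun i => f (Fin.castAdd n i)) = u₀),
      ← Finset.sum_filter]
    rw [Finset.sum_eq_zero (s := S.filter fun f => ¬(fun i => f (Fin.castAdd n i)) = u₀), add_zero]
    · refine Finset.sum_bij' (fun f _ => fun i => f (Fin.natAdd (M + 2) i))
        (fun v _ => Fin.append u₀ v) ?_ ?_ ?_ ?_ ?_
      · intro f hf
        rw [Finset.mem_filter] at hf ⊢
        refine ⟨Finset.mem_univ _, ?_⟩
        rw [← hf.2, Fin.append_castAdd_natAdd]
        exact hf.1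
      · intro v hv
        rw [Finset.mem_filter] at hv ⊢
        exact ⟨hv.2, by simp⟩
      · intro f hf
        rw [Finset.mem_filter] at hf
        rw [← hf.2, Fin.append_castAdd_natAdd]
      · intro v _
        simp
      · intro f hf
        rw [Finset.mem_filter] at hf
        rw [if_pos hf.2, one_mul, ← hf.2, Fin.append_castAdd_natAdd]
    · intro f hf
      rw [if_neg (Finset.mem_filter.mp hf).2, zero_mul]
  have h1 := h id
  have h2 := h (finRotate (M + 2))
  rw [Equiv.coe_refl, ← h1, ← h2, ← Finset.sum_sub_distrib, Finset.mul_sum]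
  refine Finset.sum_congr rfl fun f _ => ?_
  ring

lemma chain_sub_notMem_lattice {M : ℕ} {x θ : ℂ}
    (hx : ∀ k : ℤ, θ - x ≠ Complex.I * eta (M + 2) * k) (i : Fin (M + 2)) (k : ℤ) :
    chain (M + 2) (M + 1) x i - θ ≠ Complex.I * eta (M + 2) * k := by
  intro h
  apply hx ((M + 1 : ℕ) - (i : ℕ) - k)
  rw [chain] at h
  push_cast at h ⊢
  linear_combination -h

lemma prod_cross_id {M n : ℕ} {E F : ℂ → ℂ} (hE : IsRegularPart (M + 2) E F) {x : ℂ}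
    {θ : Fin n → ℂ} (hx : ∀ b, ∀ k : ℤ, θ b - x ≠ Complex.I * eta (M + 2) * k)
    (v : Fin n → Fin (M + 2)) :
    ∏ i : Fin (M + 2), ∏ b, (pairFactor (M + 2) i (v b) (chain (M + 2) (M + 1) x i - θ b) *
      E (chain (M + 2) (M + 1) x i - θ b)) = 1 := by
  rw [Finset.prod_comm]
  refine Finset.prod_eq_one fun b _ => ?_
  have hw : ∀ k : ℤ, x - θ b ≠ Complex.I * eta (M + 2) * k := by
    intro k hk
    apply hx b (-k)
    push_cast
    linear_combination -hk
  rw [← prod_chain_id (by omega) hE hw (v b)]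
  refine Finset.prod_congr rfl fun i _ => ?_
  rw [chain_eq, add_sub_right_comm]

lemma prod_cross_rotate {M n : ℕ} {E F : ℂ → ℂ} (hE : IsRegularPart (M + 2) E F) {x : ℂ}
    {θ : Fin n → ℂ} (hx : ∀ b, ∀ k : ℤ, θ b - x ≠ Complex.I * eta (M + 2) * k)
    (v : Fin n → Fin (M + 2)) :
    ∏ i : Fin (M + 2), ∏ b, (pairFactor (M + 2) (finRotate (M + 2) i) (v b)
      (chain (M + 2) (M + 1) x i - θ b) * E (chain (M + 2) (M + 1) x i - θ b)) =
      ∏ b, smatrix (M + 2) (x - θ b) := by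
  rw [Finset.prod_comm]
  refine Finset.prod_congr rfl fun b _ => ?_
  have hw : ∀ k : ℤ, x - θ b ≠ Complex.I * eta (M + 2) * k := by
    intro k hk
    apply hx b (-k)
    push_cast
    linear_combination -hk
  rw [← prod_chain_rotate hE hw (v b)]
  refine Finset.prod_congr rfl fun i _ => ?_
  rw [chain_eq, add_sub_right_comm]

lemma tendsto_mul_chainSum {M n : ℕ} {E F : ℂ → ℂ} (hE : IsRegularPart (M + 2) E F) (Q : ℕ)
    {Qt : ℕ} (hQt : Qt < M + 2) {x : ℂ} {θ : Fin n → ℂ}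
    (hx : ∀ b, ∀ k : ℤ, θ b - x ≠ Complex.I * eta (M + 2) * k) :
    Tendsto (fun y => (y - (x + Complex.I * eta (M + 2))) *
        chainSum (M + 2) Q Qt M (M + 2 + n) E
          (Fin.append (Fin.snoc (chain (M + 2) M y) x : Fin (M + 2) → ℂ) θ))
      (𝓝[≠] (x + Complex.I * eta (M + 2)))
      (𝓝 (chainConstant (M + 2) E *
        ((1 - statistics (M + 2) Qt * ∏ b, smatrix (M + 2) (x - θ b)) *
          ∑ v ∈ labelings (M + 2) n (multiplicity (M + 2) Q n), labelValue (M + 2) Qt n θ v *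
            ∏ a, ∏ b ∈ Finset.Ioi a,
              (pairFactor (M + 2) (v a) (v b) (θ a - θ b) * E (θ a - θ b))))) := by
  have hN : 2 ≤ M + 2 := by omega
  set X : (Fin (M + 2 + n) → Fin (M + 2)) → ℂ → ℂ := fun f y =>
    labelValue (M + 2) Qt (M + 2 + n)
        (Fin.append (Fin.snoc (chain (M + 2) M y) x : Fin (M + 2) → ℂ) θ) f *
      (∏ i : Fin (M + 2), ∏ b : Fin n,
        (pairFactor (M + 2) (f (Fin.castAdd n i)) (f (Fin.natAdd (M + 2) b))
            ((Fin.snoc (chain (M + 2) M y) x : Fin (M + 2) → ℂ) i - θ b) *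
          E ((Fin.snoc (chain (M + 2) M y) x : Fin (M + 2) → ℂ) i - θ b))) *
      ∏ a : Fin n, ∏ b ∈ Finset.Ioi a,
        (pairFactor (M + 2) (f (Fin.natAdd (M + 2) a)) (f (Fin.natAdd (M + 2) b)) (θ a - θ b) *
          E (θ a - θ b)) with hX
  have hterm : ∀ y, (y - (x + Complex.I * eta (M + 2))) *
        chainSum (M + 2) Q Qt M (M + 2 + n) E
          (Fin.append (Fin.snoc (chain (M + 2) M y) x : Fin (M + 2) → ℂ) θ) =
      ∑ f ∈ labelings (M + 2) (M + 2 + n) (multiplicity (M + 2) Q (M + 2 + n)),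
        (y - (x + Complex.I * eta (M + 2))) * (∏ i : Fin (M + 2), ∏ j ∈ Finset.Ioi i,
          chainFactor (M + 2) E (M + 1) i j (f (Fin.castAdd n i)) (f (Fin.castAdd n j))
            ((Fin.snoc (chain (M + 2) M y) x : Fin (M + 2) → ℂ) i -
              (Fin.snoc (chain (M + 2) M y) x : Fin (M + 2) → ℂ) j)) * X f y := by
    intro y
    rw [chainSum, Finset.mul_sum]
    refine Finset.sum_congr rfl fun f _ => ?_
    rw [prod_Ioi_univ_add, hX]
    simp only [Fin.append_left, Fin.append_right, Fin.val_castAdd, Fin.val_natAdd]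
    have h1 : ∀ (a : ℕ) (b : ℕ) (p q : Fin (M + 2)) (z : ℂ),
        chainFactor (M + 2) E (M + 1) a (M + 2 + b) p q z = pairFactor (M + 2) p q z * E z := by
      intro a b p q z
      rw [chainFactor, if_neg (by omega)]
    simp only [h1]
    ring
  have hcont : Continuous fun y => (Fin.snoc (chain (M + 2) M y) x : Fin (M + 2) → ℂ) :=
    (continuous_snoc x).comp (continuous_chain (M + 2) M)
  have hcont' : Continuous fun y =>
      Fin.append (Fin.snoc (chain (M + 2) M y) x : Fin (M + 2) → ℂ) θ := by
    refine continuous_pi fun i => ?_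
    induction i using Fin.addCases with
    | left i =>
      simp only [Fin.append_left]
      exact (continuous_apply i).comp hcont
    | right i =>
      simp only [Fin.append_right]
      exact continuous_const
  have hXlim : ∀ f, Tendsto (X f) (𝓝[≠] (x + Complex.I * eta (M + 2)))
      (𝓝 (X f (x + Complex.I * eta (M + 2)))) := by
    intro f
    refine Tendsto.mono_left ?_ nhdsWithin_le_nhds
    refine ContinuousAt.tendsto (ContinuousAt.mul (ContinuousAt.mul ?_ ?_) continuousAt_const)
    · exact ContinuousAt.comp (f := fun y =>
        Fin.append (Fin.snoc (chain (M + 2) M y) x : Fin (M + 2) → ℂ) θ)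
        (analyticAt_labelValue f _).continuousAt hcont'.continuousAt
    · refine tendsto_finsetProd _ fun i _ => tendsto_finsetProd _ fun b _ => ?_
      have hreg : Regular (M + 2) ((Fin.snoc (chain (M + 2) M (x + Complex.I * eta (M + 2))) x :
          Fin (M + 2) → ℂ) i - θ b) := by
        rw [snoc_chain]
        exact regular_of_notMem_lattice hN (chain_sub_notMem_lattice (hx b) i)
      exact ContinuousAt.comp (f := fun y =>
        (Fin.snoc (chain (M + 2) M y) x : Fin (M + 2) → ℂ) i - θ b)
        (((analyticAt_pairFactor _ _ hreg).mul (hE.analyticAt _ hreg)).continuousAt)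
        (((continuous_apply i).comp hcont).sub continuous_const).continuousAt
  have hlim := tendsto_finsetSum
    (labelings (M + 2) (M + 2 + n) (multiplicity (M + 2) Q (M + 2 + n))) fun f _ =>
      (tendsto_mul_prod_chain hE x fun i => f (Fin.castAdd n i)).mul (hXlim f)
  rw [sum_labelings_append] at hlim
  simp only [append_mem_labelings hN] at hlim
  simp only [hterm]
  convert hlim using 2
  rw [← Finset.sum_filter, ← Finset.sum_filter, Finset.filter_mem_eq_inter,
    Finset.univ_inter, hX]
  simp only [Fin.append_left, Fin.append_right, snoc_chain, labelValue_append hN,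
    chainValue_id hQt, chainValue_rotate hQt, prod_cross_rotate hE hx, Equiv.refl_apply,
    prod_cross_id hE hx]
  rw [sub_mul, Finset.mul_sum, Finset.mul_sum]
  congr 2
  · refine Finset.sum_congr rfl fun v _ => ?_
    ring
  · refine Finset.sum_congr rfl fun v _ => ?_
    ring

lemma formFactor_recursion {N : ℕ} (hN : 2 ≤ N) {E F : ℂ → ℂ} (hE : IsRegularPart N E F)
    {Q Qt : ℕ} (hQt : Qt < N) {c : ℕ → ℂ} (hc : NormalizationRelation N Q F c) (n : ℕ) (x : ℂ)
    {θ : Fin n → ℂ} (hθ : θ ∈ generic N n)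
    (hx : ∀ i, ∀ k : ℤ, θ i - x ≠ Complex.I * eta N * k) :
    HasIteratedResidue N N (fun a => formFactor N F Q Qt c (N + n) (Fin.append a θ)) x
      (2 * Complex.I * formFactor N F Q Qt c n θ *
        (1 - statistics N Qt * ∏ i, smatrix N (x - θ i)) *
        ∏ α ∈ Finset.Icc 1 (N - 2), (Real.sqrt 2 : ℂ) * intertwiner N α) := by
  by_cases hn : n % N = Q
  swap
  · have hn' : (N + n) % N ≠ Q := by rwa [Nat.add_mod_left]
    obtain ⟨m, rfl⟩ : ∃ m, N = m + 1 := ⟨N - 1, by omega⟩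
    simp only [formFactor_of_ne hn, formFactor_of_ne hn', Pi.zero_apply, mul_zero, zero_mul]
    exact hasIteratedResidue_zero _ m x
  have hc' := hc n hn
  rw [chainConstant_eq hN hE] at hc'
  have hval : 2 * Complex.I * formFactor N F Q Qt c n θ *
        (1 - statistics N Qt * ∏ i, smatrix N (x - θ i)) *
        ∏ α ∈ Finset.Icc 1 (N - 2), (Real.sqrt 2 : ℂ) * intertwiner N α =
      c (N + n) * (chainConstant N E *
        ((1 - statistics N Qt * ∏ b, smatrix N (x - θ b)) *
          ∑ v ∈ labelings N n (multiplicity N Q n), labelValue N Qt n θ v *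
            ∏ a, ∏ b ∈ Finset.Ioi a, (pairFactor N (v a) (v b) (θ a - θ b) * E (θ a - θ b)))) := by
    rw [formFactor_eq_sum hN hE Q Qt c hn hθ, ← mul_assoc (c (N + n)), hc']
    ring
  rw [hval]
  obtain ⟨M, rfl⟩ : ∃ M, N = M + 2 := ⟨N - 2, by omega⟩
  refine ⟨fun y => c (M + 2 + n) * chainSum (M + 2) Q Qt M (M + 2 + n) E
    (Fin.append (Fin.snoc (chain (M + 2) M y) x : Fin (M + 2) → ℂ) θ), ?_, ?_⟩
  · filter_upwards [eventually_notMem_lattice hN (x + Complex.I * eta (M + 2)) x,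
      eventually_all.mpr fun i => eventually_notMem_lattice hN (x + Complex.I * eta (M + 2)) (θ i)]
      with y hxy hy
    have hmod : (M + 2 + n) % (M + 2) = Q := by rwa [Nat.add_mod_left]
    have h := hasIteratedResidue_formFactor hN (by omega)
      (isSpectator_append_snoc hN hθ hx hy hxy (m := M)) hE (by omega) Q Qt c hmod
    rw [← append_snoc_eq_splice] at h
    have hfun : (fun a : Fin (M + 1) → ℂ => formFactor (M + 2) F Q Qt c (M + 2 + n)
        (splice a (Fin.append (Fin.snoc (fun _ => 0) x : Fin (M + 2) → ℂ) θ))) =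
        fun a => formFactor (M + 2) F Q Qt c (M + 2 + n)
          (Fin.append (Fin.snoc a x : Fin (M + 2) → ℂ) θ) := by
      ext a
      rw [append_snoc_eq_splice a x θ]
    rw [hfun] at h
    exact h
  · have h := (tendsto_mul_chainSum hE Q hQt hx).const_mul (c (M + 2 + n))
    refine h.congr fun y => ?_
    ring

/-! ### The p-functions -/

lemma analyticOnNhd_pFunction (N Qt n : ℕ) (m : Fin (N - 1) → ℕ) :
    AnalyticOnNhd ℂ (fun x : (Fin n → ℂ) × ((k : Fin (N - 1)) → Fin (m k) → ℂ) =>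
      pFunction N Qt n m x.1 x.2) Set.univ := by
  intro x _
  unfold pFunction
  refine analyticAt_const.mul (AnalyticAt.cexp (AnalyticAt.sub
    (Finset.analyticAt_fun_sum _ fun k _ => ?_)
    (analyticAt_const.mul (Finset.analyticAt_fun_sum _ fun i _ => ?_))))
  · split_ifs
    · refine Finset.analyticAt_fun_sum _ fun j _ => ?_
      exact ((ContinuousLinearMap.proj (R := ℂ) (φ := fun _ : Fin (m k) => ℂ) j).comp
        ((ContinuousLinearMap.proj (R := ℂ) (φ := fun k => Fin (m k) → ℂ) k).comp
          (ContinuousLinearMap.snd ℂ (Fin n → ℂ) ((k : Fin (N - 1)) → Fin (m k) → ℂ)))).analyticAt x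
    · exact analyticAt_const
  · exact ((ContinuousLinearMap.proj (R := ℂ) (φ := fun _ : Fin n => ℂ) i).comp
      (ContinuousLinearMap.fst ℂ (Fin n → ℂ) ((k : Fin (N - 1)) → Fin (m k) → ℂ))).analyticAt x

lemma pFunction_append {N : ℕ} (hN : 2 ≤ N) (Qt n : ℕ) (m : Fin (N - 1) → ℕ) (a : Fin N → ℂ)
    (θ : Fin n → ℂ) (b : Fin (N - 1) → ℂ) (z : (k : Fin (N - 1)) → Fin (m k) → ℂ) :
    pFunction N Qt (N + n) (fun k => m k + 1) (Fin.append a θ) (fun k => Fin.cons (b k) (z k)) =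
      Complex.exp (Complex.I * Real.pi / N * ((Qt : ℂ) * ((Qt : ℂ) - N + 2))) *
        Complex.exp ((∑ k : Fin (N - 1), if (k : ℕ) < Qt then b k else 0) -
          (Qt : ℂ) / N * ∑ i, a i) * pFunction N Qt n m θ z := by
  have h : (∑ k : Fin (N - 1), if (k : ℕ) < Qt then
        ∑ j, (Fin.cons (b k) (z k) : Fin (m k + 1) → ℂ) j else 0) =
      (∑ k : Fin (N - 1), if (k : ℕ) < Qt then b k else 0) +
        ∑ k : Fin (N - 1), if (k : ℕ) < Qt then ∑ j, z k j else 0 := by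
    rw [← Finset.sum_add_distrib]
    refine Finset.sum_congr rfl fun k _ => ?_
    split_ifs
    · rw [Fin.sum_univ_succ]
      simp
    · rw [add_zero]
  rw [pFunction, pFunction, h, rho_add hN, Fin.sum_univ_add]
  simp only [Fin.append_left, Fin.append_right]
  rw [show ∀ A B C D : ℂ, A * B * (C * D) = A * C * (B * D) from fun A B C D => by ring,
    ← Complex.exp_add]
  congr 2
  ring

lemma eq_of_sub_eq {N : ℕ} (hN : 2 ≤ N) {a : Fin N → ℂ}
    (ha : ∀ k : Fin (N - 1), a ⟨k, by omega⟩ - a ⟨k + 1, by omega⟩ = Complex.I * eta N)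
    (i : Fin N) :
    a i = a ⟨N - 1, by omega⟩ + ((N : ℂ) - 1 - (i : ℕ)) * (Complex.I * eta N) := by
  obtain ⟨d, hd⟩ : ∃ d, (i : ℕ) + d = N - 1 := ⟨N - 1 - i, by omega⟩
  induction d generalizing i with
  | zero =>
    have hi : i = ⟨N - 1, by omega⟩ := Fin.ext (by simpa using hd)
    have hN' : (N : ℂ) = (i : ℕ) + 1 := by exact_mod_cast (by omega : N = (i : ℕ) + 1)
    rw [← hi, hN']
    ring
  | succ d ih =>
    have h1 := ha ⟨i, by omega⟩
    have h2 := ih ⟨i + 1, by omega⟩ (by simp; omega)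
    simp only at h1 h2
    rw [h2] at h1
    push_cast at h1
    have h3 : a i = a ⟨i, by omega⟩ := rfl
    linear_combination h1

lemma pFunction_recursion {N : ℕ} (hN : 2 ≤ N) {Qt : ℕ} (hQt : Qt < N) (n : ℕ)
    (m : Fin (N - 1) → ℕ) (a : Fin N → ℂ) (θ : Fin n → ℂ)
    (z : (k : Fin (N - 1)) → Fin (m k) → ℂ)
    (ha : ∀ k : Fin (N - 1), a ⟨k, by omega⟩ - a ⟨k + 1, by omega⟩ = Complex.I * eta N) :
    pFunction N Qt (N + n) (fun k => m k + 1) (Fin.append a θ)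
        (fun k => Fin.cons (a ⟨k, by omega⟩) (z k)) = statistics N Qt * pFunction N Qt n m θ z ∧
      pFunction N Qt (N + n) (fun k => m k + 1) (Fin.append a θ)
        (fun k => Fin.cons (a ⟨k + 1, by omega⟩) (z k)) = pFunction N Qt n m θ z := by
  set x := a ⟨N - 1, by omega⟩ with hx
  set g : ℕ → ℂ := fun i => x + ((N : ℂ) - 1 - i) * (Complex.I * eta N) with hg
  have hag : ∀ i : Fin N, a i = g i := eq_of_sub_eq hN ha
  have hsum : ∑ i, a i = ∑ i ∈ Finset.range N, g i := by
    rw [← Fin.sum_univ_eq_sum_range]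
    exact Finset.sum_congr rfl fun i _ => hag i
  have h1 := sum_fin_ite_lt (K := N - 1) (Qt := Qt) (by omega) g
  have h2 := sum_fin_ite_lt (K := N - 1) (Qt := Qt) (by omega) fun i => g (i + 1)
  rw [pFunction_append hN, pFunction_append hN, hsum]
  simp only [hag, h1, h2]
  rw [exp_chain hN Qt (g := g) (x := x) fun _ => rfl,
    exp_chain_shift hN Qt (g := g) (x := x) fun _ => rfl, one_mul]
  exact ⟨rfl, rfl⟩

lemma isPFunction {N Q Qt : ℕ} (hN : 2 ≤ N) (hQt : Qt < N) :
    IsPFunction N Q (statistics N Qt) (spin N Q Qt) (pFunction N Qt) where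
  analytic n m _ := analyticOnNhd_pFunction N Qt n m
  symmetric n m _ i j θ z := by
    rw [pFunction, pFunction]
    congr 4
    exact Equiv.sum_comp (Equiv.swap i j) θ
  periodic n m _ x θ z := by
    have h := exp_mul_statistics (N := N) Qt
    rw [pFunction, pFunction, Fin.sum_univ_succ, Fin.sum_univ_succ]
    simp only [Fin.cons_zero, Fin.cons_succ]
    rw [show ∀ A B : ℂ, A - (Qt : ℂ) / N * (x + 2 * Real.pi * Complex.I + B) =
      A - (Qt : ℂ) / N * (x + B) + -((Qt : ℂ) / N * (2 * Real.pi * Complex.I)) from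
        fun A B => by ring, Complex.exp_add]
    rw [show ∀ A B C D : ℂ, A * (B * (C * D)) = B * C * (D * A) from fun A B C D => by ring, h,
      mul_one]
  recursion n m _ a θ z ha := by
    obtain ⟨h1, h2⟩ := pFunction_recursion hN hQt n m a θ z ha
    exact ⟨by rw [h1, h2], h1⟩
  lorentz n m hm μ θ z := by
    obtain ⟨hn, rfl⟩ := hm
    have h : (∑ k : Fin (N - 1), if (k : ℕ) < Qt then ∑ j, (z k j + μ) else 0) =
        (∑ k : Fin (N - 1), if (k : ℕ) < Qt then ∑ j, z k j else 0) +
          ((Qt * (n / N) + min Q Qt : ℕ) : ℂ) * μ := by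
      rw [← sum_multiplicity hQt, Nat.cast_sum, Finset.sum_mul, ← Finset.sum_add_distrib]
      refine Finset.sum_congr rfl fun k _ => ?_
      split_ifs
      · rw [Finset.sum_add_distrib, Finset.sum_const, Finset.card_univ, Fintype.card_fin,
          nsmul_eq_mul]
      · simp
    rw [pFunction, pFunction, h, mul_left_comm, ← Complex.exp_add, ← spin_eq hN hn,
      Finset.sum_add_distrib, Finset.sum_const, Finset.card_univ, Fintype.card_fin, nsmul_eq_mul]
    congr 2
    ring

/-! ### The form factor equations -/

lemma exists_normalization {N : ℕ} (hN : 2 ≤ N) {E F : ℂ → ℂ} (hE : IsRegularPart N E F) {Q : ℕ}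
    (hQ : Q < N) (c₀ : ℂ) : ∃ c : ℕ → ℂ, c Q = c₀ ∧ NormalizationRelation N Q F c := by
  refine ⟨fun n => c₀ * ((2 * Complex.I *
    ∏ α ∈ Finset.Icc 1 (N - 2), (Real.sqrt 2 : ℂ) * intertwiner N α) / chainConstant N E) ^
      (n / N), ?_, fun n _ => ?_⟩
  · dsimp only
    rw [Nat.div_eq_of_lt hQ, pow_zero, mul_one]
  · have hK := chainConstant_ne_zero hE
    dsimp only
    rw [chainConstant_eq hN hE, Nat.add_div_left _ (by omega), pow_succ]
    field_simp

lemma isFormFactorFamily {N : ℕ} (hN : 2 ≤ N) {E F : ℂ → ℂ} (hE : IsRegularPart N E F)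
    {Q Qt : ℕ} (hQt : Qt < N) {c : ℕ → ℂ} (hc : NormalizationRelation N Q F c) :
    IsFormFactorFamily N Q (statistics N Qt) (spin N Q Qt) (formFactor N F Q Qt c) where
  charge _ hn := formFactor_of_ne hn
  analytic n := analyticOnNhd_formFactor hN hE Q Qt c n
  meromorphic n θ := isMeromorphicAt_formFactor hN hE Q Qt c n θ
  watson n i hi _ hθ := formFactor_watson hN hE Q Qt c n i hi hθ
  crossing n x θ h := formFactor_crossing hN hE Q Qt c n x θ h
  boundState _ _ h₀ h₁ x _ hθ hx := formFactor_boundState hN hE Q Qt c h₀ h₁ x hθ hx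
  recursion n x _ hθ hx := formFactor_recursion hN hE hQt hc n x hθ hx
  lorentz n μ _ hθ := formFactor_lorentz hN hE hQt c n μ hθ

lemma statistics_zero (N : ℕ) : statistics N 0 = 1 := pow_zero _

lemma spin_zero_right (N Q : ℕ) : spin N Q 0 = 0 := by simp [spin]

lemma spin_zero_left (N Qt : ℕ) : spin N 0 Qt = 0 := by simp [spin]

lemma spin_self {N : ℕ} (hN : 2 ≤ N) (Q : ℕ) : spin N Q Q = (Q : ℂ) * ((N : ℂ) - Q) / N := by
  have hN0 : (N : ℂ) ≠ 0 := by
    rw [Nat.cast_ne_zero]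
    omega
  rw [spin, min_self]
  field_simp

/-! ### Labelings with a single particle for each label -/

/-- The labeling by `1, …, Q`. -/
def standardLabeling {N Q : ℕ} (hQ : Q < N) (i : Fin Q) : Fin N := ⟨i + 1, by omega⟩

lemma standardLabeling_mem {N Q : ℕ} (hQ : Q < N) :
    standardLabeling hQ ∈ labelings N Q (multiplicity N Q Q) := by
  rw [mem_labelings]
  intro k
  rw [multiplicity, Nat.div_eq_of_lt hQ, zero_add]
  split_ifs with h
  · rw [Finset.card_eq_one]
    refine ⟨⟨k, h⟩, ?_⟩
    ext a
    rw [mem_labelFiber, Finset.mem_singleton, standardLabeling, Fin.ext_iff]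
    simp
  · rw [Finset.card_eq_zero]
    ext a
    rw [mem_labelFiber, standardLabeling]
    simp only [Finset.notMem_empty, iff_false]
    omega

lemma label_bounds {N Q : ℕ} (hQ : Q < N) {f : Fin Q → Fin N}
    (hf : f ∈ labelings N Q (multiplicity N Q Q)) (a : Fin Q) : 0 < (f a : ℕ) ∧ (f a : ℕ) ≤ Q := by
  have h := card_label_le hQ hf
  rw [Nat.div_eq_of_lt hQ, mul_zero, zero_add, min_self, ← Finset.sum_filter, Finset.sum_const,
    nsmul_eq_mul, mul_one, Nat.cast_inj] at h
  have h1 := Finset.eq_univ_of_card _ (h.trans (Fintype.card_fin Q).symm)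
  have h2 := Finset.mem_univ a
  rw [← h1, Finset.mem_filter] at h2
  exact h2.2

lemma label_injective {N Q : ℕ} (hQ : Q < N) {f : Fin Q → Fin N}
    (hf : f ∈ labelings N Q (multiplicity N Q Q)) : Function.Injective f := by
  intro a b hab
  obtain ⟨h0, h1⟩ := label_bounds hQ hf a
  have hk := mem_labelings.mp hf ⟨f a - 1, by omega⟩
  have h2 : (labelFiber f ⟨f a - 1, by omega⟩).card ≤ 1 := by
    rw [hk, multiplicity, Nat.div_eq_of_lt hQ]
    split_ifs <;> omega
  refine Finset.card_le_one.mp h2 a ?_ b ?_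
  · rw [mem_labelFiber]
    simp only
    omega
  · rw [mem_labelFiber, ← hab]
    simp only
    omega

lemma eq_standardLabeling {N Q : ℕ} (hQ : Q < N) {f : Fin Q → Fin N}
    (hf : f ∈ labelings N Q (multiplicity N Q Q)) (hmono : StrictMono f) :
    f = standardLabeling hQ := by
  have hb := label_bounds hQ hf
  have h : StrictMono fun a : Fin Q => (⟨f a - 1, by have := hb a; omega⟩ : Fin Q) := by
    intro a b hab
    have h1 := Fin.lt_def.mp (hmono hab)
    have h2 := hb a
    rw [Fin.lt_def]
    simp only
    omega
  ext a
  have h1 := congrArg Fin.val (h.apply_eq (x := a))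
  have h2 := hb a
  simp only at h1
  rw [standardLabeling]
  simp only
  omega

/-! ### Explicit form factors -/

lemma orderFormFactor_one {N : ℕ} (hN : 2 ≤ N) {E F : ℂ → ℂ} (hE : IsRegularPart N E F)
    (c : ℕ → ℂ) (θ : Fin 1 → ℂ) : orderFormFactor N F 1 c 1 θ = c 1 := by
  have hQ : 1 < N := by omega
  have hgen : θ ∈ generic N 1 := mem_generic_of_lt hN fun i j hij => by omega
  have hlab : labelings N 1 (multiplicity N 1 1) = {standardLabeling hQ} := by
    ext f
    rw [Finset.mem_singleton]
    refine ⟨fun hf => eq_standardLabeling hQ hf (Subsingleton.strictMono f), ?_⟩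
    rintro rfl
    exact standardLabeling_mem hQ
  rw [orderFormFactor, formFactor_eq_sum hN hE 1 0 c (Nat.mod_eq_of_lt hQ) hgen, hlab,
    Finset.sum_singleton, prod_Ioi_univ_succ]
  simp [labelValue, rho, standardLabeling]

lemma cosh_half_ne_zero {N : ℕ} (hN : 3 ≤ N) : Complex.cosh (Complex.I * eta N / 2) ≠ 0 := by
  have h := hs_mul_ne_zero (N := N) (k := 2) (by omega) (by omega)
  intro h0
  apply h
  rw [hs, show ((2 : ℕ) : ℂ) * (Complex.I * eta N) / 2 = 2 * (Complex.I * eta N / 2) by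
    push_cast; ring, Complex.sinh_two_mul, h0, mul_zero]

lemma labelings_two {N : ℕ} (hN : 3 ≤ N) : labelings N 2 (multiplicity N 2 2) =
    {![⟨1, by omega⟩, ⟨2, by omega⟩], ![⟨2, by omega⟩, ⟨1, by omega⟩]} := by
  have hQ : 2 < N := by omega
  have hstd : standardLabeling hQ = ![⟨1, by omega⟩, ⟨2, by omega⟩] := by
    ext i
    fin_cases i <;> rfl
  ext f
  rw [Finset.mem_insert, Finset.mem_singleton]
  constructor
  · intro hf
    have h0 := label_bounds hQ hf 0
    have h1 := label_bounds hQ hf 1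
    have hne : (f 0 : ℕ) ≠ f 1 := fun h => absurd (label_injective hQ hf (Fin.ext h)) (by simp)
    rcases (by omega : (f 0 : ℕ) = 1 ∧ (f 1 : ℕ) = 2 ∨ (f 0 : ℕ) = 2 ∧ (f 1 : ℕ) = 1) with h | h
    · left
      ext i
      fin_cases i
      · exact h.1
      · exact h.2
    · right
      ext i
      fin_cases i
      · exact h.1
      · exact h.2
  · have hmem := standardLabeling_mem hQ
    rintro (rfl | rfl)
    · rwa [← hstd]
    · rw [← comp_perm_mem_labelings (Equiv.swap 0 1)]
      convert hmem using 1
      ext i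
      fin_cases i <;> rfl

lemma formFactor_two {N : ℕ} (hN : 3 ≤ N) {E F : ℂ → ℂ} (hE : IsRegularPart N E F) (Qt : ℕ)
    (c : ℕ → ℂ) {θ : Fin 2 → ℂ} (hθ : θ ∈ generic N 2) {A : ℂ}
    (hA : ∀ f ∈ labelings N 2 (multiplicity N 2 2), labelValue N Qt 2 θ f = A) :
    formFactor N F 2 Qt c 2 θ = c 2 * (2 * Complex.cosh (Complex.I * eta N / 2)) *
      (A * F (θ 0 - θ 1) / (Complex.sinh ((θ 0 - θ 1 - 2 * Real.pi * Complex.I / N) / 2) *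
        Complex.sinh ((θ 0 - θ 1 + 2 * Real.pi * Complex.I / N) / 2))) := by
  have hreg := regular_of_mem_generic hθ 0 1
  have hc : 2 * Real.pi * Complex.I / N = Complex.I * eta N := by
    rw [eta]
    ring
  have h12 : (⟨1, by omega⟩ : Fin N) < ⟨2, by omega⟩ := by simp
  have hne : (![⟨1, by omega⟩, ⟨2, by omega⟩] : Fin 2 → Fin N) ≠ ![⟨2, by omega⟩, ⟨1, by omega⟩] :=
    fun h => absurd (congrFun h 0) (by simp)
  have hprod : ∀ f : Fin 2 → Fin N, ∏ i, ∏ j ∈ Finset.Ioi i,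
      (pairFactor N (f i) (f j) (θ i - θ j) * E (θ i - θ j)) =
      pairFactor N (f 0) (f 1) (θ 0 - θ 1) * E (θ 0 - θ 1) := by
    intro f
    rw [prod_Ioi_univ_succ]
    simp
  rw [formFactor_eq_sum (by omega) hE 2 Qt c (Nat.mod_eq_of_lt hN) hθ,
    Finset.sum_congr rfl fun f hf => by rw [hA f hf, hprod f], labelings_two hN,
    Finset.sum_pair hne]
  simp only [Matrix.cons_val_zero, Matrix.cons_val_one]
  rw [pairFactor_of_lt h12, pairFactor_of_gt h12, hE.eq_regular _ hreg, hc]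
  obtain ⟨h1, h2⟩ := hreg
  have hadd : hs (θ 0 - θ 1 + Complex.I * eta N) + hs (θ 0 - θ 1 - Complex.I * eta N) =
      2 * hs (θ 0 - θ 1) * Complex.cosh (Complex.I * eta N / 2) := by
    rw [hs, hs, hs, add_div, sub_div (θ 0 - θ 1), Complex.sinh_add, Complex.sinh_sub]
    ring
  change _ = _ * (_ / (hs (θ 0 - θ 1 - Complex.I * eta N) * hs (θ 0 - θ 1 + Complex.I * eta N)))
  field_simp
  linear_combination c 2 * A * E (θ 0 - θ 1) * hadd

lemma rho_ne_zero (N Qt n : ℕ) : rho N Qt n ≠ 0 := Complex.exp_ne_zero _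

lemma labelValue_zero (N n : ℕ) (θ : Fin n → ℂ) (f : Fin n → Fin N) :
    labelValue N 0 n θ f = 1 := by
  have : ∀ a, ¬(0 < (f a : ℕ) ∧ (f a : ℕ) ≤ 0) := fun a => by omega
  rw [labelValue, Finset.sum_congr rfl fun a _ => if_neg (this a)]
  simp [rho]

lemma labelValue_self {N Q : ℕ} (hQ : Q < N) (θ : Fin Q → ℂ) {f : Fin Q → Fin N}
    (hf : f ∈ labelings N Q (multiplicity N Q Q)) :
    labelValue N Q Q θ f = rho N Q Q * Complex.exp ((1 - (Q : ℂ) / N) * ∑ a, θ a) := by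
  rw [labelValue, Finset.sum_congr rfl fun a _ => if_pos (label_bounds hQ hf a)]
  congr 2
  ring

lemma hasIteratedResidue_paraFermi {N Q : ℕ} (h₀ : 1 ≤ Q) (hQ : Q < N) {E F : ℂ → ℂ}
    (hE : IsRegularPart N E F) (c : ℕ → ℂ) (x : ℂ) :
    HasIteratedResidue N Q (paraFermiFormFactor N F Q c Q) x
      (c Q * rho N Q Q * (∏ i : Fin Q, ∏ j ∈ Finset.Ioi i, orderedFactor N E (j - i)) *
        Complex.exp ((Q : ℂ) * ((N : ℂ) - Q) / N *
          (x + Complex.I * eta N * ((Q : ℂ) - 1) / 2))) := by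
  have hN : 2 ≤ N := by omega
  have hN0 : (N : ℂ) ≠ 0 := by
    rw [Nat.cast_ne_zero]
    omega
  obtain ⟨m, rfl⟩ : ∃ m, Q = m + 1 := ⟨Q - 1, by omega⟩
  have hspl : ∀ a : Fin (m + 1) → ℂ, splice a (fun _ : Fin (m + 1) => (0 : ℂ)) = a := by
    intro a
    ext i
    rw [splice_of_lt _ _ i.isLt]
  have h := hasIteratedResidue_formFactor hN hQ (x := x) (t := fun _ : Fin (m + 1) => (0 : ℂ))
    ⟨fun i _ hi _ => absurd i.isLt (by omega), fun i hi => absurd i.isLt (by omega)⟩ hE le_rfl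
    (m + 1) (m + 1) c (Nat.mod_eq_of_lt hQ)
  simp only [hspl] at h
  refine Eq.mp (congrArg (HasIteratedResidue N (m + 1) _ x) ?_) h
  rw [chainSum, Finset.sum_eq_single (standardLabeling hQ)]
  · have hmono : StrictMono (standardLabeling hQ) := by
      intro i j hij
      rw [Fin.lt_def] at hij ⊢
      simp only [standardLabeling]
      omega
    rw [prod_chainFactor_chain, prod_chainFactor_of_strictMono E hmono,
      labelValue_self hQ _ (standardLabeling_mem hQ)]
    have hsum : ∑ a, chain N m x a = (m + 1) * (x + Complex.I * eta N * m / 2) := by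
      have h1 : ∀ a : Fin (m + 1), chain N m x a =
          (x + m * (Complex.I * eta N)) + -(Complex.I * eta N) * (a : ℕ) := fun a => by
        rw [chain]
        ring
      rw [Finset.sum_congr rfl fun a _ => h1 a, Fin.sum_univ_eq_sum_range
        (fun a => (x + m * (Complex.I * eta N)) + -(Complex.I * eta N) * a), sum_range_linear]
      push_cast
      ring
    rw [hsum]
    have hexp : ((m + 1 : ℕ) : ℂ) * ((N : ℂ) - (m + 1 : ℕ)) / N *
        (x + Complex.I * eta N * (((m + 1 : ℕ) : ℂ) - 1) / 2) =
        (1 - ((m + 1 : ℕ) : ℂ) / N) * ((m + 1) * (x + Complex.I * eta N * m / 2)) := by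
      push_cast
      field_simp
      ring
    rw [hexp]
    ring
  · intro f hf hne
    rw [prod_chainFactor_chain, prod_chainFactor_of_not_strictMono, mul_zero]
    exact fun hmono => hne (eq_standardLabeling hQ hf hmono)
  · exact fun h => absurd (standardLabeling_mem hQ) h

lemma prod_orderedFactor_ne_zero {N Q : ℕ} (hQ : Q < N) {E F : ℂ → ℂ}
    (hE : IsRegularPart N E F) :
    ∏ i : Fin Q, ∏ j ∈ Finset.Ioi i, orderedFactor N E (j - i) ≠ 0 := by
  refine Finset.prod_ne_zero_iff.mpr fun i _ => Finset.prod_ne_zero_iff.mpr fun j hj => ?_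
  have : (i : ℕ) < j := Fin.lt_def.mp (Finset.mem_Ioi.mp hj)
  exact orderedFactor_ne_zero hE (by omega) (by omega)

end

end ZNIsing

theorem mainTheorem4 (N : ℕ) (hN : 2 ≤ N) :
    -- the p-functions of the fields `ψ_{Q,Q̃}` satisfy (i')-(v')
    (∀ Q < N, ∀ Qt < N, ZNIsing.IsPFunction N Q (ZNIsing.statistics N Qt) (ZNIsing.spin N Q Qt)
      (ZNIsing.pFunction N Qt)) ∧
    ∃ F : ℂ → ℂ, ZNIsing.IsMinimalFormFactor N F ∧
      -- normalization constants exist, with arbitrary `N_Q`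
      (∀ Q < N, ∀ c₀ : ℂ, ∃ c : ℕ → ℂ, c Q = c₀ ∧ ZNIsing.NormalizationRelation N Q F c) ∧
      -- the form factor equations of the fields `ψ_{Q,Q̃}`
      (∀ Q < N, ∀ Qt < N, ∀ c : ℕ → ℂ, ZNIsing.NormalizationRelation N Q F c →
        ZNIsing.IsFormFactorFamily N Q (ZNIsing.statistics N Qt) (ZNIsing.spin N Q Qt)
          (ZNIsing.formFactor N F Q Qt c)) ∧
      -- in particular order parameters, disorder parameters and para-fermi fields
      (∀ Q < N, ∀ c : ℕ → ℂ, ZNIsing.NormalizationRelation N Q F c →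
        ZNIsing.IsFormFactorFamily N Q 1 0 (ZNIsing.orderFormFactor N F Q c)) ∧
      (∀ Qt < N, ∀ c : ℕ → ℂ, ZNIsing.NormalizationRelation N 0 F c →
        ZNIsing.IsFormFactorFamily N 0 (ZNIsing.omega N ^ Qt) 0
          (ZNIsing.disorderFormFactor N F Qt c)) ∧
      (∀ Q < N, ∀ c : ℕ → ℂ, ZNIsing.NormalizationRelation N Q F c →
        ZNIsing.IsFormFactorFamily N Q (ZNIsing.omega N ^ Q) ((Q : ℂ) * ((N : ℂ) - Q) / N)
          (ZNIsing.paraFermiFormFactor N F Q c)) ∧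
      -- explicit examples, up to normalization constants
      (∀ c : ℕ → ℂ, c 1 ≠ 0 → ∃ C : ℂ, C ≠ 0 ∧ ∀ θ : Fin 1 → ℂ,
        ZNIsing.orderFormFactor N F 1 c 1 θ = C) ∧
      (3 ≤ N → ∀ c : ℕ → ℂ, c 2 ≠ 0 → ∃ C : ℂ, C ≠ 0 ∧ ∀ θ ∈ ZNIsing.generic N 2,
        ZNIsing.orderFormFactor N F 2 c 2 θ = C * (F (θ 0 - θ 1) /
          (Complex.sinh ((θ 0 - θ 1 - 2 * Real.pi * Complex.I / N) / 2) *
            Complex.sinh ((θ 0 - θ 1 + 2 * Real.pi * Complex.I / N) / 2)))) ∧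
      -- the one-particle form factor of `ψ_Q`; the particle of type `Q` and rapidity
      -- `x + i η (Q - 1) / 2` is the bound state of `Q` particles of type 1
      (∀ Q, 1 ≤ Q → Q < N → ∀ c : ℕ → ℂ, c Q ≠ 0 → ∃ C : ℂ, C ≠ 0 ∧ ∀ x : ℂ,
        ZNIsing.HasIteratedResidue N Q (ZNIsing.paraFermiFormFactor N F Q c Q) x
          (C * Complex.exp ((Q : ℂ) * ((N : ℂ) - Q) / N *
            (x + Complex.I * ZNIsing.eta N * ((Q : ℂ) - 1) / 2)))) ∧
      (3 ≤ N → ∀ c : ℕ → ℂ, c 2 ≠ 0 → ∃ C : ℂ, C ≠ 0 ∧ ∀ θ ∈ ZNIsing.generic N 2,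
        ZNIsing.paraFermiFormFactor N F 2 c 2 θ = C * (Complex.exp ((1 - 2 / (N : ℂ)) *
          (θ 0 + θ 1)) * F (θ 0 - θ 1) /
          (Complex.sinh ((θ 0 - θ 1 - 2 * Real.pi * Complex.I / N) / 2) *
            Complex.sinh ((θ 0 - θ 1 + 2 * Real.pi * Complex.I / N) / 2)))) := by
  have hE := ZNIsing.isRegularPart hN
  refine ⟨fun Q _ Qt hQt => ZNIsing.isPFunction hN hQt, ZNIsing.minimalFormFactor N,
    ZNIsing.isMinimalFormFactor hN, fun Q hQ c₀ => ZNIsing.exists_normalization hN hE hQ c₀,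
    fun Q _ Qt hQt c hc => ZNIsing.isFormFactorFamily hN hE hQt hc, ?_, ?_, ?_, ?_, ?_, ?_, ?_⟩
  · intro Q _ c hc
    have h := ZNIsing.isFormFactorFamily hN hE (Qt := 0) (by omega) hc
    rwa [ZNIsing.statistics_zero, ZNIsing.spin_zero_right] at h
  · intro Qt hQt c hc
    have h := ZNIsing.isFormFactorFamily hN hE hQt hc
    rwa [ZNIsing.spin_zero_left] at h
  · intro Q hQ c hc
    have h := ZNIsing.isFormFactorFamily hN hE hQ hc
    rwa [ZNIsing.spin_self hN] at h
  · intro c hc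
    exact ⟨c 1, hc, fun θ => ZNIsing.orderFormFactor_one hN hE c θ⟩
  · intro hN3 c hc
    refine ⟨c 2 * (2 * Complex.cosh (Complex.I * ZNIsing.eta N / 2)),
      mul_ne_zero hc (mul_ne_zero two_ne_zero (ZNIsing.cosh_half_ne_zero hN3)), fun θ hθ => ?_⟩
    have h := ZNIsing.formFactor_two hN3 hE 0 c hθ fun f _ => ZNIsing.labelValue_zero N 2 θ f
    rwa [one_mul] at h
  · intro Q h₀ hQ c hc
    exact ⟨_, mul_ne_zero (mul_ne_zero hc (ZNIsing.rho_ne_zero N Q Q))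
      (ZNIsing.prod_orderedFactor_ne_zero hQ hE),
      fun x => ZNIsing.hasIteratedResidue_paraFermi h₀ hQ hE c x⟩
  · intro hN3 c hc
    refine ⟨c 2 * (2 * Complex.cosh (Complex.I * ZNIsing.eta N / 2)) * ZNIsing.rho N 2 2,
      mul_ne_zero (mul_ne_zero hc (mul_ne_zero two_ne_zero (ZNIsing.cosh_half_ne_zero hN3)))
        (ZNIsing.rho_ne_zero N 2 2), fun θ hθ => ?_⟩
    have h := ZNIsing.formFactor_two hN3 hE 2 c hθ fun f hf => ZNIsing.labelValue_self hN3 θ hf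
    rw [Fin.sum_univ_two, Nat.cast_ofNat] at h
    refine h.trans ?_
    ring
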